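/- **Conventions.** Fix a universe ("small" refers to it). For a groupoid $\mathcal V$ let $\mathcal V^{\otimes}$ be the free symmetric monoidal category on $\mathcal V$. A *Feynman category* $\mathfrak F=(\mathcal V,\mathcal F,\imath)$ consists of a groupoid $\mathcal V$, a symmetric monoidal category $\mathcal F$ and a functor $\imath:\mathcal V\to\mathcal F$ such that (i) $\imath$ induces an equivalence $\mathcal V^{\otimes}\simeq \mathrm{Iso}(\mathcal F)$; (ii) $\imath$ and the tensor product of morphisms induce an equivalence $\mathrm{Iso}(\mathcal F\downarrow\mathcal V)^{\otimes}\simeq \mathrm{Iso}(\mathcal F\downarrow\mathcal F)$; (iii) $(\mathcal F\downarrow \imath(*))$ is essentially small for every $*\in\mathcal V$. A *morphism* $(v,f):\mathfrak F\to\mathfrak F'$ of Feynman categories is a functor $v:\mathcal V\to\mathcal V'$ and a strong symmetric monoidal functor $f:\mathcal F\to\mathcal F'$ together with an isomorphism $f\imath\cong\imath' v$. Let $\mathcal C$ be a cocomplete (for small diagrams), locally small symmetric monoidal category whose tensor product preserves small colimits in each variable. For a symmetric monoidal category $\mathcal A$, $\mathcal A\text{-}\mathcal Ops$ is the category of strong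 symmetric monoidal functors $\mathcal A\to\mathcal C$ and monoidal natural transformations. For a strong symmetric monoidal functor $g:\mathcal A\to\mathcal B$ let $g^*:\mathcal B\text{-}\mathcal Ops\to\mathcal A\text{-}\mathcal Ops$ be precomposition with $g$. A *pushforward* along $g$ is a left adjoint $g_*\dashv g^*$ which is computed pointwise by $$ (g_*\mathcal O)(Y)=\operatorname{colim}_{(g\downarrow Y)}\mathcal O\circ P,\qquad P(X,\,gX\to Y)=X, $$ the unit $\mathcal O\to g^*g_*\mathcal O$ being given by the structure maps of these colimits (that is, it exhibits $g_*\mathcal O$ as a pointwise left Kan extension of $\mathcal O$ along $g$). **Decorations.** Let $\mathcal O\in\mathcal F\text{-}\mathcal Ops$. An element of $\mathcal O(X)$ is a morphism $a:\mathbb 1\to\mathcal O(X)$ in $\mathcal C$; elements $a$ of $\mathcal O(X)$ and $b$ of $\mathcal O(Y)$ have a product $a\otimes b$, an element of $\mathcal O(X\otimes Y)$. The decorated symmetric monoidal category $\mathcal F_{dec\,\mathcal O}$ is the following one. * *Cartesian version* (if $\mathcal C$ is Cartesian, i.e. its unit is terminal and its tensor product is the categorical product): objects are pairs $(X,a)$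 with $a$ an element of $\mathcal O(X)$; morphisms $(X,a)\to(Y,b)$ are morphisms $\phi:X\to Y$ with $\mathcal O(\phi)\circ a=b$; and $(X,a)\otimes(Y,b)=(X\otimes Y,a\otimes b)$. * *General version* (any $\mathcal C$): objects are objects $X$ with a decomposition $\bigotimes_{w}\imath(w)\cong X$ and an element $a_w$ of $\mathcal O(\imath(w))$ for each factor; morphisms to $(Y,\bigotimes_v\imath(v)\cong Y,(b_v)_v)$ are those $\phi:X\to Y$ which, along the decompositions and up to reordering the factors $w$ (and replacing $w$, $a_w$ by isomorphic decorated vertices), are of the form $\bigotimes_v\phi_v$ with $\phi_v:\bigotimes_{w\in I_v}\imath(w)\to\imath(v)$ and $\mathcal O(\phi_v)\circ\bigotimes_{w\in I_v}a_w=b_v$ for every $v$; the tensor product juxtaposes decompositions and elements. In both versions $forget:\mathcal F_{dec\,\mathcal O}\to\mathcal F$ forgets the decoration. Given a morphism $(v,f):\mathfrak F\to\mathfrak F'$ and a pushforward $f_*$ with unit $\eta:\mathcal O\to f^*f_*\mathcal O$, let $f^{\mathcal O}:\mathcal F_{dec\,\mathcal O}\to\mathcal F'_{dec\,f_*\mathcal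 O}$ be the strong symmetric monoidal functor which is $f$ on underlying objects and morphisms and which is given on decorations by $a\mapsto\eta_X\circ a$ (Cartesian version), respectively by the induced decomposition of $f(X)$ into the vertices $v(w)$ with the elements $\eta_{\imath(w)}\circ a_w$, transported along $f\imath(w)\cong\imath'v(w)$ (general version). With $forget':\mathcal F'_{dec\,f_*\mathcal O}\to\mathcal F'$ one has $forget'\circ f^{\mathcal O}=f\circ forget$. **Corollary.** Let $(v,f):\mathfrak F\to\mathfrak F'$ be a morphism of Feynman categories such that $(f\downarrow X')$ is essentially small for every $X'\in\mathcal F'$. Then a pushforward $f_*:\mathcal F\text{-}\mathcal Ops\to\mathcal F'\text{-}\mathcal Ops$ along $f$ exists. Moreover, for every choice of $f_*$ and every $\mathcal O\in\mathcal F\text{-}\mathcal Ops$, both for the general version of decorations and, if $\mathcal C$ is Cartesian, for the Cartesian version, pushforwards $f^{\mathcal O}_*$, $forget_*$ and $forget'_*$ exist, so that there is a square of adjoint pairs $$\begin{array}{ccc}\mathcal F_{dec\,\mathcal O}\text{-}\mathcal Ops&\underset{f^{\mathcal O*}}{\overset{f^{\mathcal O}_*}{\rightleftarrows}}&\mathcal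 F'_{dec\,f_*\mathcal O}\text{-}\mathcal Ops\\[4pt] forget_*\downarrow\uparrow forget^*&&forget'_*\downarrow\uparrow forget'^*\\[4pt]\mathcal F\text{-}\mathcal Ops&\underset{f^*}{\overset{f_*}{\rightleftarrows}}&\mathcal F'\text{-}\mathcal Ops\end{array}$$ and for every choice of these pushforwards the square of left adjoints commutes up to isomorphism: the natural transformation $forget'_*\circ f^{\mathcal O}_*\to f_*\circ forget_*$ which corresponds under the adjunctions to the canonical isomorphism of right adjoints $f^{\mathcal O*}\circ forget'^*\cong forget^*\circ f^*$ is an isomorphism. -/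

import Mathlib

open CategoryTheory MonoidalCategory Limits

universe w t t' u₁ v₁ u₂ v₂ u₃ v₃ u₄ v₄ u₅ v₅

set_option linter.unusedSectionVars false

namespace FeynmanDec

/-- Objects of the free symmetric monoidal category on `V`: formal tensor words. -/
inductive FreeSym (V : Type u₁) : Type u₁
  | of : V → FreeSym V
  | unit : FreeSym V
  | tensor : FreeSym V → FreeSym V → FreeSym V

namespace FreeSym

section Construction

variable (V : Type u₁) [Category.{v₁} V]

/-- Formal morphisms of the free symmetric monoidal category on a category `V`. -/
inductive PreHom : FreeSym V → FreeSym V → Type (max u₁ v₁)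
  | of {a b : V} (g : a ⟶ b) : PreHom (.of a) (.of b)
  | id (X) : PreHom X X
  | comp {X Y Z} (f : PreHom X Y) (g : PreHom Y Z) : PreHom X Z
  | tensor {X Y X' Y'} (f : PreHom X Y) (g : PreHom X' Y') :
      PreHom (.tensor X X') (.tensor Y Y')
  | assocHom (X Y Z) : PreHom (.tensor (.tensor X Y) Z) (.tensor X (.tensor Y Z))
  | assocInv (X Y Z) : PreHom (.tensor X (.tensor Y Z)) (.tensor (.tensor X Y) Z)
  | leftHom (X) : PreHom (.tensor .unit X) X
  | leftInv (X) : PreHom X (.tensor .unit X)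
  | rightHom (X) : PreHom (.tensor X .unit) X
  | rightInv (X) : PreHom X (.tensor X .unit)
  | braid (X Y) : PreHom (.tensor X Y) (.tensor Y X)

/-- The congruence generated by functoriality of `V → V^⊗` and by the axioms of a
symmetric monoidal category. -/
inductive Eqv : ∀ {X Y : FreeSym V}, PreHom V X Y → PreHom V X Y → Prop
  | refl {X Y} (f : PreHom V X Y) : Eqv f f
  | symm {X Y} {f g : PreHom V X Y} : Eqv f g → Eqv g f
  | trans {X Y} {f g h : PreHom V X Y} : Eqv f g → Eqv g h → Eqv f h
  | comp_congr {X Y Z} {f f' : PreHom V X Y} {g g' : PreHom V Y Z} :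
      Eqv f f' → Eqv g g' → Eqv (.comp f g) (.comp f' g')
  | tensor_congr {X Y X' Y'} {f f' : PreHom V X Y} {g g' : PreHom V X' Y'} :
      Eqv f f' → Eqv g g' → Eqv (.tensor f g) (.tensor f' g')
  | of_id (a : V) : Eqv (.of (𝟙 a)) (.id (.of a))
  | of_comp {a b c : V} (g : a ⟶ b) (h : b ⟶ c) :
      Eqv (.of (g ≫ h)) (.comp (.of g) (.of h))
  | id_comp {X Y} (f : PreHom V X Y) : Eqv (.comp (.id X) f) f
  | comp_id {X Y} (f : PreHom V X Y) : Eqv (.comp f (.id Y)) f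
  | assoc {X Y Z W} (f : PreHom V X Y) (g : PreHom V Y Z) (h : PreHom V Z W) :
      Eqv (.comp (.comp f g) h) (.comp f (.comp g h))
  | tensor_id (X Y) : Eqv (.tensor (.id X) (.id Y)) (.id (.tensor X Y))
  | tensor_comp {X Y Z X' Y' Z'} (f : PreHom V X Y) (f' : PreHom V X' Y')
      (g : PreHom V Y Z) (g' : PreHom V Y' Z') :
      Eqv (.comp (.tensor f f') (.tensor g g')) (.tensor (.comp f g) (.comp f' g'))
  | assoc_hom_inv (X Y Z) : Eqv (.comp (.assocHom X Y Z) (.assocInv X Y Z)) (.id _)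
  | assoc_inv_hom (X Y Z) : Eqv (.comp (.assocInv X Y Z) (.assocHom X Y Z)) (.id _)
  | assoc_nat {X Y Z X' Y' Z'} (f : PreHom V X X') (g : PreHom V Y Y') (h : PreHom V Z Z') :
      Eqv (.comp (.tensor (.tensor f g) h) (.assocHom X' Y' Z'))
        (.comp (.assocHom X Y Z) (.tensor f (.tensor g h)))
  | left_hom_inv (X) : Eqv (.comp (.leftHom X) (.leftInv X)) (.id _)
  | left_inv_hom (X) : Eqv (.comp (.leftInv X) (.leftHom X)) (.id _)
  | left_nat {X Y} (f : PreHom V X Y) :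
      Eqv (.comp (.tensor (.id .unit) f) (.leftHom Y)) (.comp (.leftHom X) f)
  | right_hom_inv (X) : Eqv (.comp (.rightHom X) (.rightInv X)) (.id _)
  | right_inv_hom (X) : Eqv (.comp (.rightInv X) (.rightHom X)) (.id _)
  | right_nat {X Y} (f : PreHom V X Y) :
      Eqv (.comp (.tensor f (.id .unit)) (.rightHom Y)) (.comp (.rightHom X) f)
  | pentagon (W X Y Z) :
      Eqv (.comp (.tensor (.assocHom W X Y) (.id Z))
          (.comp (.assocHom W (.tensor X Y) Z) (.tensor (.id W) (.assocHom X Y Z))))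
        (.comp (.assocHom (.tensor W X) Y Z) (.assocHom W X (.tensor Y Z)))
  | triangle (X Y) :
      Eqv (.comp (.assocHom X .unit Y) (.tensor (.id X) (.leftHom Y)))
        (.tensor (.rightHom X) (.id Y))
  | braid_braid (X Y) : Eqv (.comp (.braid X Y) (.braid Y X)) (.id _)
  | braid_nat {X Y X' Y'} (f : PreHom V X Y) (g : PreHom V X' Y') :
      Eqv (.comp (.tensor f g) (.braid Y Y')) (.comp (.braid X X') (.tensor g f))
  | hexagon (X Y Z) :
      Eqv (.comp (.assocHom X Y Z) (.comp (.braid X (.tensor Y Z)) (.assocHom Y Z X)))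
        (.comp (.tensor (.braid X Y) (.id Z))
          (.comp (.assocHom Y X Z) (.tensor (.id Y) (.braid X Z))))

/-- The setoid of formal morphisms. -/
instance setoidHom (X Y : FreeSym V) : Setoid (PreHom V X Y) :=
  ⟨Eqv V, Eqv.refl, Eqv.symm, Eqv.trans⟩

variable {V}

instance : Category.{max u₁ v₁} (FreeSym V) where
  Hom X Y := Quotient (setoidHom V X Y)
  id X := ⟦.id X⟧
  comp := Quotient.map₂ .comp fun _ _ hf _ _ hg => .comp_congr hf hg
  id_comp := by rintro _ _ ⟨f⟩; exact Quotient.sound (.id_comp f)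
  comp_id := by rintro _ _ ⟨f⟩; exact Quotient.sound (.comp_id f)
  assoc := by rintro _ _ _ _ ⟨f⟩ ⟨g⟩ ⟨h⟩; exact Quotient.sound (.assoc f g h)

instance : MonoidalCategoryStruct (FreeSym V) where
  tensorObj := .tensor
  tensorHom := Quotient.map₂ .tensor fun _ _ hf _ _ hg => .tensor_congr hf hg
  whiskerLeft X _ _ f := Quotient.map₂ .tensor (fun _ _ hf _ _ hg => .tensor_congr hf hg)
    ⟦.id X⟧ f
  whiskerRight f Y := Quotient.map₂ .tensor (fun _ _ hf _ _ hg => .tensor_congr hf hg)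
    f ⟦.id Y⟧
  tensorUnit := .unit
  associator X Y Z := ⟨⟦.assocHom X Y Z⟧, ⟦.assocInv X Y Z⟧,
    Quotient.sound (.assoc_hom_inv X Y Z), Quotient.sound (.assoc_inv_hom X Y Z)⟩
  leftUnitor X := ⟨⟦.leftHom X⟧, ⟦.leftInv X⟧,
    Quotient.sound (.left_hom_inv X), Quotient.sound (.left_inv_hom X)⟩
  rightUnitor X := ⟨⟦.rightHom X⟧, ⟦.rightInv X⟧,
    Quotient.sound (.right_hom_inv X), Quotient.sound (.right_inv_hom X)⟩

instance : MonoidalCategory (FreeSym V) := MonoidalCategory.ofTensorHom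
  (id_tensorHom_id := fun X Y => Quotient.sound (.tensor_id X Y))
  (id_tensorHom := fun _ _ _ _ => rfl)
  (tensorHom_id := fun _ _ => rfl)
  (tensorHom_comp_tensorHom := by
    rintro _ _ _ _ _ _ ⟨f⟩ ⟨f'⟩ ⟨g⟩ ⟨g'⟩; exact Quotient.sound (.tensor_comp f f' g g'))
  (associator_naturality := by
    rintro _ _ _ _ _ _ ⟨f⟩ ⟨g⟩ ⟨h⟩; exact Quotient.sound (.assoc_nat f g h))
  (leftUnitor_naturality := by rintro _ _ ⟨f⟩; exact Quotient.sound (.left_nat f))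
  (rightUnitor_naturality := by rintro _ _ ⟨f⟩; exact Quotient.sound (.right_nat f))
  (pentagon := fun W X Y Z => Quotient.sound (.pentagon W X Y Z))
  (triangle := fun X Y => Quotient.sound (.triangle X Y))

/-- The symmetry of the free symmetric monoidal category. -/
def braidIso (X Y : FreeSym V) : X ⊗ Y ≅ Y ⊗ X :=
  ⟨⟦.braid X Y⟧, ⟦.braid Y X⟧,
    Quotient.sound (.braid_braid X Y), Quotient.sound (.braid_braid Y X)⟩

lemma hexagon (X Y Z : FreeSym V) :
    α_ X Y Z ≪≫ braidIso X (Y ⊗ Z) ≪≫ α_ Y Z X =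
      whiskerRightIso (braidIso X Y) Z ≪≫ α_ Y X Z ≪≫ whiskerLeftIso Y (braidIso X Z) :=
  Iso.ext (Quotient.sound (.hexagon X Y Z))

instance : SymmetricCategory (FreeSym V) where
  braiding := braidIso
  braiding_naturality_right X _ _ := by
    rintro ⟨f⟩; exact Quotient.sound (.braid_nat (.id X) f)
  braiding_naturality_left := by
    rintro _ _ ⟨f⟩ Z; exact Quotient.sound (.braid_nat f (.id Z))
  hexagon_forward X Y Z := congrArg Iso.hom (hexagon X Y Z)
  hexagon_reverse X Y Z := by
    have h := congrArg Iso.inv (hexagon Z X Y)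
    simp only [Iso.trans_inv, whiskerRightIso_inv, whiskerLeftIso_inv, Category.assoc] at h
    exact h
  symmetry X Y := Quotient.sound (.braid_braid X Y)

/-- The canonical functor `V → V^⊗`. -/
def incl : V ⥤ FreeSym V where
  obj := .of
  map g := ⟦.of g⟧
  map_id a := Quotient.sound (.of_id a)
  map_comp g h := Quotient.sound (.of_comp g h)

/-- Induction principle for morphisms of the free symmetric monoidal category. -/
lemma hom_induction {P : ∀ {X Y : FreeSym V}, (X ⟶ Y) → Prop}
    (of : ∀ {a b : V} (g : a ⟶ b), P (incl.map g))
    (id : ∀ X : FreeSym V, P (𝟙 X))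
    (comp : ∀ {X Y Z : FreeSym V} (f : X ⟶ Y) (g : Y ⟶ Z), P f → P g → P (f ≫ g))
    (tensor : ∀ {X Y X' Y' : FreeSym V} (f : X ⟶ Y) (g : X' ⟶ Y'), P f → P g → P (f ⊗ₘ g))
    (assocHom : ∀ X Y Z : FreeSym V, P (α_ X Y Z).hom)
    (assocInv : ∀ X Y Z : FreeSym V, P (α_ X Y Z).inv)
    (leftHom : ∀ X : FreeSym V, P (λ_ X).hom) (leftInv : ∀ X : FreeSym V, P (λ_ X).inv)
    (rightHom : ∀ X : FreeSym V, P (ρ_ X).hom) (rightInv : ∀ X : FreeSym V, P (ρ_ X).inv)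
    (braid : ∀ X Y : FreeSym V, P (β_ X Y).hom) {X Y : FreeSym V} (s : X ⟶ Y) : P s := by
  induction s using Quotient.inductionOn with | _ f
  induction f with
  | of g => exact of g
  | id X => exact id X
  | comp f g hf hg => exact comp _ _ hf hg
  | tensor f g hf hg => exact tensor _ _ hf hg
  | assocHom X Y Z => exact assocHom X Y Z
  | assocInv X Y Z => exact assocInv X Y Z
  | leftHom X => exact leftHom X
  | leftInv X => exact leftInv X
  | rightHom X => exact rightHom X
  | rightInv X => exact rightInv X
  | braid X Y => exact braid X Y

end Construction

section Groupoid

variable {V : Type u₁} [Groupoid.{v₁} V]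

lemma isIso_hom {X Y : FreeSym V} (s : X ⟶ Y) : IsIso s := by
  induction s using hom_induction with
  | of g => infer_instance
  | id X => infer_instance
  | comp f g hf hg => infer_instance
  | tensor f g hf hg => infer_instance
  | assocHom X Y Z => infer_instance
  | assocInv X Y Z => infer_instance
  | leftHom X => infer_instance
  | leftInv X => infer_instance
  | rightHom X => infer_instance
  | rightInv X => infer_instance
  | braid X Y => infer_instance

/-- The free symmetric monoidal category on a groupoid is a groupoid. -/
noncomputable instance : Groupoid.{max u₁ v₁} (FreeSym V) :=
  Groupoid.ofIsIso fun s => isIso_hom s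

end Groupoid

section Lift

variable {V : Type u₁} [Category.{v₁} V] {A : Type u₂} [Category.{v₂} A] [MonoidalCategory A]
  [SymmetricCategory A]

/-- The object part of the extension of `G : V → A` to tensor words. -/
def liftObj (G : V ⥤ A) : FreeSym V → A
  | .of a => G.obj a
  | .unit => 𝟙_ A
  | .tensor X Y => liftObj G X ⊗ liftObj G Y

/-- The extension of `G : V → A` to formal morphisms. -/
def liftPreHom (G : V ⥤ A) : ∀ {X Y : FreeSym V}, PreHom V X Y → (liftObj G X ⟶ liftObj G Y)
  | _, _, .of g => G.map g
  | _, _, .id _ => 𝟙 _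
  | _, _, .comp f g => liftPreHom G f ≫ liftPreHom G g
  | _, _, .tensor f g => liftPreHom G f ⊗ₘ liftPreHom G g
  | _, _, .assocHom _ _ _ => (α_ _ _ _).hom
  | _, _, .assocInv _ _ _ => (α_ _ _ _).inv
  | _, _, .leftHom _ => (λ_ _).hom
  | _, _, .leftInv _ => (λ_ _).inv
  | _, _, .rightHom _ => (ρ_ _).hom
  | _, _, .rightInv _ => (ρ_ _).inv
  | _, _, .braid _ _ => (β_ _ _).hom

lemma liftPreHom_eqv (G : V ⥤ A) {X Y : FreeSym V} {f g : PreHom V X Y} (h : Eqv V f g) :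
    liftPreHom G f = liftPreHom G g := by
  induction h with
  | refl => rfl
  | symm _ ih => exact ih.symm
  | trans _ _ ih ih' => exact ih.trans ih'
  | comp_congr _ _ ih ih' => simp only [liftPreHom, ih, ih']
  | tensor_congr _ _ ih ih' => exact congrArg₂ (fun a b => a ⊗ₘ b) ih ih'
  | of_id a => exact G.map_id a
  | of_comp g h => exact G.map_comp g h
  | id_comp => simp only [liftPreHom, Category.id_comp]
  | comp_id => simp only [liftPreHom, Category.comp_id]
  | assoc => simp only [liftPreHom, Category.assoc]
  | tensor_id X Y => exact id_tensorHom_id _ _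
  | tensor_comp => exact tensorHom_comp_tensorHom _ _ _ _
  | assoc_hom_inv => exact Iso.hom_inv_id _
  | assoc_inv_hom => exact Iso.inv_hom_id _
  | assoc_nat => exact associator_naturality _ _ _
  | left_hom_inv => exact Iso.hom_inv_id _
  | left_inv_hom => exact Iso.inv_hom_id _
  | left_nat f => simp [liftPreHom, liftObj]
  | right_hom_inv => exact Iso.hom_inv_id _
  | right_inv_hom => exact Iso.inv_hom_id _
  | right_nat f => simp [liftPreHom, liftObj]
  | pentagon => simp [liftPreHom, liftObj]
  | triangle => simp [liftPreHom, liftObj]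
  | braid_braid => exact SymmetricCategory.symmetry _ _
  | braid_nat => exact BraidedCategory.braiding_naturality _ _
  | hexagon => simp [liftPreHom, liftObj]

/-- The symmetric monoidal functor `G^⊗ : V^⊗ → A` induced by a functor `G : V → A` to a
symmetric monoidal category. -/
def lift (G : V ⥤ A) : FreeSym V ⥤ A where
  obj := liftObj G
  map := Quotient.lift (liftPreHom G) fun _ _ h => liftPreHom_eqv G h
  map_id _ := rfl
  map_comp := by rintro _ _ _ ⟨f⟩ ⟨g⟩; rfl

lemma lift_map_tensor (G : V ⥤ A) {X Y X' Y' : FreeSym V} (f : X ⟶ Y) (g : X' ⟶ Y') :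
    (lift G).map (f ⊗ₘ g) = ((lift G).map f ⊗ₘ (lift G).map g) := by
  obtain ⟨f⟩ := f; obtain ⟨g⟩ := g; rfl

lemma lift_map_whiskerRight (G : V ⥤ A) {X Y : FreeSym V} (f : X ⟶ Y) (Z : FreeSym V) :
    (lift G).map (f ▷ Z) = (lift G).map f ▷ (lift G).obj Z := by
  rw [← tensorHom_id, lift_map_tensor]
  exact tensorHom_id _ _

lemma lift_map_whiskerLeft (G : V ⥤ A) (Z : FreeSym V) {X Y : FreeSym V} (f : X ⟶ Y) :
    (lift G).map (Z ◁ f) = (lift G).obj Z ◁ (lift G).map f := by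
  rw [← id_tensorHom, lift_map_tensor]
  exact id_tensorHom _ _

/-- `G^⊗` is strictly symmetric monoidal. -/
instance liftMonoidal (G : V ⥤ A) : (lift G).Monoidal :=
  Functor.CoreMonoidal.toMonoidal
    { εIso := Iso.refl _
      μIso := fun _ _ => Iso.refl _
      μIso_hom_natural_left := fun f X' => (Category.comp_id _).trans
        ((lift_map_whiskerRight G f X').symm.trans (Category.id_comp _).symm)
      μIso_hom_natural_right := fun X' f => (Category.comp_id _).trans
        ((lift_map_whiskerLeft G X' f).symm.trans (Category.id_comp _).symm)
      associativity := fun X Y Z => by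
        change 𝟙 (liftObj G X ⊗ liftObj G Y) ▷ liftObj G Z ≫
          𝟙 ((liftObj G X ⊗ liftObj G Y) ⊗ liftObj G Z) ≫
            (α_ (liftObj G X) (liftObj G Y) (liftObj G Z)).hom =
          (α_ (liftObj G X) (liftObj G Y) (liftObj G Z)).hom ≫
            liftObj G X ◁ 𝟙 (liftObj G Y ⊗ liftObj G Z) ≫
              𝟙 (liftObj G X ⊗ (liftObj G Y ⊗ liftObj G Z))
        simp
      left_unitality := fun X => by
        change (λ_ (liftObj G X)).hom = 𝟙 (𝟙_ A) ▷ liftObj G X ≫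
          𝟙 (𝟙_ A ⊗ liftObj G X) ≫ (λ_ (liftObj G X)).hom
        simp
      right_unitality := fun X => by
        change (ρ_ (liftObj G X)).hom = liftObj G X ◁ 𝟙 (𝟙_ A) ≫
          𝟙 (liftObj G X ⊗ 𝟙_ A) ≫ (ρ_ (liftObj G X)).hom
        simp }

instance (G : V ⥤ A) : (lift G).Braided where
  braided X Y := by
    change 𝟙 (liftObj G X ⊗ liftObj G Y) ≫ (β_ (liftObj G X) (liftObj G Y)).hom =
      (β_ (liftObj G X) (liftObj G Y)).hom ≫ 𝟙 (liftObj G Y ⊗ liftObj G X)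
    simp

/-- Functoriality of `G ↦ G^⊗`: components. -/
def liftApp {G H : V ⥤ A} (τ : G ⟶ H) : ∀ X : FreeSym V, (lift G).obj X ⟶ (lift H).obj X
  | .of a => τ.app a
  | .unit => 𝟙 _
  | .tensor X Y => liftApp τ X ⊗ₘ liftApp τ Y

/-- Functoriality of `G ↦ G^⊗`. -/
def liftTrans {G H : V ⥤ A} (τ : G ⟶ H) : lift G ⟶ lift H where
  app := liftApp τ
  naturality X Y s := by
    induction s using hom_induction with
    | of g => exact τ.naturality g
    | id X => simp
    | comp f g hf hg => simp [hg, reassoc_of% hf]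
    | tensor f g hf hg =>
      simp only [lift_map_tensor]
      exact (tensorHom_comp_tensorHom _ _ _ _).trans
        ((congrArg₂ (· ⊗ₘ ·) hf hg).trans (tensorHom_comp_tensorHom _ _ _ _).symm)
    | assocHom X Y Z =>
      exact (associator_naturality (liftApp τ X) (liftApp τ Y) (liftApp τ Z)).symm
    | assocInv X Y Z =>
      exact (associator_inv_naturality (liftApp τ X) (liftApp τ Y) (liftApp τ Z)).symm
    | leftHom X =>
      exact ((congrArg (· ≫ _) (id_tensorHom _ _)).trans
        (leftUnitor_naturality (liftApp τ X))).symm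
    | leftInv X =>
      exact ((leftUnitor_inv_naturality (liftApp τ X)).trans
        (congrArg (_ ≫ ·) (id_tensorHom _ _).symm)).symm
    | rightHom X =>
      exact ((congrArg (· ≫ _) (tensorHom_id _ _)).trans
        (rightUnitor_naturality (liftApp τ X))).symm
    | rightInv X =>
      exact ((rightUnitor_inv_naturality (liftApp τ X)).trans
        (congrArg (_ ≫ ·) (tensorHom_id _ _).symm)).symm
    | braid X Y =>
      exact (BraidedCategory.braiding_naturality (liftApp τ X) (liftApp τ Y)).symm

end Lift

section Conj

variable {W : Type u₁} [Category.{v₁} W] [MonoidalCategory W] {A : Type u₂} [Category.{v₂} A]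
  [MonoidalCategory A] (K L : W ⥤ A) [K.Monoidal] [L.Monoidal]

open Functor.LaxMonoidal Functor.OplaxMonoidal

lemma conj_assoc {x y z x' y' z' : W} (k : K.obj x ⟶ L.obj x') (l : K.obj y ⟶ L.obj y')
    (m : K.obj z ⟶ L.obj z') :
    K.map (α_ x y z).hom ≫ δ K x (y ⊗ z) ≫ (k ⊗ₘ (δ K y z ≫ (l ⊗ₘ m) ≫ μ L y' z')) ≫
        μ L x' (y' ⊗ z') =
      (δ K (x ⊗ y) z ≫ ((δ K x y ≫ (k ⊗ₘ l) ≫ μ L x' y') ⊗ₘ m) ≫ μ L (x' ⊗ y') z') ≫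
        L.map (α_ x' y' z').hom := by
  simp only [Functor.Monoidal.map_associator, Category.assoc,
    Functor.Monoidal.μ_δ_assoc, ← id_tensorHom, ← tensorHom_id, tensorHom_comp_tensorHom_assoc,
    Category.id_comp, Category.comp_id, Functor.Monoidal.μ_δ]
  congr 1
  have h₁ : (k ⊗ₘ (l ⊗ₘ m) ≫ μ L y' z') = (k ⊗ₘ (l ⊗ₘ m)) ≫ (𝟙 _ ⊗ₘ μ L y' z') := by
    rw [tensorHom_comp_tensorHom, Category.comp_id]
  have h₂ : (δ K x y ≫ (k ⊗ₘ l) ⊗ₘ m) = (δ K x y ⊗ₘ 𝟙 _) ≫ ((k ⊗ₘ l) ⊗ₘ m) := by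
    rw [tensorHom_comp_tensorHom, Category.id_comp]
  rw [h₁, h₂, Category.assoc, Category.assoc, associator_naturality_assoc]

lemma conj_assoc_inv {x y z x' y' z' : W} (k : K.obj x ⟶ L.obj x') (l : K.obj y ⟶ L.obj y')
    (m : K.obj z ⟶ L.obj z') :
    K.map (α_ x y z).inv ≫ δ K (x ⊗ y) z ≫ ((δ K x y ≫ (k ⊗ₘ l) ≫ μ L x' y') ⊗ₘ m) ≫
        μ L (x' ⊗ y') z' =
      (δ K x (y ⊗ z) ≫ (k ⊗ₘ (δ K y z ≫ (l ⊗ₘ m) ≫ μ L y' z')) ≫ μ L x' (y' ⊗ z')) ≫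
        L.map (α_ x' y' z').inv := by
  rw [← cancel_mono (L.map (α_ x' y' z').hom), Category.assoc, Category.assoc _ (L.map _),
    ← L.map_comp, Iso.inv_hom_id, L.map_id, Category.comp_id, ← conj_assoc, ← K.map_comp_assoc]
  simp

lemma conj_left {x x' : W} (k : K.obj x ⟶ L.obj x') :
    K.map (λ_ x).hom ≫ k =
      (δ K (𝟙_ W) x ≫ (η K ≫ ε L ⊗ₘ k) ≫ μ L (𝟙_ W) x') ≫ L.map (λ_ x').hom := by
  simp only [MonoidalCategory.tensorHom_def', comp_whiskerRight, Category.assoc]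
  rw [← Functor.LaxMonoidal.left_unitality, Functor.Monoidal.map_leftUnitor,
    whisker_exchange_assoc]
  simp

lemma conj_right {x x' : W} (k : K.obj x ⟶ L.obj x') :
    K.map (ρ_ x).hom ≫ k =
      (δ K x (𝟙_ W) ≫ (k ⊗ₘ η K ≫ ε L) ≫ μ L x' (𝟙_ W)) ≫ L.map (ρ_ x').hom := by
  simp only [MonoidalCategory.tensorHom_def, MonoidalCategory.whiskerLeft_comp, Category.assoc]
  rw [← Functor.LaxMonoidal.right_unitality, Functor.Monoidal.map_rightUnitor,
    ← whisker_exchange_assoc]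
  simp

lemma arr_assoc {x y z : W} {X Y Z : A} (k : K.obj x ⟶ X) (l : K.obj y ⟶ Y) (m : K.obj z ⟶ Z) :
    (δ K (x ⊗ y) z ≫ ((δ K x y ≫ (k ⊗ₘ l)) ⊗ₘ m)) ≫ (α_ X Y Z).hom =
      K.map (α_ x y z).hom ≫ δ K x (y ⊗ z) ≫ (k ⊗ₘ (δ K y z ≫ (l ⊗ₘ m))) := by
  have h₁ : (k ⊗ₘ δ K y z ≫ (l ⊗ₘ m)) = (K.obj x ◁ δ K y z) ≫ (k ⊗ₘ (l ⊗ₘ m)) := by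
    rw [← id_tensorHom, tensorHom_comp_tensorHom, Category.id_comp]
  have h₂ : (δ K x y ≫ (k ⊗ₘ l) ⊗ₘ m) = (δ K x y ▷ K.obj z) ≫ ((k ⊗ₘ l) ⊗ₘ m) := by
    rw [← tensorHom_id, tensorHom_comp_tensorHom, Category.id_comp]
  rw [h₁, h₂, Category.assoc, Category.assoc, associator_naturality,
    Functor.OplaxMonoidal.associativity_assoc]

lemma arr_left {x : W} {X : A} (k : K.obj x ⟶ X) :
    (δ K (𝟙_ W) x ≫ (η K ⊗ₘ k)) ≫ (λ_ X).hom = K.map (λ_ x).hom ≫ k := by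
  simp [MonoidalCategory.tensorHom_def]

lemma arr_right {x : W} {X : A} (k : K.obj x ⟶ X) :
    (δ K x (𝟙_ W) ≫ (k ⊗ₘ η K)) ≫ (ρ_ X).hom = K.map (ρ_ x).hom ≫ k := by
  simp [MonoidalCategory.tensorHom_def']

variable {K} in
lemma arr_inv {x y : W} {X Y : A} {k : K.obj x ⟶ X} {l : K.obj y ⟶ Y} (s : x ≅ y) (e : X ≅ Y)
    (h : k ≫ e.hom = K.map s.hom ≫ l) : l ≫ e.inv = K.map s.inv ≫ k := by
  rw [Iso.comp_inv_eq, Category.assoc, h, ← K.map_comp_assoc, s.inv_hom_id, K.map_id,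
    Category.id_comp]

end Conj

section Uniqueness

variable {V : Type u₁} [Category.{v₁} V] {A : Type u₂} [Category.{v₂} A] [MonoidalCategory A]
  [SymmetricCategory A]

open Functor.Monoidal in
/-- Components of the isomorphism between two symmetric monoidal functors out of `V^⊗` that
agree on `V`. -/
def extIsoApp {K L : FreeSym V ⥤ A} [K.Braided] [L.Braided] (e : incl ⋙ K ≅ incl ⋙ L) :
    ∀ X : FreeSym V, K.obj X ≅ L.obj X
  | .of a => e.app a
  | .unit => (εIso K).symm ≪≫ εIso L
  | .tensor X Y => (μIso K X Y).symm ≪≫ (extIsoApp e X ⊗ᵢ extIsoApp e Y) ≪≫ μIso L X Y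

open Functor.LaxMonoidal Functor.OplaxMonoidal

lemma extIsoApp_of {K L : FreeSym V ⥤ A} [K.Braided] [L.Braided] (e : incl ⋙ K ≅ incl ⋙ L)
    (a : V) : (extIsoApp e (incl.obj a)).hom = e.hom.app a := rfl

lemma extIsoApp_unit {K L : FreeSym V ⥤ A} [K.Braided] [L.Braided] (e : incl ⋙ K ≅ incl ⋙ L) :
    (extIsoApp e (𝟙_ _)).hom = η K ≫ ε L := rfl

lemma extIsoApp_tensor {K L : FreeSym V ⥤ A} [K.Braided] [L.Braided]
    (e : incl ⋙ K ≅ incl ⋙ L) (X Y : FreeSym V) :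
    (extIsoApp e (X ⊗ Y)).hom =
      δ K X Y ≫ ((extIsoApp e X).hom ⊗ₘ (extIsoApp e Y).hom) ≫ μ L X Y := rfl

lemma extIsoApp_naturality {K L : FreeSym V ⥤ A} [K.Braided] [L.Braided]
    (e : incl ⋙ K ≅ incl ⋙ L) {X Y : FreeSym V} (s : X ⟶ Y) :
    K.map s ≫ (extIsoApp e Y).hom = (extIsoApp e X).hom ≫ L.map s := by
  have hα : ∀ X Y Z : FreeSym V, K.map (α_ X Y Z).hom ≫ (extIsoApp e (X ⊗ Y ⊗ Z)).hom =
      (extIsoApp e ((X ⊗ Y) ⊗ Z)).hom ≫ L.map (α_ X Y Z).hom := by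
    intro X Y Z
    simp only [extIsoApp_tensor]
    exact conj_assoc K L _ _ _
  have hl : ∀ X : FreeSym V, K.map (λ_ X).hom ≫ (extIsoApp e X).hom =
      (extIsoApp e (𝟙_ _ ⊗ X)).hom ≫ L.map (λ_ X).hom := by
    intro X
    simp only [extIsoApp_tensor, extIsoApp_unit]
    exact conj_left K L _
  have hr : ∀ X : FreeSym V, K.map (ρ_ X).hom ≫ (extIsoApp e X).hom =
      (extIsoApp e (X ⊗ 𝟙_ _)).hom ≫ L.map (ρ_ X).hom := by
    intro X
    simp only [extIsoApp_tensor, extIsoApp_unit]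
    exact conj_right K L _
  induction s using hom_induction with
  | of g => exact e.hom.naturality g
  | id X => simp
  | comp f g hf hg => simp [hg, reassoc_of% hf]
  | tensor f g hf hg =>
    simp only [extIsoApp_tensor, ← Functor.OplaxMonoidal.δ_natural_assoc,
      tensorHom_comp_tensorHom_assoc, hf, hg, Category.assoc,
      ← Functor.LaxMonoidal.μ_natural]
  | assocHom X Y Z => exact hα X Y Z
  | assocInv X Y Z =>
    rw [← cancel_epi (K.map (α_ X Y Z).hom), ← Category.assoc, ← K.map_comp, ← Category.assoc,
      hα X Y Z, Category.assoc, ← L.map_comp]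
    simp
  | leftHom X => exact hl X
  | leftInv X =>
    rw [← cancel_epi (K.map (λ_ X).hom), ← Category.assoc, ← K.map_comp, ← Category.assoc,
      hl X, Category.assoc, ← L.map_comp]
    simp
  | rightHom X => exact hr X
  | rightInv X =>
    rw [← cancel_epi (K.map (ρ_ X).hom), ← Category.assoc, ← K.map_comp, ← Category.assoc,
      hr X, Category.assoc, ← L.map_comp]
    simp
  | braid X Y => simp [extIsoApp_tensor]

/-- Two symmetric monoidal functors out of `V^⊗` that agree on `V` are isomorphic. -/
def extIso {K L : FreeSym V ⥤ A} [K.Braided] [L.Braided] (e : incl ⋙ K ≅ incl ⋙ L) : K ≅ L :=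
  NatIso.ofComponents (extIsoApp e) fun s => extIsoApp_naturality e s

end Uniqueness

end FreeSym

section Feynman

variable {V : Type u₁} [Groupoid.{v₁} V] {A : Type u₂} [Category.{v₂} A] [MonoidalCategory A]
  [SymmetricCategory A]

/-- The groupoid `Iso(A ↓ V)` of morphisms `X ⟶ ι v`. -/
abbrev IsoOver (ι : V ⥤ A) := Core (Comma (𝟭 A) ι)

/-- The functor `(A ↓ V)^⊗ → (A ↓ A)` induced by tensoring in `A`: it sends a word of morphisms
`φ_i : X_i ⟶ ι v_i` to their tensor product `⊗ X_i ⟶ ⊗ ι v_i`. -/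
def tensorArrows (ι : V ⥤ A) : FreeSym (IsoOver ι) ⥤ Arrow A where
  obj W := Arrow.mk ((FreeSym.liftTrans
    (Functor.whiskerLeft (Core.inclusion _) (Comma.natTrans (𝟭 A) ι))).app W)
  map s := Arrow.homMk
    ((FreeSym.lift (Core.inclusion _ ⋙ Comma.fst (𝟭 A) ι ⋙ 𝟭 A)).map s)
    ((FreeSym.lift (Core.inclusion _ ⋙ Comma.snd (𝟭 A) ι ⋙ ι)).map s)
    ((FreeSym.liftTrans
      (Functor.whiskerLeft (Core.inclusion _) (Comma.natTrans (𝟭 A) ι))).naturality s)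

/-- `(V, A, ι)` is a Feynman category. Smallness is measured by the universe `w`. -/
structure IsFeynmanCategory (ι : V ⥤ A) : Prop where
  /-- `ι^⊗` induces an equivalence `V^⊗ ≃ Iso(A)`. -/
  isomorphism_condition : (Core.functorToCore (FreeSym.lift ι)).IsEquivalence
  /-- `ι^⊗` induces an equivalence `Iso(A ↓ V)^⊗ ≃ Iso(A ↓ A)`. -/
  hereditary_condition : (Core.functorToCore (tensorArrows ι)).IsEquivalence
  /-- The comma categories `(A ↓ v)` are essentially small. -/
  size_condition : ∀ v : V, EssentiallySmall.{w} (Over (ι.obj v))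

end Feynman

section Ops

variable (A : Type u₁) [Category.{v₁} A] [MonoidalCategory A] [SymmetricCategory A]
  (C : Type u₂) [Category.{v₂} C] [MonoidalCategory C] [SymmetricCategory C]

/-- An `A`-op in `C`: a strong symmetric monoidal functor `A ⥤ C`. -/
structure Op where
  functor : A ⥤ C
  [braided : functor.Braided]

attribute [instance] Op.braided

variable {A C}

/-- Morphisms of ops: monoidal natural transformations. -/
@[ext]
structure OpHom (O P : Op A C) where
  trans : O.functor ⟶ P.functor
  [isMonoidal : NatTrans.IsMonoidal trans]

attribute [instance] OpHom.isMonoidal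

/-- The category `A-Ops` of strong symmetric monoidal functors `A ⥤ C`. -/
instance : Category (Op A C) where
  Hom := OpHom
  id O := ⟨𝟙 O.functor⟩
  comp f g := ⟨f.trans ≫ g.trans⟩

variable {B : Type u₃} [Category.{v₃} B] [MonoidalCategory B] [SymmetricCategory B]

variable (C) in
/-- The pullback `f^* : B-Ops ⥤ A-Ops` along a strong symmetric monoidal functor `f : A ⥤ B`. -/
def pullback (f : A ⥤ B) [f.Braided] : Op B C ⥤ Op A C where
  obj P := ⟨f ⋙ P.functor⟩
  map τ := ⟨Functor.whiskerLeft f τ.trans⟩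

variable (C) in
/-- A pushforward along `f : A ⥤ B`: a left adjoint `f_*` of the pullback `f^*` on categories of
ops which is computed pointwise as `(f_* O)(X') = colim_{(f ↓ X')} O ∘ P`, with structure maps
given by the unit of the adjunction. -/
structure Pushforward (f : A ⥤ B) [f.Braided] where
  functor : Op A C ⥤ Op B C
  adj : functor ⊣ pullback C f
  isColimit : ∀ O : Op A C, Nonempty (Functor.LeftExtension.IsPointwiseLeftKanExtension
    (Functor.LeftExtension.mk (functor.obj O).functor (adj.unit.app O).trans))

end Ops

section Decorations

/-- Decorations of the objects of a symmetric monoidal category `A`, together with the relation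
`Rel a b φ` that `φ` carries the decoration `a` of its source to the decoration `b` of its
target. This only serves to construct decorated symmetric monoidal categories. -/
structure Decoration (A : Type u₁) [Category.{v₁} A] [MonoidalCategory A]
    [SymmetricCategory A] where
  Fib : A → Type t
  Rel : ∀ {X Y : A}, Fib X → Fib Y → (X ⟶ Y) → Prop
  unit : Fib (𝟙_ A)
  tensor : ∀ {X Y : A}, Fib X → Fib Y → Fib (X ⊗ Y)
  rel_id : ∀ {X : A} (a : Fib X), Rel a a (𝟙 X)
  rel_comp : ∀ {X Y Z : A} {a : Fib X} {b : Fib Y} {c : Fib Z} {f : X ⟶ Y} {g : Y ⟶ Z},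
    Rel a b f → Rel b c g → Rel a c (f ≫ g)
  rel_tensor : ∀ {X Y X' Y' : A} {a : Fib X} {b : Fib Y} {a' : Fib X'} {b' : Fib Y'}
    {f : X ⟶ Y} {g : X' ⟶ Y'}, Rel a b f → Rel a' b' g → Rel (tensor a a') (tensor b b') (f ⊗ₘ g)
  rel_assoc_hom : ∀ {X Y Z : A} (a : Fib X) (b : Fib Y) (c : Fib Z),
    Rel (tensor (tensor a b) c) (tensor a (tensor b c)) (α_ X Y Z).hom
  rel_assoc_inv : ∀ {X Y Z : A} (a : Fib X) (b : Fib Y) (c : Fib Z),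
    Rel (tensor a (tensor b c)) (tensor (tensor a b) c) (α_ X Y Z).inv
  rel_left_hom : ∀ {X : A} (a : Fib X), Rel (tensor unit a) a (λ_ X).hom
  rel_left_inv : ∀ {X : A} (a : Fib X), Rel a (tensor unit a) (λ_ X).inv
  rel_right_hom : ∀ {X : A} (a : Fib X), Rel (tensor a unit) a (ρ_ X).hom
  rel_right_inv : ∀ {X : A} (a : Fib X), Rel a (tensor a unit) (ρ_ X).inv
  rel_braid : ∀ {X Y : A} (a : Fib X) (b : Fib Y), Rel (tensor a b) (tensor b a) (β_ X Y).hom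

variable {A : Type u₁} [Category.{v₁} A] [MonoidalCategory A] [SymmetricCategory A]

/-- Objects of the decorated category: pairs `(X, a)` of an object and a decoration of it. -/
@[ext]
structure Decorated (D : Decoration.{t} A) where
  obj : A
  dec : D.Fib obj

namespace Decorated

variable {D : Decoration.{t} A}

/-- Morphisms `(X, a) ⟶ (Y, b)`: morphisms `X ⟶ Y` carrying `a` to `b`. -/
@[ext]
structure Hom (x y : Decorated D) where
  hom : x.obj ⟶ y.obj
  rel : D.Rel x.dec y.dec hom

instance : Category.{v₁} (Decorated D) where
  Hom := Hom
  id x := ⟨𝟙 _, D.rel_id _⟩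
  comp f g := ⟨f.hom ≫ g.hom, D.rel_comp f.rel g.rel⟩

@[ext]
lemma hom_ext {x y : Decorated D} {f g : x ⟶ y} (h : f.hom = g.hom) : f = g := Hom.ext h

@[simp] lemma id_hom (x : Decorated D) : Hom.hom (𝟙 x) = 𝟙 x.obj := rfl

@[simp] lemma comp_hom {x y z : Decorated D} (f : x ⟶ y) (g : y ⟶ z) :
    (f ≫ g).hom = f.hom ≫ g.hom := rfl

/-- Lift an isomorphism of `A` that is compatible with the decorations. -/
@[simps]
def isoMk {x y : Decorated D} (e : x.obj ≅ y.obj) (h : D.Rel x.dec y.dec e.hom)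
    (h' : D.Rel y.dec x.dec e.inv) : x ≅ y where
  hom := ⟨e.hom, h⟩
  inv := ⟨e.inv, h'⟩

instance : MonoidalCategoryStruct (Decorated D) where
  tensorObj x y := ⟨x.obj ⊗ y.obj, D.tensor x.dec y.dec⟩
  tensorHom f g := ⟨f.hom ⊗ₘ g.hom, D.rel_tensor f.rel g.rel⟩
  whiskerLeft x _ _ f := ⟨x.obj ◁ f.hom, by
    rw [← id_tensorHom]; exact D.rel_tensor (D.rel_id _) f.rel⟩
  whiskerRight f y := ⟨f.hom ▷ y.obj, by
    rw [← tensorHom_id]; exact D.rel_tensor f.rel (D.rel_id _)⟩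
  tensorUnit := ⟨𝟙_ A, D.unit⟩
  associator x y z := isoMk (α_ x.obj y.obj z.obj) (D.rel_assoc_hom _ _ _) (D.rel_assoc_inv _ _ _)
  leftUnitor x := isoMk (λ_ x.obj) (D.rel_left_hom _) (D.rel_left_inv _)
  rightUnitor x := isoMk (ρ_ x.obj) (D.rel_right_hom _) (D.rel_right_inv _)

@[simp] lemma tensor_obj (x y : Decorated D) : (x ⊗ y).obj = x.obj ⊗ y.obj := rfl
@[simp] lemma tensor_dec (x y : Decorated D) : (x ⊗ y).dec = D.tensor x.dec y.dec := rfl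
@[simp] lemma unit_obj : (𝟙_ (Decorated D)).obj = 𝟙_ A := rfl
@[simp] lemma tensorHom_hom {x y x' y' : Decorated D} (f : x ⟶ y) (g : x' ⟶ y') :
    (f ⊗ₘ g).hom = f.hom ⊗ₘ g.hom := rfl
@[simp] lemma whiskerLeft_hom (x : Decorated D) {y z : Decorated D} (f : y ⟶ z) :
    (x ◁ f).hom = x.obj ◁ f.hom := rfl
@[simp] lemma whiskerRight_hom {x y : Decorated D} (f : x ⟶ y) (z : Decorated D) :
    (f ▷ z).hom = f.hom ▷ z.obj := rfl
@[simp] lemma associator_hom_hom (x y z : Decorated D) :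
    (α_ x y z).hom.hom = (α_ x.obj y.obj z.obj).hom := rfl
@[simp] lemma associator_inv_hom (x y z : Decorated D) :
    (α_ x y z).inv.hom = (α_ x.obj y.obj z.obj).inv := rfl
@[simp] lemma leftUnitor_hom_hom (x : Decorated D) : (λ_ x).hom.hom = (λ_ x.obj).hom := rfl
@[simp] lemma rightUnitor_hom_hom (x : Decorated D) : (ρ_ x).hom.hom = (ρ_ x.obj).hom := rfl

instance : MonoidalCategory (Decorated D) where
  tensorHom_def f g := by ext; simp [MonoidalCategory.tensorHom_def]

instance : SymmetricCategory (Decorated D) where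
  braiding x y := isoMk (β_ x.obj y.obj) (D.rel_braid _ _) (by
    rw [← SymmetricCategory.braiding_swap_eq_inv_braiding]
    exact D.rel_braid _ _)

@[simp] lemma braiding_hom_hom (x y : Decorated D) :
    (β_ x y).hom.hom = (β_ x.obj y.obj).hom := rfl

/-- The functor forgetting the decorations. -/
@[simps]
def forget (D : Decoration.{t} A) : Decorated D ⥤ A where
  obj x := x.obj
  map f := f.hom

instance forgetMonoidal (D : Decoration.{t} A) : (forget D).Monoidal :=
  Functor.CoreMonoidal.toMonoidal
    { εIso := Iso.refl _
      μIso := fun _ _ => Iso.refl _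
      μIso_hom_natural_left := fun {x y} f z =>
        (Category.comp_id (f.hom ▷ z.obj)).trans (Category.id_comp (f.hom ▷ z.obj)).symm
      μIso_hom_natural_right := fun {x y} z f =>
        (Category.comp_id (z.obj ◁ f.hom)).trans (Category.id_comp (z.obj ◁ f.hom)).symm
      associativity := fun x y z => by
        change 𝟙 (x.obj ⊗ y.obj) ▷ z.obj ≫ 𝟙 ((x.obj ⊗ y.obj) ⊗ z.obj) ≫
            (α_ x.obj y.obj z.obj).hom =
          (α_ x.obj y.obj z.obj).hom ≫ x.obj ◁ 𝟙 (y.obj ⊗ z.obj) ≫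
            𝟙 (x.obj ⊗ (y.obj ⊗ z.obj))
        simp
      left_unitality := fun x => by
        change (λ_ x.obj).hom = 𝟙 (𝟙_ A) ▷ x.obj ≫ 𝟙 (𝟙_ A ⊗ x.obj) ≫ (λ_ x.obj).hom
        simp
      right_unitality := fun x => by
        change (ρ_ x.obj).hom = x.obj ◁ 𝟙 (𝟙_ A) ≫ 𝟙 (x.obj ⊗ 𝟙_ A) ≫ (ρ_ x.obj).hom
        simp }

instance (D : Decoration.{t} A) : (forget D).Braided where
  braided x y := by
    change 𝟙 (x.obj ⊗ y.obj) ≫ (β_ x.obj y.obj).hom =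
      (β_ x.obj y.obj).hom ≫ 𝟙 (y.obj ⊗ x.obj)
    simp

end Decorated

open Functor.LaxMonoidal Functor.OplaxMonoidal

variable {B : Type u₂} [Category.{v₂} B] [MonoidalCategory B] [SymmetricCategory B]

/-- A map of decorations over a strong symmetric monoidal functor `f`. -/
structure DecorationMap (f : A ⥤ B) [f.Braided] (D : Decoration.{t} A) (E : Decoration.{t'} B) where
  map : ∀ {X : A}, D.Fib X → E.Fib (f.obj X)
  rel_map : ∀ {X Y : A} {a : D.Fib X} {b : D.Fib Y} {φ : X ⟶ Y},
    D.Rel a b φ → E.Rel (map a) (map b) (f.map φ)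
  rel_ε : E.Rel E.unit (map D.unit) (ε f)
  rel_η : E.Rel (map D.unit) E.unit (η f)
  rel_μ : ∀ {X Y : A} (a : D.Fib X) (b : D.Fib Y),
    E.Rel (E.tensor (map a) (map b)) (map (D.tensor a b)) (μ f X Y)
  rel_δ : ∀ {X Y : A} (a : D.Fib X) (b : D.Fib Y),
    E.Rel (map (D.tensor a b)) (E.tensor (map a) (map b)) (δ f X Y)

namespace DecorationMap

variable {f : A ⥤ B} [f.Braided] {D : Decoration.{t} A} {E : Decoration.{t'} B}

/-- The functor `(X, a) ↦ (f X, m a)` between decorated categories. -/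
@[simps]
def functor (m : DecorationMap f D E) : Decorated D ⥤ Decorated E where
  obj x := ⟨f.obj x.obj, m.map x.dec⟩
  map φ := ⟨f.map φ.hom, m.rel_map φ.rel⟩

instance functorMonoidal (m : DecorationMap f D E) : m.functor.Monoidal :=
  Functor.CoreMonoidal.toMonoidal
    { εIso := Decorated.isoMk (Functor.Monoidal.εIso f) m.rel_ε m.rel_η
      μIso := fun x y =>
        Decorated.isoMk (Functor.Monoidal.μIso f x.obj y.obj) (m.rel_μ _ _) (m.rel_δ _ _)
      μIso_hom_natural_left := fun φ z => Decorated.hom_ext (μ_natural_left f φ.hom z.obj)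
      μIso_hom_natural_right := fun z φ => Decorated.hom_ext (μ_natural_right f z.obj φ.hom)
      associativity := fun x y z => Decorated.hom_ext (associativity f x.obj y.obj z.obj)
      left_unitality := fun x => Decorated.hom_ext (left_unitality f x.obj)
      right_unitality := fun x => Decorated.hom_ext (right_unitality f x.obj) }

instance (m : DecorationMap f D E) : m.functor.Braided where
  braided x y := Decorated.hom_ext (Functor.LaxBraided.braided (F := f) x.obj y.obj)

/-- The square of decorated categories over `f` commutes. -/
def squareIso (m : DecorationMap f D E) :
    m.functor ⋙ Decorated.forget E ≅ Decorated.forget D ⋙ f :=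
  Iso.refl _

lemma square_eq (m : DecorationMap f D E) :
    m.functor ⋙ Decorated.forget E = Decorated.forget D ⋙ f := rfl

instance (m : DecorationMap f D E) : NatTrans.IsMonoidal m.squareIso.hom where
  unit := by
    change (𝟙 (𝟙_ B) ≫ ε f) ≫ 𝟙 (f.obj (𝟙_ A)) = ε f ≫ f.map (𝟙 (𝟙_ A))
    simp
  tensor x y := by
    change (𝟙 (f.obj x.obj ⊗ f.obj y.obj) ≫ μ f x.obj y.obj) ≫ 𝟙 (f.obj (x.obj ⊗ y.obj)) =
      (𝟙 (f.obj x.obj) ⊗ₘ 𝟙 (f.obj y.obj)) ≫ μ f x.obj y.obj ≫ f.map (𝟙 (x.obj ⊗ y.obj))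
    simp

end DecorationMap

end Decorations

section Elements

variable {A : Type u₁} [Category.{v₁} A] [MonoidalCategory A] [SymmetricCategory A]
  {B : Type u₂} [Category.{v₂} B] [MonoidalCategory B] [SymmetricCategory B]
  {C : Type u₃} [Category.{v₃} C] [MonoidalCategory C] [SymmetricCategory C]

open Functor.LaxMonoidal Functor.OplaxMonoidal

/-- The product `a ⊗ b : 𝟙 ⟶ O(X ⊗ Y)` of two elements `a : 𝟙 ⟶ O X` and `b : 𝟙 ⟶ O Y`. -/
def mulElt (O : A ⥤ C) [O.Braided] {X Y : A} (a : 𝟙_ C ⟶ O.obj X) (b : 𝟙_ C ⟶ O.obj Y) :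
    𝟙_ C ⟶ O.obj (X ⊗ Y) :=
  (λ_ (𝟙_ C)).inv ≫ (a ⊗ₘ b) ≫ μ O X Y

section

variable (O : A ⥤ C) [O.Braided]

lemma elt_inv {X Y : A} {a : 𝟙_ C ⟶ O.obj X} {b : 𝟙_ C ⟶ O.obj Y} (e : X ≅ Y)
    (h : a ≫ O.map e.hom = b) : b ≫ O.map e.inv = a := by
  rw [← h, Category.assoc, ← O.map_comp, e.hom_inv_id, O.map_id, Category.comp_id]

lemma mulElt_map {X Y X' Y' : A} (a : 𝟙_ C ⟶ O.obj X) (a' : 𝟙_ C ⟶ O.obj X') (f : X ⟶ Y)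
    (g : X' ⟶ Y') :
    mulElt O a a' ≫ O.map (f ⊗ₘ g) = mulElt O (a ≫ O.map f) (a' ≫ O.map g) := by
  simp only [mulElt, Category.assoc, ← tensorHom_comp_tensorHom, μ_natural]

lemma mulElt_assoc {X Y Z : A} (a : 𝟙_ C ⟶ O.obj X) (b : 𝟙_ C ⟶ O.obj Y) (c : 𝟙_ C ⟶ O.obj Z) :
    mulElt O (mulElt O a b) c ≫ O.map (α_ X Y Z).hom = mulElt O a (mulElt O b c) := by
  have h₁ : ((λ_ (𝟙_ C)).inv ≫ (a ⊗ₘ b) ≫ μ O X Y ⊗ₘ c) =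
      ((λ_ (𝟙_ C)).inv ▷ 𝟙_ C) ≫ ((a ⊗ₘ b) ⊗ₘ c) ≫ (μ O X Y ▷ O.obj Z) := by
    rw [← tensorHom_id, ← tensorHom_id, tensorHom_comp_tensorHom, tensorHom_comp_tensorHom]
    simp
  have h₂ : (a ⊗ₘ (λ_ (𝟙_ C)).inv ≫ (b ⊗ₘ c) ≫ μ O Y Z) =
      (𝟙_ C ◁ (λ_ (𝟙_ C)).inv) ≫ (a ⊗ₘ (b ⊗ₘ c)) ≫ (O.obj X ◁ μ O Y Z) := by
    rw [← id_tensorHom, ← id_tensorHom, tensorHom_comp_tensorHom, tensorHom_comp_tensorHom]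
    simp
  have h₃ : (λ_ (𝟙_ C)).inv ≫ ((λ_ (𝟙_ C)).inv ▷ 𝟙_ C) ≫ (α_ (𝟙_ C) (𝟙_ C) (𝟙_ C)).hom =
      (λ_ (𝟙_ C)).inv ≫ (𝟙_ C ◁ (λ_ (𝟙_ C)).inv) := by
    monoidal
  simp only [mulElt]
  rw [h₁, h₂]
  simp only [Category.assoc, Functor.LaxMonoidal.associativity, associator_naturality_assoc,
    reassoc_of% h₃]

lemma unit_mulElt {X : A} (a : 𝟙_ C ⟶ O.obj X) :
    mulElt O (ε O) a ≫ O.map (λ_ X).hom = a := by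
  simp [mulElt, MonoidalCategory.tensorHom_def']

lemma mulElt_unit {X : A} (a : 𝟙_ C ⟶ O.obj X) :
    mulElt O a (ε O) ≫ O.map (ρ_ X).hom = a := by
  simp [mulElt, MonoidalCategory.tensorHom_def, unitors_inv_equal]

lemma mulElt_braid {X Y : A} (a : 𝟙_ C ⟶ O.obj X) (b : 𝟙_ C ⟶ O.obj Y) :
    mulElt O a b ≫ O.map (β_ X Y).hom = mulElt O b a := by
  have h : (λ_ (𝟙_ C)).inv ≫ (β_ (𝟙_ C) (𝟙_ C)).hom = (λ_ (𝟙_ C)).inv := by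
    simp [unitors_inv_equal]
  simp only [mulElt, Category.assoc, Functor.LaxBraided.braided,
    BraidedCategory.braiding_naturality_assoc, reassoc_of% h]

end

/-- Decoration by elements of `O`: a decoration of `X` is an element `a : 𝟙 ⟶ O X`, and
`φ : X ⟶ Y` carries `a` to `b` if `O(φ) ∘ a = b`. -/
def elements (O : Op A C) : Decoration.{v₃} A where
  Fib X := 𝟙_ C ⟶ O.functor.obj X
  Rel a b φ := a ≫ O.functor.map φ = b
  unit := ε O.functor
  tensor a b := mulElt O.functor a b
  rel_id a := by simp
  rel_comp h h' := by simp [reassoc_of% h, h']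
  rel_tensor h h' := by rw [mulElt_map, h, h']
  rel_assoc_hom a b c := mulElt_assoc O.functor a b c
  rel_assoc_inv a b c := elt_inv O.functor (α_ _ _ _) (mulElt_assoc O.functor a b c)
  rel_left_hom a := unit_mulElt O.functor a
  rel_left_inv a := elt_inv O.functor (λ_ _) (unit_mulElt O.functor a)
  rel_right_hom a := mulElt_unit O.functor a
  rel_right_inv a := elt_inv O.functor (ρ_ _) (mulElt_unit O.functor a)
  rel_braid a b := mulElt_braid O.functor a b

section

variable {f : A ⥤ B} [f.Braided] {O : Op A C} {P : Op B C} (η : O ⟶ (pullback C f).obj P)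

/-- The component `O X ⟶ P (f X)` of `η : O ⟶ f^* P`. -/
def transApp (X : A) : O.functor.obj X ⟶ P.functor.obj (f.obj X) := η.trans.app X

lemma transApp_naturality {X Y : A} (φ : X ⟶ Y) :
    O.functor.map φ ≫ transApp η Y = transApp η X ≫ P.functor.map (f.map φ) :=
  η.trans.naturality φ

lemma transApp_unit : ε O.functor ≫ transApp η (𝟙_ A) = ε P.functor ≫ P.functor.map (ε f) :=
  NatTrans.IsMonoidal.unit (τ := η.trans)

lemma transApp_tensor (X Y : A) : μ O.functor X Y ≫ transApp η (X ⊗ Y) =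
    (transApp η X ⊗ₘ transApp η Y) ≫ μ P.functor (f.obj X) (f.obj Y) ≫
      P.functor.map (μ f X Y) :=
  NatTrans.IsMonoidal.tensor (τ := η.trans) X Y

lemma transApp_mulElt {X Y : A} (a : 𝟙_ C ⟶ O.functor.obj X) (b : 𝟙_ C ⟶ O.functor.obj Y) :
    mulElt P.functor (a ≫ transApp η X) (b ≫ transApp η Y) ≫ P.functor.map (μ f X Y) =
      mulElt O.functor a b ≫ transApp η (X ⊗ Y) := by
  simp only [mulElt, Category.assoc, transApp_tensor]
  rw [← tensorHom_comp_tensorHom_assoc]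

lemma transApp_map {X Y : A} {a : 𝟙_ C ⟶ O.functor.obj X} {b : 𝟙_ C ⟶ O.functor.obj Y}
    {φ : X ⟶ Y} (h : a ≫ O.functor.map φ = b) :
    (a ≫ transApp η X) ≫ P.functor.map (f.map φ) = b ≫ transApp η Y := by
  rw [← h, Category.assoc, Category.assoc, transApp_naturality]

/-- For a morphism of ops `η : O ⟶ f^* P`, the map `(X, a) ↦ (f X, η_X(a))`. -/
def elementsMap : DecorationMap f (elements O) (elements P) where
  map {X} a := a ≫ transApp η X
  rel_map h := transApp_map η h
  rel_ε := (transApp_unit η).symm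
  rel_η := elt_inv P.functor (Functor.Monoidal.εIso f) (transApp_unit η).symm
  rel_μ a b := transApp_mulElt η a b
  rel_δ a b := elt_inv P.functor (Functor.Monoidal.μIso f _ _) (transApp_mulElt η a b)

end

end Elements

section Decomposed

variable {V : Type u₁} [Category.{v₁} V] {A : Type u₂} [Category.{v₂} A] [MonoidalCategory A]
  [SymmetricCategory A] {C : Type u₃} [Category.{v₃} C] [MonoidalCategory C] [SymmetricCategory C]

open Functor.LaxMonoidal Functor.OplaxMonoidal

/-- Objects of the decorated vertex category: pairs `(v, a)` with `a : 𝟙 ⟶ O (ι v)`. -/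
structure DecVertex (ι : V ⥤ A) (O : Op A C) where
  vertex : V
  elt : 𝟙_ C ⟶ O.functor.obj (ι.obj vertex)

namespace DecVertex

variable {ι : V ⥤ A} {O : Op A C}

/-- Morphisms of decorated vertices. -/
@[ext]
structure Hom (p q : DecVertex ι O) where
  hom : p.vertex ⟶ q.vertex
  rel : p.elt ≫ O.functor.map (ι.map hom) = q.elt

instance : Category (DecVertex ι O) where
  Hom := Hom
  id p := ⟨𝟙 _, by simp⟩
  comp f g := ⟨f.hom ≫ g.hom, by simp [reassoc_of% f.rel, g.rel]⟩

/-- Forgetting the decoration of a vertex. -/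
@[simps]
def forget (ι : V ⥤ A) (O : Op A C) : DecVertex ι O ⥤ V where
  obj p := p.vertex
  map f := f.hom

end DecVertex

variable (ι : V ⥤ A) (O : Op A C)

/-- The functor sending a word of decorated vertices `(v_i, a_i)` to `⊗ ι v_i`. -/
abbrev wordObj : FreeSym (DecVertex ι O) ⥤ A := FreeSym.lift (DecVertex.forget ι O ⋙ ι)

/-- The element `⊗ a_i : 𝟙 ⟶ O (⊗ ι v_i)` of a word of decorated vertices `(v_i, a_i)`. -/
def wordElt : ∀ x : FreeSym (DecVertex ι O), 𝟙_ C ⟶ (wordObj ι O ⋙ O.functor).obj x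
  | .of p => p.elt
  | .unit => ε (wordObj ι O ⋙ O.functor)
  | .tensor x y => mulElt (wordObj ι O ⋙ O.functor) (wordElt x) (wordElt y)

/-- `IsCompatible ι O y x φ`: the morphism `φ : ⊗_w ι w ⟶ ⊗_v ι v` carries the decorations
`(a_w)` of the word `x` to the decorations `(b_v)` of the word `y`. That is, after a reordering
`s` of the word `x`, `φ` decomposes as `⊗_v φ_v` with `φ_v : ⊗_{w ∈ I_v} ι w ⟶ ι v` such that
`O(φ_v)(⊗_{w ∈ I_v} a_w) = b_v` for every letter `v` of `y`. (The isomorphisms `δ` and `μ` of the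
strict monoidal functor `wordObj` are identities.) -/
def IsCompatible : ∀ y x : FreeSym (DecVertex ι O),
    ((wordObj ι O).obj x ⟶ (wordObj ι O).obj y) → Prop
  | .of p, x, φ => wordElt ι O x ≫ O.functor.map φ = wordElt ι O (.of p)
  | .unit, x, φ => ∃ s : x ⟶ 𝟙_ (FreeSym (DecVertex ι O)), φ = (wordObj ι O).map s
  | .tensor y₁ y₂, x, φ => ∃ (x₁ x₂ : FreeSym (DecVertex ι O)) (s : x ⟶ x₁ ⊗ x₂)
      (φ₁ : (wordObj ι O).obj x₁ ⟶ (wordObj ι O).obj y₁)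
      (φ₂ : (wordObj ι O).obj x₂ ⟶ (wordObj ι O).obj y₂),
      φ = (wordObj ι O).map s ≫ δ (wordObj ι O) x₁ x₂ ≫ (φ₁ ⊗ₘ φ₂) ≫ μ (wordObj ι O) y₁ y₂ ∧
        IsCompatible y₁ x₁ φ₁ ∧ IsCompatible y₂ x₂ φ₂

variable {ι O}

lemma wordElt_map {x y : FreeSym (DecVertex ι O)} (s : x ⟶ y) :
    wordElt ι O x ≫ O.functor.map ((wordObj ι O).map s) = wordElt ι O y := by
  have key : (elements ((pullback C (wordObj ι O)).obj O)).Rel (wordElt ι O x) (wordElt ι O y) s := by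
    induction s using FreeSym.hom_induction with
    | of g => exact g.rel
    | id X => exact Decoration.rel_id _ _
    | comp f g hf hg => exact Decoration.rel_comp _ hf hg
    | tensor f g hf hg => exact Decoration.rel_tensor _ hf hg
    | assocHom X Y Z => exact Decoration.rel_assoc_hom _ _ _ _
    | assocInv X Y Z => exact Decoration.rel_assoc_inv _ _ _ _
    | leftHom X => exact Decoration.rel_left_hom _ _
    | leftInv X => exact Decoration.rel_left_inv _ _
    | rightHom X => exact Decoration.rel_right_hom _ _
    | rightInv X => exact Decoration.rel_right_inv _ _
    | braid X Y => exact Decoration.rel_braid _ _ _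
  exact key

lemma wordElt_tensor (x y : FreeSym (DecVertex ι O)) :
    wordElt ι O (x ⊗ y) = mulElt O.functor (wordElt ι O x) (wordElt ι O y) ≫
      O.functor.map (μ (wordObj ι O) x y) := by
  change mulElt (wordObj ι O ⋙ O.functor) (wordElt ι O x) (wordElt ι O y) = _
  simp [mulElt]

lemma wordElt_unit : wordElt ι O (𝟙_ (FreeSym (DecVertex ι O))) =
    ε O.functor ≫ O.functor.map (ε (wordObj ι O)) := rfl

namespace IsCompatible

lemma tensor_iff {y₁ y₂ x : FreeSym (DecVertex ι O)}
    {φ : (wordObj ι O).obj x ⟶ (wordObj ι O).obj (y₁ ⊗ y₂)} :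
    IsCompatible ι O (y₁ ⊗ y₂) x φ ↔ ∃ (x₁ x₂ : FreeSym (DecVertex ι O)) (s : x ⟶ x₁ ⊗ x₂)
      (φ₁ : (wordObj ι O).obj x₁ ⟶ (wordObj ι O).obj y₁)
      (φ₂ : (wordObj ι O).obj x₂ ⟶ (wordObj ι O).obj y₂),
      φ = (wordObj ι O).map s ≫ δ (wordObj ι O) x₁ x₂ ≫ (φ₁ ⊗ₘ φ₂) ≫ μ (wordObj ι O) y₁ y₂ ∧
        IsCompatible ι O y₁ x₁ φ₁ ∧ IsCompatible ι O y₂ x₂ φ₂ := Iff.rfl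

lemma unit_iff {x : FreeSym (DecVertex ι O)}
    {φ : (wordObj ι O).obj x ⟶ (wordObj ι O).obj (𝟙_ (FreeSym (DecVertex ι O)))} :
    IsCompatible ι O (𝟙_ _) x φ ↔
      ∃ s : x ⟶ 𝟙_ (FreeSym (DecVertex ι O)), φ = (wordObj ι O).map s := Iff.rfl

lemma of_iff {p : DecVertex ι O} {x : FreeSym (DecVertex ι O)}
    {φ : (wordObj ι O).obj x ⟶ (wordObj ι O).obj (FreeSym.incl.obj p)} :
    IsCompatible ι O (FreeSym.incl.obj p) x φ ↔
      wordElt ι O x ≫ O.functor.map φ = wordElt ι O (FreeSym.incl.obj p) := Iff.rfl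

/-- Induction on words, phrased with the tensor product. -/
lemma word_induction {V : Type*} [Category V] {P : FreeSym V → Prop}
    (of : ∀ a, P (FreeSym.incl.obj a)) (unit : P (𝟙_ _)) (tensor : ∀ x y, P x → P y → P (x ⊗ y))
    (x : FreeSym V) : P x := by
  induction x with
  | of a => exact of a
  | unit => exact unit
  | tensor x y hx hy => exact tensor x y hx hy

lemma elt {y : FreeSym (DecVertex ι O)} :
    ∀ {x : FreeSym (DecVertex ι O)} {φ : (wordObj ι O).obj x ⟶ (wordObj ι O).obj y},
      IsCompatible ι O y x φ → wordElt ι O x ≫ O.functor.map φ = wordElt ι O y := by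
  induction y using word_induction with
  | of p => exact fun h => h
  | unit => rintro x _ ⟨s, rfl⟩; exact wordElt_map s
  | tensor y₁ y₂ ih₁ ih₂ =>
    intro x φ h
    obtain ⟨x₁, x₂, s, φ₁, φ₂, rfl, h₁, h₂⟩ := tensor_iff.1 h
    rw [Functor.map_comp, ← Category.assoc, wordElt_map, wordElt_tensor, wordElt_tensor,
      Category.assoc, ← Functor.map_comp, Functor.Monoidal.μ_δ_assoc, Functor.map_comp,
      ← Category.assoc, mulElt_map, ih₁ h₁, ih₂ h₂]

lemma precomp {y : FreeSym (DecVertex ι O)} {x x' : FreeSym (DecVertex ι O)}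
    (t : x' ⟶ x) {φ : (wordObj ι O).obj x ⟶ (wordObj ι O).obj y} (h : IsCompatible ι O y x φ) :
    IsCompatible ι O y x' ((wordObj ι O).map t ≫ φ) := by
  induction y using word_induction with
  | of p =>
    rw [of_iff] at h ⊢
    rw [Functor.map_comp, ← Category.assoc, wordElt_map, h]
  | unit =>
    obtain ⟨s, rfl⟩ := unit_iff.1 h
    exact unit_iff.2 ⟨t ≫ s, by rw [Functor.map_comp]⟩
  | tensor y₁ y₂ =>
    obtain ⟨x₁, x₂, s, φ₁, φ₂, rfl, h₁, h₂⟩ := tensor_iff.1 h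
    exact tensor_iff.2
      ⟨x₁, x₂, t ≫ s, φ₁, φ₂, by rw [Functor.map_comp, Category.assoc], h₁, h₂⟩

lemma tensor {y₁ y₂ x₁ x₂ : FreeSym (DecVertex ι O)}
    {φ₁ : (wordObj ι O).obj x₁ ⟶ (wordObj ι O).obj y₁}
    {φ₂ : (wordObj ι O).obj x₂ ⟶ (wordObj ι O).obj y₂}
    (h₁ : IsCompatible ι O y₁ x₁ φ₁) (h₂ : IsCompatible ι O y₂ x₂ φ₂) :
    IsCompatible ι O (y₁ ⊗ y₂) (x₁ ⊗ x₂)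
      (δ (wordObj ι O) x₁ x₂ ≫ (φ₁ ⊗ₘ φ₂) ≫ μ (wordObj ι O) y₁ y₂) :=
  tensor_iff.2 ⟨x₁, x₂, 𝟙 _, φ₁, φ₂, by rw [CategoryTheory.Functor.map_id, Category.id_comp],
    h₁, h₂⟩

lemma id (y : FreeSym (DecVertex ι O)) : IsCompatible ι O y y (𝟙 _) := by
  induction y using word_induction with
  | of p => rw [of_iff, CategoryTheory.Functor.map_id]; exact Category.comp_id _
  | unit => exact unit_iff.2 ⟨𝟙 _, (CategoryTheory.Functor.map_id _ _).symm⟩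
  | tensor y₁ y₂ ih₁ ih₂ =>
    have := ih₁.tensor ih₂
    rwa [id_tensorHom_id, Category.id_comp, Functor.Monoidal.δ_μ] at this

lemma map {x y : FreeSym (DecVertex ι O)} (s : x ⟶ y) :
    IsCompatible ι O y x ((wordObj ι O).map s) := by
  have := (id y).precomp s
  rwa [Category.comp_id] at this

lemma postcomp {y y' : FreeSym (DecVertex ι O)} (t : y ⟶ y') :
    ∀ {x : FreeSym (DecVertex ι O)} {φ : (wordObj ι O).obj x ⟶ (wordObj ι O).obj y},
      IsCompatible ι O y x φ → IsCompatible ι O y' x (φ ≫ (wordObj ι O).map t) := by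
  induction t using FreeSym.hom_induction with
  | of g =>
    intro x φ h
    rw [of_iff] at h ⊢
    rw [Functor.map_comp, ← Category.assoc, h, wordElt_map]
  | id X =>
    intro x φ h
    rwa [CategoryTheory.Functor.map_id, Category.comp_id]
  | comp f g hf hg =>
    intro x φ h
    rw [Functor.map_comp, ← Category.assoc]
    exact hg (hf h)
  | tensor f g hf hg =>
    intro x φ h
    obtain ⟨x₁, x₂, s, φ₁, φ₂, rfl, h₁, h₂⟩ := tensor_iff.1 h
    refine tensor_iff.2 ⟨x₁, x₂, s, _, _, ?_, hf h₁, hg h₂⟩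
    simp only [Category.assoc, ← tensorHom_comp_tensorHom, μ_natural]
  | assocHom X Y Z =>
    intro x φ h
    obtain ⟨x₁₂, x₃, s, φ₁₂, φ₃, rfl, h₁₂, h₃⟩ := tensor_iff.1 h
    obtain ⟨x₁, x₂, s', φ₁, φ₂, rfl, h₁, h₂⟩ := tensor_iff.1 h₁₂
    convert (h₁.tensor (h₂.tensor h₃)).precomp (s ≫ s' ▷ x₃ ≫ (α_ _ _ _).hom) using 1
    simp only [Functor.map_comp, Category.assoc, FreeSym.conj_assoc]
    rw [← Functor.OplaxMonoidal.δ_natural_left_assoc, ← tensorHom_id,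
      tensorHom_comp_tensorHom_assoc, Category.id_comp]
  | assocInv X Y Z =>
    intro x φ h
    obtain ⟨x₁, x₂₃, s, φ₁, φ₂₃, rfl, h₁, h₂₃⟩ := tensor_iff.1 h
    obtain ⟨x₂, x₃, s', φ₂, φ₃, rfl, h₂, h₃⟩ := tensor_iff.1 h₂₃
    convert ((h₁.tensor h₂).tensor h₃).precomp (s ≫ x₁ ◁ s' ≫ (α_ _ _ _).inv) using 1
    simp only [Functor.map_comp, Category.assoc, FreeSym.conj_assoc_inv]
    rw [← Functor.OplaxMonoidal.δ_natural_right_assoc, ← id_tensorHom,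
      tensorHom_comp_tensorHom_assoc, Category.id_comp]
  | leftHom X =>
    intro x φ h
    obtain ⟨x₁, x₂, s, φ₁, φ₂, rfl, h₁, h₂⟩ := tensor_iff.1 h
    obtain ⟨s', rfl⟩ := unit_iff.1 h₁
    convert h₂.precomp (s ≫ s' ▷ x₂ ≫ (λ_ _).hom) using 1
    simp only [Functor.map_comp, Category.assoc, FreeSym.conj_left, Functor.Monoidal.η_ε]
    rw [← Functor.OplaxMonoidal.δ_natural_left_assoc, ← tensorHom_id,
      tensorHom_comp_tensorHom_assoc, Category.id_comp, Category.comp_id]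
  | leftInv X =>
    intro x φ h
    convert ((id (𝟙_ _)).tensor h).precomp (λ_ x).inv using 1
    rw [← cancel_epi ((wordObj ι O).map (λ_ x).hom), ← Category.assoc, FreeSym.conj_left,
      Category.assoc, ← Functor.map_comp, ← Functor.map_comp_assoc]
    simp
  | rightHom X =>
    intro x φ h
    obtain ⟨x₁, x₂, s, φ₁, φ₂, rfl, h₁, h₂⟩ := tensor_iff.1 h
    obtain ⟨s', rfl⟩ := unit_iff.1 h₂
    convert h₁.precomp (s ≫ x₁ ◁ s' ≫ (ρ_ _).hom) using 1
    simp only [Functor.map_comp, Category.assoc, FreeSym.conj_right, Functor.Monoidal.η_ε]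
    rw [← Functor.OplaxMonoidal.δ_natural_right_assoc, ← id_tensorHom,
      tensorHom_comp_tensorHom_assoc, Category.id_comp, Category.comp_id]
  | rightInv X =>
    intro x φ h
    convert (h.tensor (id (𝟙_ _))).precomp (ρ_ x).inv using 1
    rw [← cancel_epi ((wordObj ι O).map (ρ_ x).hom), ← Category.assoc, FreeSym.conj_right,
      Category.assoc, ← Functor.map_comp, ← Functor.map_comp_assoc]
    simp
  | braid X Y =>
    intro x φ h
    obtain ⟨x₁, x₂, s, φ₁, φ₂, rfl, h₁, h₂⟩ := tensor_iff.1 h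
    convert (h₂.tensor h₁).precomp (s ≫ (β_ _ _).hom) using 1
    simp

lemma comp {z : FreeSym (DecVertex ι O)} :
    ∀ {x y : FreeSym (DecVertex ι O)} {φ : (wordObj ι O).obj x ⟶ (wordObj ι O).obj y}
      {ψ : (wordObj ι O).obj y ⟶ (wordObj ι O).obj z},
      IsCompatible ι O y x φ → IsCompatible ι O z y ψ → IsCompatible ι O z x (φ ≫ ψ) := by
  induction z using word_induction with
  | of p =>
    intro x y φ ψ h h'
    rw [of_iff] at h' ⊢
    rw [Functor.map_comp, ← Category.assoc, h.elt, h']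
  | unit =>
    intro x y φ ψ h h'
    obtain ⟨s, rfl⟩ := unit_iff.1 h'
    exact h.postcomp s
  | tensor z₁ z₂ ih₁ ih₂ =>
    intro x y φ ψ h h'
    obtain ⟨y₁, y₂, s, ψ₁, ψ₂, rfl, h₁, h₂⟩ := tensor_iff.1 h'
    obtain ⟨x₁, x₂, t, φ₁, φ₂, e, k₁, k₂⟩ := tensor_iff.1 (h.postcomp s)
    refine tensor_iff.2 ⟨x₁, x₂, t, _, _, ?_, ih₁ k₁ h₁, ih₂ k₂ h₂⟩
    rw [← Category.assoc, e]
    simp only [Category.assoc, Functor.Monoidal.μ_δ_assoc, tensorHom_comp_tensorHom_assoc]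

end IsCompatible

variable (ι O) in
/-- A decomposed decoration of `X`: a decomposition `⊗_v ι v ≅ X` together with an element
`a_v : 𝟙 ⟶ O (ι v)` for every letter `v` of the decomposition. -/
structure Decomposition (X : A) where
  word : FreeSym (DecVertex ι O)
  iso : (wordObj ι O).obj word ≅ X

lemma IsCompatible.of_map {x y : FreeSym (DecVertex ι O)} {X Y : A}
    {k : (wordObj ι O).obj x ≅ X} {l : (wordObj ι O).obj y ≅ Y} {φ : X ⟶ Y} (s : x ⟶ y)
    (h : k.hom ≫ φ = (wordObj ι O).map s ≫ l.hom) :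
    IsCompatible ι O y x (k.hom ≫ φ ≫ l.inv) := by
  rw [reassoc_of% h, l.hom_inv_id, Category.comp_id]
  exact IsCompatible.map s

variable (ι O) in
/-- Decoration by decomposed elements of `O`: a morphism `φ : X ⟶ Y` carries the decoration
`(⊗ ι w ≅ X, (a_w))` to `(⊗ ι v ≅ Y, (b_v))` if, along the chosen decompositions,
`φ` is compatible with the tuples `(a_w)` and `(b_v)`. -/
def decomposed : Decoration A where
  Fib X := Decomposition ι O X
  Rel a b φ := IsCompatible ι O b.word a.word (a.iso.hom ≫ φ ≫ b.iso.inv)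
  unit := ⟨𝟙_ _, (Functor.Monoidal.εIso (wordObj ι O)).symm⟩
  tensor a b := ⟨a.word ⊗ b.word, (Functor.Monoidal.μIso (wordObj ι O) _ _).symm ≪≫
    (a.iso ⊗ᵢ b.iso)⟩
  rel_id a := by
    simpa using IsCompatible.id a.word
  rel_comp {X Y Z a b c f g} h h' := by
    simpa using h.comp h'
  rel_tensor {X Y X' Y' a b a' b' f g} h h' := by
    convert h.tensor h' using 1
    simp [← tensorHom_comp_tensorHom_assoc]
  rel_assoc_hom a b c := IsCompatible.of_map (α_ _ _ _).hom
    (FreeSym.arr_assoc (wordObj ι O) a.iso.hom b.iso.hom c.iso.hom)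
  rel_assoc_inv a b c := IsCompatible.of_map (α_ _ _ _).inv (FreeSym.arr_inv (α_ _ _ _) (α_ _ _ _)
    (FreeSym.arr_assoc (wordObj ι O) a.iso.hom b.iso.hom c.iso.hom))
  rel_left_hom a := IsCompatible.of_map (λ_ _).hom
    (FreeSym.arr_left (wordObj ι O) a.iso.hom)
  rel_left_inv a := IsCompatible.of_map (λ_ _).inv (FreeSym.arr_inv (λ_ _) (λ_ _)
    (FreeSym.arr_left (wordObj ι O) a.iso.hom))
  rel_right_hom a := IsCompatible.of_map (ρ_ _).hom
    (FreeSym.arr_right (wordObj ι O) a.iso.hom)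
  rel_right_inv a := IsCompatible.of_map (ρ_ _).inv (FreeSym.arr_inv (ρ_ _) (ρ_ _)
    (FreeSym.arr_right (wordObj ι O) a.iso.hom))
  rel_braid a b := by
    refine IsCompatible.of_map (β_ _ _).hom ?_
    simp

end Decomposed

section DecomposedMap

variable {V : Type u₁} [Category.{v₁} V] {A : Type u₂} [Category.{v₂} A] [MonoidalCategory A]
  [SymmetricCategory A] {V' : Type u₃} [Category.{v₃} V'] {B : Type u₄} [Category.{v₄} B]
  [MonoidalCategory B] [SymmetricCategory B]
  {C : Type u₅} [Category.{v₅} C] [MonoidalCategory C] [SymmetricCategory C]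
  {ι : V ⥤ A} {ι' : V' ⥤ B} {v : V ⥤ V'} {f : A ⥤ B} [f.Braided] (e : ι ⋙ f ≅ v ⋙ ι')
  {O : Op A C} {P : Op B C} (σ : O ⟶ (pullback C f).obj P)

open Functor.LaxMonoidal Functor.OplaxMonoidal

/-- The functor `(w, a) ↦ (v w, σ(a))` on decorated vertices. -/
@[simps]
def vertexMap : DecVertex ι O ⥤ DecVertex ι' P where
  obj p := ⟨v.obj p.vertex, (p.elt ≫ transApp σ (ι.obj p.vertex)) ≫
    P.functor.map (e.hom.app p.vertex)⟩
  map {p q} g := ⟨v.map g.hom, by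
    have h := e.hom.naturality g.hom
    simp only [Functor.comp_map] at h
    change ((p.elt ≫ transApp σ (ι.obj p.vertex)) ≫ P.functor.map (e.hom.app p.vertex)) ≫
        P.functor.map (ι'.map (v.map g.hom)) =
      (q.elt ≫ transApp σ (ι.obj q.vertex)) ≫ P.functor.map (e.hom.app q.vertex)
    rw [← transApp_map σ g.rel, Category.assoc, Category.assoc (p.elt ≫ _), ← Functor.map_comp,
      ← Functor.map_comp, h]⟩
  map_id p := DecVertex.Hom.ext (v.map_id p.vertex)
  map_comp g h := DecVertex.Hom.ext (v.map_comp g.hom h.hom)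

/-- The induced functor on words of decorated vertices. -/
abbrev wordMap : FreeSym (DecVertex ι O) ⥤ FreeSym (DecVertex ι' P) :=
  FreeSym.lift (vertexMap e σ ⋙ FreeSym.incl)

/-- The canonical isomorphism `⊗ ι' (v w) ≅ f (⊗ ι w)`. -/
def wordIso : wordMap e σ ⋙ wordObj ι' P ≅ wordObj ι O ⋙ f :=
  FreeSym.extIso (NatIso.ofComponents (fun p => (e.app p.vertex).symm) fun g =>
    e.inv.naturality g.hom)

/-- The components of `wordIso`. -/
def wordIsoApp (x : FreeSym (DecVertex ι O)) :
    (wordObj ι' P).obj ((wordMap e σ).obj x) ≅ f.obj ((wordObj ι O).obj x) :=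
  (wordIso e σ).app x

lemma wordIsoApp_unit : (wordIsoApp e σ (𝟙_ _)).hom =
    ((wordObj ι' P).map (η (wordMap e σ)) ≫ η (wordObj ι' P)) ≫
      ε f ≫ f.map (ε (wordObj ι O)) := rfl

lemma wordIsoApp_tensor (x y : FreeSym (DecVertex ι O)) : (wordIsoApp e σ (x ⊗ y)).hom =
    ((wordObj ι' P).map (δ (wordMap e σ) x y) ≫ δ (wordObj ι' P) _ _) ≫
      ((wordIsoApp e σ x).hom ⊗ₘ (wordIsoApp e σ y).hom) ≫
        μ f _ _ ≫ f.map (μ (wordObj ι O) x y) := rfl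

lemma wordIsoApp_naturality {x y : FreeSym (DecVertex ι O)} (s : x ⟶ y) :
    (wordObj ι' P).map ((wordMap e σ).map s) ≫ (wordIsoApp e σ y).hom =
      (wordIsoApp e σ x).hom ≫ f.map ((wordObj ι O).map s) :=
  (wordIso e σ).hom.naturality s

/-- `wordIso` carries the element of a word to its image under `σ`. -/
lemma wordElt_wordMap (x : FreeSym (DecVertex ι O)) :
    wordElt ι' P ((wordMap e σ).obj x) ≫ P.functor.map (wordIsoApp e σ x).hom =
      wordElt ι O x ≫ transApp σ ((wordObj ι O).obj x) := by
  induction x using IsCompatible.word_induction with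
  | of p =>
    change ((p.elt ≫ transApp σ (ι.obj p.vertex)) ≫ P.functor.map (e.app p.vertex).hom) ≫
      P.functor.map (e.app p.vertex).inv = p.elt ≫ transApp σ (ι.obj p.vertex)
    rw [Category.assoc _ (P.functor.map _), ← Functor.map_comp, Iso.hom_inv_id]
    exact (congrArg (fun z => (p.elt ≫ transApp σ (ι.obj p.vertex)) ≫ z)
      (P.functor.map_id _)).trans (Category.comp_id _)
  | unit =>
    rw [wordIsoApp_unit, Category.assoc, Functor.map_comp,
      ← Category.assoc, wordElt_map, wordElt_unit, wordElt_unit, Category.assoc, Category.assoc,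
      transApp_naturality, ← Category.assoc (ε O.functor), transApp_unit, ← Functor.map_comp,
      Functor.Monoidal.ε_η_assoc, Functor.map_comp, Category.assoc]
  | tensor x y hx hy =>
    rw [wordIsoApp_tensor, Category.assoc, Functor.map_comp,
      ← Category.assoc, wordElt_map, wordElt_tensor, wordElt_tensor, Category.assoc, Category.assoc,
      transApp_naturality, ← Category.assoc (mulElt _ _ _) (transApp _ _), ← transApp_mulElt,
      ← Functor.map_comp,
      Functor.Monoidal.μ_δ_assoc, Functor.map_comp, Functor.map_comp,
      ← Category.assoc, mulElt_map, hx, hy, Category.assoc]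

lemma wordElt_wordMap_comp {x y : FreeSym (DecVertex ι O)}
    {φ : (wordObj ι O).obj x ⟶ (wordObj ι O).obj y}
    (h : wordElt ι O x ≫ O.functor.map φ = wordElt ι O y) :
    wordElt ι' P ((wordMap e σ).obj x) ≫
      P.functor.map ((wordIsoApp e σ x).hom ≫ f.map φ ≫ (wordIsoApp e σ y).inv) =
        wordElt ι' P ((wordMap e σ).obj y) := by
  rw [Functor.map_comp, Functor.map_comp, ← Category.assoc, wordElt_wordMap, ← Category.assoc,
    transApp_map σ h, ← wordElt_wordMap e σ, Category.assoc, ← Functor.map_comp,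
    Iso.hom_inv_id, CategoryTheory.Functor.map_id]
  exact Category.comp_id _

lemma IsCompatible.wordMap {y : FreeSym (DecVertex ι O)} :
    ∀ {x : FreeSym (DecVertex ι O)} {φ : (wordObj ι O).obj x ⟶ (wordObj ι O).obj y},
      IsCompatible ι O y x φ →
      IsCompatible ι' P ((wordMap e σ).obj y) ((wordMap e σ).obj x)
        ((wordIsoApp e σ x).hom ≫ f.map φ ≫ (wordIsoApp e σ y).inv) := by
  induction y using IsCompatible.word_induction with
  | of p =>
    intro x φ h
    exact IsCompatible.of_iff.2 (wordElt_wordMap_comp e σ h.elt)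
  | unit =>
    intro x φ h
    obtain ⟨s, rfl⟩ := unit_iff.1 h
    have k : (wordIsoApp e σ x).hom ≫ f.map ((wordObj ι O).map s) ≫ (wordIsoApp e σ (𝟙_ _)).inv =
        (wordObj ι' P).map ((FeynmanDec.wordMap e σ).map s) := by
      rw [← Category.assoc, ← wordIsoApp_naturality, Category.assoc, Iso.hom_inv_id,
        Category.comp_id]
    exact k ▸ IsCompatible.map _
  | tensor y₁ y₂ ih₁ ih₂ =>
    intro x φ h
    obtain ⟨x₁, x₂, s, φ₁, φ₂, rfl, h₁, h₂⟩ := tensor_iff.1 h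
    convert (((ih₁ h₁).tensor (ih₂ h₂)).precomp ((FeynmanDec.wordMap e σ).map s ≫
      δ (FeynmanDec.wordMap e σ) x₁ x₂)).postcomp (μ (FeynmanDec.wordMap e σ) y₁ y₂) using 1
    rw [Functor.map_comp, Category.assoc, ← Category.assoc, ← wordIsoApp_naturality,
      Category.assoc, Functor.map_comp (wordObj ι' P), Category.assoc, Category.assoc]
    congr 1
    rw [← Category.assoc, Iso.comp_inv_eq]
    simp only [wordIsoApp_tensor, Functor.map_comp, Category.assoc]
    congr 2
    simp [← tensorHom_comp_tensorHom_assoc]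

/-- For a morphism of ops `σ : O ⟶ f^* P`, the map `(X, (a_w)_w) ↦ (f X, (σ(a_w))_w)`. -/
def decomposedMap : DecorationMap f (decomposed ι O) (decomposed ι' P) where
  map {X} a := ⟨(FeynmanDec.wordMap e σ).obj a.word,
    wordIsoApp e σ a.word ≪≫ f.mapIso a.iso⟩
  rel_map {X Y a b φ} h := by
    have h' := IsCompatible.wordMap e σ h
    simpa [decomposed] using h'
  rel_ε := by
    refine IsCompatible.of_map (ε (FeynmanDec.wordMap e σ)) ?_
    simp [decomposed, wordIsoApp_unit]
  rel_η := by
    refine IsCompatible.of_map (η (FeynmanDec.wordMap e σ)) ?_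
    simp [decomposed, wordIsoApp_unit]
  rel_μ a b := by
    refine IsCompatible.of_map (μ (FeynmanDec.wordMap e σ) _ _) ?_
    simp [decomposed, wordIsoApp_tensor, ← tensorHom_comp_tensorHom_assoc]
  rel_δ a b := by
    refine IsCompatible.of_map (δ (FeynmanDec.wordMap e σ) _ _) ?_
    simp [decomposed, wordIsoApp_tensor, ← tensorHom_comp_tensorHom,
      ← Functor.OplaxMonoidal.δ_natural]

end DecomposedMap

section Square

variable {A : Type u₁} [Category.{v₁} A] [MonoidalCategory A] [SymmetricCategory A]
  {B : Type u₂} [Category.{v₂} B] [MonoidalCategory B] [SymmetricCategory B]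
  {C : Type u₃} [Category.{v₃} C] [MonoidalCategory C] [SymmetricCategory C]

open Functor.LaxMonoidal Functor.OplaxMonoidal

/-- A monoidal natural isomorphism is an isomorphism of ops. -/
def Op.isoMk {O P : Op A C} (i : O.functor ≅ P.functor) [NatTrans.IsMonoidal i.hom] : O ≅ P where
  hom := ⟨i.hom⟩
  inv := ⟨i.inv⟩
  hom_inv_id := OpHom.ext i.hom_inv_id
  inv_hom_id := OpHom.ext i.inv_hom_id

variable {f : A ⥤ B} [f.Braided] {D : Decoration.{t} A} {E : Decoration.{t'} B}

instance (m : DecorationMap f D E) (Q : Op B C) : NatTrans.IsMonoidal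
    (F₁ := m.functor ⋙ (Decorated.forget E ⋙ Q.functor))
    (F₂ := Decorated.forget D ⋙ (f ⋙ Q.functor))
    (Functor.isoWhiskerRight m.squareIso Q.functor).hom where
  unit := by
    have h := congrArg (fun z => ε Q.functor ≫ Q.functor.map z)
      (NatTrans.IsMonoidal.unit (τ := m.squareIso.hom))
    simpa [-Decorated.forget_map] using h
  tensor x y := by
    have h := congrArg (fun z => μ Q.functor _ _ ≫ Q.functor.map z)
      (NatTrans.IsMonoidal.tensor (τ := m.squareIso.hom) x y)
    simpa [-Decorated.forget_map] using h

variable (C) in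
/-- The square of pullback functors `m^* ∘ forget^* = forget^* ∘ f^*`. -/
def pullbackSquare (m : DecorationMap f D E) :
    pullback C (Decorated.forget E) ⋙ pullback C m.functor ≅
      pullback C f ⋙ pullback C (Decorated.forget D) :=
  NatIso.ofComponents (fun Q =>
    Op.isoMk (O := ⟨m.functor ⋙ (Decorated.forget E ⋙ Q.functor)⟩)
      (P := ⟨Decorated.forget D ⋙ (f ⋙ Q.functor)⟩)
      (Functor.isoWhiskerRight m.squareIso Q.functor)) fun τ => OpHom.ext (by
    ext x
    exact (τ.trans.naturality (m.squareIso.hom.app x)).symm)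

variable (C) in
/-- For a map `m` of decorations over `f`, with the commuting square
`forget' ∘ m = f ∘ forget` of decorated categories: all edges of the square other than `f` admit
pushforwards on categories of ops in `C`, and, for all choices of the pushforwards, the induced
square of left adjoints commutes, via the isomorphism which corresponds under the adjunctions to
the commutation of the square of pullback functors. -/
def AdjointSquare (p : Pushforward C f) (m : DecorationMap f D E) : Prop :=
  Nonempty (Pushforward C m.functor) ∧ Nonempty (Pushforward C (Decorated.forget D)) ∧
    Nonempty (Pushforward C (Decorated.forget E)) ∧
    ∀ (q : Pushforward C m.functor) (l : Pushforward C (Decorated.forget D))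
      (r : Pushforward C (Decorated.forget E)),
      IsIso ((conjugateEquiv (l.adj.comp p.adj) (q.adj.comp r.adj)).symm (pullbackSquare C m).inv)

variable (C) in
/-- `C` is Cartesian: the monoidal unit is terminal and `X ⊗ Y` is the product of `X` and `Y`. -/
def IsCartesian : Prop :=
  ∃ t : IsTerminal (𝟙_ C), ∀ X Y : C, Nonempty (IsLimit (BinaryFan.mk
    ((X ◁ t.from Y) ≫ (ρ_ X).hom) ((t.from X ▷ Y) ≫ (λ_ Y).hom)))

end Square

end FeynmanDec

open FeynmanDec

/-! The only content is the existence of pushforwards. Conjugation under adjunctions sends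
isomorphisms to isomorphisms, so the comparison of the composite left adjoints is invertible as soon
as all the adjunctions are there.

A pushforward along `g` exists once the pointwise left Kan extension `L` of a strong symmetric
monoidal functor along `g` is again strong symmetric monoidal. Since tensoring in `C` preserves
colimits in each variable, `L Y₁ ⊗ L Y₂` is a colimit over `(g ↓ Y₁) × (g ↓ Y₂)`, while `L (Y₁ ⊗
Y₂)` is one over `(g ↓ Y₁ ⊗ Y₂)`. The two agree if tensoring the comma categories is full and
essentially surjective, hence final. This, with the analogous condition at the unit, is
`IsTensorFinal`; `IsTensorFinal.exists_op` then supplies the symmetric monoidal structure and its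
universal property, and `IsTensorFinal.nonempty_pushforward` the adjunction.

Tensor finality comes from heredity. By the Feynman axioms a morphism from a tensor word of letters
to `Y₁ ⊗ Y₂` becomes `φ₁ ⊗ φ₂` after a reordering of the word, and a reordering relating two such
decompositions is itself a tensor product (`IsHereditary`, `IsFeynmanCategory.isHereditary`). A
functor between hereditary categories that is given on letters by a functor `p` is tensor final
(`IsHereditary.isTensorFinal`). This needs two facts on free symmetric monoidal categories. A
morphism from `p^⊗ x` to a tensor product splits after a reordering of `x` (`FreeSym.splits`). A
morphism whose image under `p^⊗` is a tensor product is one already (`FreeSym.exists_eq_tensorHom`);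
the proof colours the letters of the two factors differently, and identifies the components by
faithfulness of the tensor product on words.

Decorated categories are hereditary over words of decorated vertices. In the general version a
decomposition of the decoration is part of the data (`IsHereditary.decomposed`); in the Cartesian
version an element of `O(X ⊗ Y)` is the same as a pair of elements of `O(X)` and `O(Y)`
(`IsHereditary.elements`). Hence `f`, `f^O` and both forgetful functors are tensor final.

The colimits exist because the comma categories are essentially small: slices by heredity and the
size condition, decorated comma categories because, up to isomorphism, an object carries only a
small set of decorations (`HasSmallFibres`). -/

namespace FeynmanDec

namespace FreeSym

open Functor.LaxMonoidal Functor.OplaxMonoidal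

/-! ### Splitting morphisms of words along their target -/

section Splitting

variable {U : Type u₁} [Category.{v₁} U] {V : Type u₂} [Category.{v₂} V]

/-- The functor `p^⊗ : U^⊗ ⥤ V^⊗` induced by `p : U ⥤ V`. -/
abbrev mapWord (p : U ⥤ V) : FreeSym U ⥤ FreeSym V := lift (p ⋙ incl)

/-- A morphism `p a ⟶ b`, as a morphism of words. -/
def letter (p : U ⥤ V) {a : U} {b : V} (g : p.obj a ⟶ b) :
    (mapWord p).obj (incl.obj a) ⟶ incl.obj b := incl.map g

lemma letter_comp (p : U ⥤ V) {a : U} {b c : V} (g : p.obj a ⟶ b) (h : b ⟶ c) :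
    letter p (g ≫ h) = letter p g ≫ incl.map h := incl.map_comp g h

lemma letter_id (p : U ⥤ V) (a : U) : letter p (𝟙 (p.obj a)) = 𝟙 _ := incl.map_id _

/-- `s : p^⊗ x ⟶ y` splits along the word `y`: every tensor factor of `y` is hit by the image of a
tensor factor of `x`, after a reordering of `x`. -/
def Splits (p : U ⥤ V) : ∀ (y : FreeSym V) (x : FreeSym U), ((mapWord p).obj x ⟶ y) → Prop
  | .of b, x, s => ∃ (a : U) (t : x ⟶ incl.obj a) (g : p.obj a ⟶ b),
      s = (mapWord p).map t ≫ letter p g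
  | .unit, x, s => ∃ t : x ⟶ 𝟙_ (FreeSym U), s = (mapWord p).map t ≫ η (mapWord p)
  | .tensor y₁ y₂, x, s => ∃ (x₁ x₂ : FreeSym U) (t : x ⟶ x₁ ⊗ x₂)
      (s₁ : (mapWord p).obj x₁ ⟶ y₁) (s₂ : (mapWord p).obj x₂ ⟶ y₂),
      s = (mapWord p).map t ≫ δ (mapWord p) x₁ x₂ ≫ (s₁ ⊗ₘ s₂) ∧
        Splits p y₁ x₁ s₁ ∧ Splits p y₂ x₂ s₂

namespace Splits

variable {p : U ⥤ V}

lemma of_iff {b : V} {x : FreeSym U} {s : (mapWord p).obj x ⟶ incl.obj b} :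
    Splits p (incl.obj b) x s ↔ ∃ (a : U) (t : x ⟶ incl.obj a) (g : p.obj a ⟶ b),
      s = (mapWord p).map t ≫ letter p g := Iff.rfl

lemma unit_iff {x : FreeSym U} {s : (mapWord p).obj x ⟶ 𝟙_ (FreeSym V)} :
    Splits p (𝟙_ _) x s ↔ ∃ t : x ⟶ 𝟙_ (FreeSym U), s = (mapWord p).map t ≫ η (mapWord p) :=
  Iff.rfl

lemma tensor_iff {y₁ y₂ : FreeSym V} {x : FreeSym U} {s : (mapWord p).obj x ⟶ y₁ ⊗ y₂} :
    Splits p (y₁ ⊗ y₂) x s ↔ ∃ (x₁ x₂ : FreeSym U) (t : x ⟶ x₁ ⊗ x₂)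
      (s₁ : (mapWord p).obj x₁ ⟶ y₁) (s₂ : (mapWord p).obj x₂ ⟶ y₂),
      s = (mapWord p).map t ≫ δ (mapWord p) x₁ x₂ ≫ (s₁ ⊗ₘ s₂) ∧
        Splits p y₁ x₁ s₁ ∧ Splits p y₂ x₂ s₂ := Iff.rfl

lemma precomp {y : FreeSym V} {x x' : FreeSym U} (t : x' ⟶ x) {s : (mapWord p).obj x ⟶ y}
    (h : Splits p y x s) : Splits p y x' ((mapWord p).map t ≫ s) := by
  induction y using IsCompatible.word_induction with
  | of b =>
    obtain ⟨a, t', g, rfl⟩ := of_iff.1 h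
    exact of_iff.2 ⟨a, t ≫ t', g, by rw [Functor.map_comp, Category.assoc]⟩
  | unit =>
    obtain ⟨t', rfl⟩ := unit_iff.1 h
    exact unit_iff.2 ⟨t ≫ t', by rw [Functor.map_comp, Category.assoc]⟩
  | tensor y₁ y₂ =>
    obtain ⟨x₁, x₂, t', s₁, s₂, rfl, h₁, h₂⟩ := tensor_iff.1 h
    exact tensor_iff.2 ⟨x₁, x₂, t ≫ t', s₁, s₂, by rw [Functor.map_comp, Category.assoc], h₁, h₂⟩

lemma tensor {y₁ y₂ : FreeSym V} {x₁ x₂ : FreeSym U} {s₁ : (mapWord p).obj x₁ ⟶ y₁}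
    {s₂ : (mapWord p).obj x₂ ⟶ y₂} (h₁ : Splits p y₁ x₁ s₁) (h₂ : Splits p y₂ x₂ s₂) :
    Splits p (y₁ ⊗ y₂) (x₁ ⊗ x₂) (δ (mapWord p) x₁ x₂ ≫ (s₁ ⊗ₘ s₂)) :=
  tensor_iff.2 ⟨x₁, x₂, 𝟙 _, s₁, s₂, by rw [CategoryTheory.Functor.map_id, Category.id_comp],
    h₁, h₂⟩

lemma unit : Splits p (𝟙_ _) (𝟙_ _) (η (mapWord p)) :=
  unit_iff.2 ⟨𝟙 _, by rw [CategoryTheory.Functor.map_id, Category.id_comp]⟩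

lemma refl (x : FreeSym U) : Splits p ((mapWord p).obj x) x (𝟙 _) := by
  induction x using IsCompatible.word_induction with
  | of a => exact of_iff.2 ⟨a, 𝟙 _, 𝟙 _, by
      rw [CategoryTheory.Functor.map_id, letter_id]; exact (Category.id_comp _).symm⟩
  | unit => exact unit
  | tensor x₁ x₂ h₁ h₂ =>
    have h := h₁.tensor h₂
    rwa [id_tensorHom_id, Category.comp_id] at h

/-- Induction on the generators of `r`: a structural isomorphism of the target is matched by the
same structural isomorphism applied to the pieces of `x`, and a morphism of letters is absorbed into
`letter`. The source and `s` stay universally quantified because the induction hypotheses are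
applied to other morphisms. -/
lemma postcomp {y y' : FreeSym V} (r : y ⟶ y') :
    ∀ {x : FreeSym U} {s : (mapWord p).obj x ⟶ y}, Splits p y x s → Splits p y' x (s ≫ r) := by
  induction r using hom_induction with
  | of g =>
    intro x s h
    obtain ⟨a, t, g', rfl⟩ := of_iff.1 h
    exact of_iff.2 ⟨a, t, g' ≫ g, by rw [letter_comp, Category.assoc]⟩
  | id X => intro x s h; rwa [Category.comp_id]
  | comp f g hf hg => intro x s h; rw [← Category.assoc]; exact hg (hf h)
  | tensor f g hf hg =>
    intro x s h
    obtain ⟨x₁, x₂, t, s₁, s₂, rfl, h₁, h₂⟩ := tensor_iff.1 h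
    exact tensor_iff.2 ⟨x₁, x₂, t, _, _, by
      simp only [Category.assoc, tensorHom_comp_tensorHom], hf h₁, hg h₂⟩
  | assocHom X Y Z =>
    intro x s h
    obtain ⟨x₁₂, x₃, t, s₁₂, s₃, rfl, h₁₂, h₃⟩ := tensor_iff.1 h
    obtain ⟨x₁, x₂, t', s₁, s₂, rfl, h₁, h₂⟩ := tensor_iff.1 h₁₂
    convert (h₁.tensor (h₂.tensor h₃)).precomp (t ≫ t' ▷ x₃ ≫ (α_ _ _ _).hom) using 1
    simp only [Functor.map_comp, Category.assoc, ← arr_assoc]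
    rw [← Functor.OplaxMonoidal.δ_natural_left_assoc, ← tensorHom_id,
      tensorHom_comp_tensorHom_assoc, Category.id_comp]
  | assocInv X Y Z =>
    intro x s h
    obtain ⟨x₁, x₂₃, t, s₁, s₂₃, rfl, h₁, h₂₃⟩ := tensor_iff.1 h
    obtain ⟨x₂, x₃, t', s₂, s₃, rfl, h₂, h₃⟩ := tensor_iff.1 h₂₃
    convert ((h₁.tensor h₂).tensor h₃).precomp (t ≫ x₁ ◁ t' ≫ (α_ _ _ _).inv) using 1
    have k := arr_inv (K := mapWord p) (α_ x₁ x₂ x₃) (α_ X Y Z) (arr_assoc (mapWord p) s₁ s₂ s₃)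
    simp only [Functor.map_comp, Category.assoc] at k ⊢
    rw [← k, ← Functor.OplaxMonoidal.δ_natural_right_assoc, ← id_tensorHom,
      tensorHom_comp_tensorHom_assoc, Category.id_comp]
  | leftHom X =>
    intro x s h
    obtain ⟨x₁, x₂, t, s₁, s₂, rfl, h₁, h₂⟩ := tensor_iff.1 h
    obtain ⟨t', rfl⟩ := unit_iff.1 h₁
    convert h₂.precomp (t ≫ t' ▷ x₂ ≫ (λ_ _).hom) using 1
    simp only [Functor.map_comp, Category.assoc, ← arr_left]
    rw [← Functor.OplaxMonoidal.δ_natural_left_assoc, ← tensorHom_id,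
      tensorHom_comp_tensorHom_assoc, Category.id_comp]
  | leftInv X =>
    intro x s h
    convert (unit.tensor h).precomp (λ_ x).inv using 1
    exact arr_inv (K := mapWord p) (λ_ x) (λ_ X) (arr_left (mapWord p) s)
  | rightHom X =>
    intro x s h
    obtain ⟨x₁, x₂, t, s₁, s₂, rfl, h₁, h₂⟩ := tensor_iff.1 h
    obtain ⟨t', rfl⟩ := unit_iff.1 h₂
    convert h₁.precomp (t ≫ x₁ ◁ t' ≫ (ρ_ _).hom) using 1
    simp only [Functor.map_comp, Category.assoc, ← arr_right]
    rw [← Functor.OplaxMonoidal.δ_natural_right_assoc, ← id_tensorHom,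
      tensorHom_comp_tensorHom_assoc, Category.id_comp]
  | rightInv X =>
    intro x s h
    convert (h.tensor unit).precomp (ρ_ x).inv using 1
    exact arr_inv (K := mapWord p) (ρ_ x) (ρ_ X) (arr_right (mapWord p) s)
  | braid X Y =>
    intro x s h
    obtain ⟨x₁, x₂, t, s₁, s₂, rfl, h₁, h₂⟩ := tensor_iff.1 h
    convert (h₂.tensor h₁).precomp (t ≫ (β_ _ _).hom) using 1
    simp

end Splits

/-- The identity of `p^⊗ x` splits tautologically, and splitting survives postcomposition with `s`.
-/
lemma splits (p : U ⥤ V) {x : FreeSym U} {y : FreeSym V} (s : (mapWord p).obj x ⟶ y) :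
    Splits p y x s := by
  have h := (Splits.refl (p := p) x).postcomp s
  rwa [Category.id_comp] at h

end Splitting

/-! ### Morphisms of words to the unit -/

section Unit

lemma assoc_tensorHom_leftUnitor {A : Type*} [Category* A] [MonoidalCategory A] {X Y Z : A}
    (k₁ : X ⟶ 𝟙_ A) (k₂ : Y ⟶ 𝟙_ A) (k₃ : Z ⟶ 𝟙_ A) :
    (α_ X Y Z).hom ≫ (k₁ ⊗ₘ (k₂ ⊗ₘ k₃) ≫ (λ_ (𝟙_ A)).hom) ≫ (λ_ (𝟙_ A)).hom =
      ((k₁ ⊗ₘ k₂) ≫ (λ_ (𝟙_ A)).hom ⊗ₘ k₃) ≫ (λ_ (𝟙_ A)).hom := by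
  have h₁ : (k₁ ⊗ₘ (k₂ ⊗ₘ k₃) ≫ (λ_ (𝟙_ A)).hom) =
      (k₁ ⊗ₘ (k₂ ⊗ₘ k₃)) ≫ (𝟙_ A ◁ (λ_ (𝟙_ A)).hom) := by
    rw [← id_tensorHom, tensorHom_comp_tensorHom, Category.comp_id]
  have h₂ : ((k₁ ⊗ₘ k₂) ≫ (λ_ (𝟙_ A)).hom ⊗ₘ k₃) =
      ((k₁ ⊗ₘ k₂) ⊗ₘ k₃) ≫ ((λ_ (𝟙_ A)).hom ▷ 𝟙_ A) := by
    rw [← tensorHom_id, tensorHom_comp_tensorHom, Category.comp_id]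
  rw [h₁, h₂, Category.assoc, Category.assoc, ← associator_naturality_assoc]
  simp [unitors_equal]

variable {V : Type u₁} [Category.{v₁} V]

/-- The canonical morphism from a word without letters to the unit. -/
def IsUnitMap : ∀ x : FreeSym V, (x ⟶ 𝟙_ (FreeSym V)) → Prop
  | .of _, _ => False
  | .unit, k => k = 𝟙 (𝟙_ (FreeSym V))
  | .tensor x y, k => ∃ (k₁ : x ⟶ 𝟙_ _) (k₂ : y ⟶ 𝟙_ _), IsUnitMap x k₁ ∧ IsUnitMap y k₂ ∧
      k = (k₁ ⊗ₘ k₂) ≫ (λ_ _).hom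

lemma isUnitMap_tensor {x y : FreeSym V} {k : x ⊗ y ⟶ 𝟙_ (FreeSym V)} :
    IsUnitMap (x ⊗ y) k ↔ ∃ (k₁ : x ⟶ 𝟙_ _) (k₂ : y ⟶ 𝟙_ _), IsUnitMap x k₁ ∧ IsUnitMap y k₂ ∧
      k = (k₁ ⊗ₘ k₂) ≫ (λ_ _).hom := Iff.rfl

lemma isUnitMap_unit {k : 𝟙_ (FreeSym V) ⟶ 𝟙_ (FreeSym V)} :
    IsUnitMap (𝟙_ _) k ↔ k = 𝟙 _ := Iff.rfl

lemma IsUnitMap.unique {x : FreeSym V} :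
    ∀ {k k' : x ⟶ 𝟙_ (FreeSym V)}, IsUnitMap x k → IsUnitMap x k' → k = k' := by
  induction x using IsCompatible.word_induction with
  | of b => intro k k' h; exact h.elim
  | unit => intro k k' h h'; exact (isUnitMap_unit.1 h).trans (isUnitMap_unit.1 h').symm
  | tensor x y hx hy =>
    intro k k' h h'
    obtain ⟨k₁, k₂, h₁, h₂, rfl⟩ := isUnitMap_tensor.1 h
    obtain ⟨l₁, l₂, h₁', h₂', rfl⟩ := isUnitMap_tensor.1 h'
    rw [hx h₁ h₁', hy h₂ h₂']

/-- Induction on the generators of `s`. A letter has no canonical map, so that case is vacuous; the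
structural cases are coherence for the unitors of the unit. -/
lemma IsUnitMap.precomp {x y : FreeSym V} (s : x ⟶ y) :
    ∀ {k : y ⟶ 𝟙_ (FreeSym V)}, IsUnitMap y k → IsUnitMap x (s ≫ k) := by
  induction s using hom_induction with
  | of g => intro k h; exact h.elim
  | id X => intro k h; rwa [Category.id_comp]
  | comp f g hf hg => intro k h; rw [Category.assoc]; exact hf (hg h)
  | tensor f g hf hg =>
    intro k h
    obtain ⟨k₁, k₂, h₁, h₂, rfl⟩ := isUnitMap_tensor.1 h
    exact isUnitMap_tensor.2 ⟨_, _, hf h₁, hg h₂, by simp⟩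
  | assocHom X Y Z =>
    intro k h
    obtain ⟨k₁, k', h₁, h', rfl⟩ := isUnitMap_tensor.1 h
    obtain ⟨k₂, k₃, h₂, h₃, rfl⟩ := isUnitMap_tensor.1 h'
    refine isUnitMap_tensor.2 ⟨_, _, isUnitMap_tensor.2 ⟨_, _, h₁, h₂, rfl⟩, h₃, ?_⟩
    exact assoc_tensorHom_leftUnitor k₁ k₂ k₃
  | assocInv X Y Z =>
    intro k h
    obtain ⟨k', k₃, h', h₃, rfl⟩ := isUnitMap_tensor.1 h
    obtain ⟨k₁, k₂, h₁, h₂, rfl⟩ := isUnitMap_tensor.1 h'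
    refine isUnitMap_tensor.2 ⟨_, _, h₁, isUnitMap_tensor.2 ⟨_, _, h₂, h₃, rfl⟩, ?_⟩
    rw [Iso.inv_comp_eq]
    exact (assoc_tensorHom_leftUnitor k₁ k₂ k₃).symm
  | leftHom X =>
    intro k h
    exact isUnitMap_tensor.2 ⟨_, _, isUnitMap_unit.2 rfl, h, by simp⟩
  | leftInv X =>
    intro k h
    obtain ⟨k₁, k₂, h₁, h₂, rfl⟩ := isUnitMap_tensor.1 h
    obtain rfl := isUnitMap_unit.1 h₁
    simpa using h₂
  | rightHom X =>
    intro k h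
    exact isUnitMap_tensor.2 ⟨_, _, h, isUnitMap_unit.2 rfl, by simp [unitors_equal]⟩
  | rightInv X =>
    intro k h
    obtain ⟨k₁, k₂, h₁, h₂, rfl⟩ := isUnitMap_tensor.1 h
    obtain rfl := isUnitMap_unit.1 h₂
    simpa [unitors_equal] using h₁
  | braid X Y =>
    intro k h
    obtain ⟨k₁, k₂, h₁, h₂, rfl⟩ := isUnitMap_tensor.1 h
    exact isUnitMap_tensor.2 ⟨_, _, h₂, h₁, by
      rw [← BraidedCategory.braiding_naturality_assoc, braiding_leftUnitor, unitors_equal]⟩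

/-- Each morphism to the unit is the pullback along itself of the identity, which is canonical. So
it is canonical, and canonical maps are unique. -/
instance (x : FreeSym V) : Subsingleton (x ⟶ 𝟙_ (FreeSym V)) where
  allEq s t := by
    have h : IsUnitMap (𝟙_ (FreeSym V)) (𝟙 _) := isUnitMap_unit.2 rfl
    simpa using (h.precomp s).unique (h.precomp t)

end Unit

end FreeSym

end FeynmanDec

/-! ### The symmetric monoidal category of families (formal coproducts) -/

namespace FeynmanDec

/-- Families of objects of `D`. -/
structure Fam (D : Type u₁) where
  I : Type
  F : I → D

namespace Fam

section Category

variable {D : Type u₁} [Category.{v₁} D]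

/-- Morphisms of families: a map of index sets, with morphisms of `D`. -/
structure Hom (X Y : Fam D) where
  idx : X.I → Y.I
  comp : ∀ i, X.F i ⟶ Y.F (idx i)

instance : Category (Fam D) where
  Hom := Hom
  id X := ⟨fun i => i, fun i => 𝟙 (X.F i)⟩
  comp f g := ⟨fun i => g.idx (f.idx i), fun i => f.comp i ≫ g.comp (f.idx i)⟩
  id_comp f := by simp only [Category.id_comp]
  comp_id f := by simp only [Category.comp_id]
  assoc f g h := by simp only [Category.assoc]

lemma hom_ext {X Y : Fam D} {φ : X.I → Y.I} {c c' : ∀ i, X.F i ⟶ Y.F (φ i)}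
    (h : ∀ i, c i = c' i) : (⟨φ, c⟩ : Hom X Y) = ⟨φ, c'⟩ := by
  rw [funext h]

/-- A morphism of families which is injective on indices and consists of isomorphisms. -/
structure IsInclusion {X Y : Fam D} (f : X ⟶ Y) : Prop where
  injective : Function.Injective (Hom.idx f)
  isIso : ∀ i, IsIso (Hom.comp f i)

lemma IsInclusion.mono {X Y : Fam D} {f : X ⟶ Y} (hf : IsInclusion f) : Mono f where
  right_cancellation {Z} g h e := by
    obtain ⟨φ, c⟩ := f
    obtain ⟨ψ, a⟩ := g
    obtain ⟨ψ', b⟩ := h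
    have e' : (⟨fun i => φ (ψ i), fun i => a i ≫ c (ψ i)⟩ : Hom Z Y) =
        ⟨fun i => φ (ψ' i), fun i => b i ≫ c (ψ' i)⟩ := e
    obtain ⟨e₁, e₂⟩ := Hom.mk.inj e'
    -- The index maps are identified first: only then do the two families of components have a
    -- common type.
    obtain rfl : ψ = ψ' := funext fun i => hf.injective (congrFun e₁ i)
    refine hom_ext fun i => ?_
    have : IsIso (c (ψ i)) := hf.isIso (ψ i)
    exact (cancel_mono (c (ψ i))).1 (congrFun (eq_of_heq e₂) i)

end Category

section Monoidal

variable {D : Type u₁} [Category.{v₁} D] [MonoidalCategory D]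

instance : MonoidalCategoryStruct (Fam D) where
  tensorObj X Y := ⟨X.I × Y.I, fun p => X.F p.1 ⊗ Y.F p.2⟩
  tensorHom f g := ⟨fun p => (Hom.idx f p.1, Hom.idx g p.2), fun p => Hom.comp f p.1 ⊗ₘ Hom.comp g p.2⟩
  whiskerLeft X _ _ g := ⟨fun p => (p.1, Hom.idx g p.2), fun p => X.F p.1 ◁ Hom.comp g p.2⟩
  whiskerRight f Y := ⟨fun p => (Hom.idx f p.1, p.2), fun p => Hom.comp f p.1 ▷ Y.F p.2⟩
  tensorUnit := ⟨PUnit, fun _ => 𝟙_ D⟩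
  associator _ _ _ := ⟨⟨fun p => (p.1.1, (p.1.2, p.2)), fun _ => (α_ _ _ _).hom⟩,
    ⟨fun p => ((p.1, p.2.1), p.2.2), fun _ => (α_ _ _ _).inv⟩,
    hom_ext fun _ => Iso.hom_inv_id _, hom_ext fun _ => Iso.inv_hom_id _⟩
  leftUnitor _ := ⟨⟨fun p => p.2, fun _ => (λ_ _).hom⟩, ⟨fun p => (⟨⟩, p), fun _ => (λ_ _).inv⟩,
    hom_ext fun _ => Iso.hom_inv_id _, hom_ext fun _ => Iso.inv_hom_id _⟩
  rightUnitor _ := ⟨⟨fun p => p.1, fun _ => (ρ_ _).hom⟩, ⟨fun p => (p, ⟨⟩), fun _ => (ρ_ _).inv⟩,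
    hom_ext fun _ => Iso.hom_inv_id _, hom_ext fun _ => Iso.inv_hom_id _⟩

instance : MonoidalCategory (Fam D) := MonoidalCategory.ofTensorHom
  (id_tensorHom_id := fun X Y => hom_ext fun _ => id_tensorHom_id _ _)
  (id_tensorHom := fun _ _ _ _ => hom_ext fun _ => id_tensorHom _ _)
  (tensorHom_id := fun _ _ => hom_ext fun _ => tensorHom_id _ _)
  (tensorHom_comp_tensorHom := fun _ _ _ _ => hom_ext fun _ => tensorHom_comp_tensorHom _ _ _ _)
  (associator_naturality := fun _ _ _ => hom_ext fun _ => associator_naturality _ _ _)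
  (leftUnitor_naturality := fun _ => hom_ext fun _ =>
    (congrArg (· ≫ _) (id_tensorHom _ _)).trans (leftUnitor_naturality _))
  (rightUnitor_naturality := fun _ => hom_ext fun _ =>
    (congrArg (· ≫ _) (tensorHom_id _ _)).trans (rightUnitor_naturality _))
  (pentagon := fun W X Y Z => hom_ext fun p => by
    have h := MonoidalCategory.pentagon (W.F p.1.1.1) (X.F p.1.1.2) (Y.F p.1.2) (Z.F p.2)
    simp only [← tensorHom_id, ← id_tensorHom] at h
    exact h)
  (triangle := fun X Y => hom_ext fun p => by
    have h := MonoidalCategory.triangle (X.F p.1.1) (Y.F p.2)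
    simp only [← tensorHom_id, ← id_tensorHom] at h
    exact h)

instance [SymmetricCategory D] : SymmetricCategory (Fam D) where
  braiding _ _ := ⟨⟨fun p => (p.2, p.1), fun _ => (β_ _ _).hom⟩,
    ⟨fun p => (p.2, p.1), fun _ => (β_ _ _).hom⟩,
    hom_ext fun _ => SymmetricCategory.symmetry _ _, hom_ext fun _ => SymmetricCategory.symmetry _ _⟩
  braiding_naturality_right X _ _ f := hom_ext fun p =>
    BraidedCategory.braiding_naturality_right (X.F p.1) (Hom.comp f p.2)
  braiding_naturality_left f Z := hom_ext fun p =>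
    BraidedCategory.braiding_naturality_left (Hom.comp f p.1) (Z.F p.2)
  hexagon_forward X Y Z := hom_ext fun p =>
    BraidedCategory.hexagon_forward (X.F p.1.1) (Y.F p.1.2) (Z.F p.2)
  hexagon_reverse X Y Z := hom_ext fun p =>
    BraidedCategory.hexagon_reverse (X.F p.1) (Y.F p.2.1) (Z.F p.2.2)
  symmetry _ _ := hom_ext fun _ => SymmetricCategory.symmetry _ _

lemma IsInclusion.tensor {X Y X' Y' : Fam D} {f : X ⟶ Y} {g : X' ⟶ Y'} (hf : IsInclusion f)
    (hg : IsInclusion g) : IsInclusion (f ⊗ₘ g) where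
  injective := hf.injective.prodMap hg.injective
  isIso p := by
    have := hf.isIso p.1
    have := hg.isIso p.2
    change IsIso (Hom.comp f p.1 ⊗ₘ Hom.comp g p.2)
    infer_instance

variable (D) in
/-- The functor sending an object to the family with this single member. -/
def single : D ⥤ Fam D where
  obj X := ⟨PUnit, fun _ => X⟩
  map f := ⟨fun i => i, fun _ => f⟩

lemma single_injective {X Y : D} {f g : X ⟶ Y} (h : (single D).map f = (single D).map g) :
    f = g :=
  congrFun (eq_of_heq (Hom.mk.inj h).2) PUnit.unit

instance : (single D).Monoidal :=
  Functor.CoreMonoidal.toMonoidal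
    { εIso := Iso.refl _
      μIso := fun X Y => ⟨⟨fun _ => ⟨⟩, fun _ => 𝟙 (X ⊗ Y)⟩, ⟨fun _ => (⟨⟩, ⟨⟩), fun _ => 𝟙 (X ⊗ Y)⟩,
        hom_ext fun _ => Category.id_comp _, hom_ext fun _ => Category.id_comp _⟩
      μIso_hom_natural_left := fun f X' => hom_ext fun _ => by
        change (f ▷ X') ≫ 𝟙 _ = 𝟙 _ ≫ (f ▷ X')
        simp
      μIso_hom_natural_right := fun X' f => hom_ext fun _ => by
        change (X' ◁ f) ≫ 𝟙 _ = 𝟙 _ ≫ (X' ◁ f)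
        simp
      associativity := fun X Y Z => hom_ext fun _ => by
        change 𝟙 (X ⊗ Y) ▷ Z ≫ 𝟙 ((X ⊗ Y) ⊗ Z) ≫ (α_ X Y Z).hom =
          (α_ X Y Z).hom ≫ X ◁ 𝟙 (Y ⊗ Z) ≫ 𝟙 (X ⊗ Y ⊗ Z)
        simp
      left_unitality := fun X => hom_ext fun _ => by
        change (λ_ X).hom = 𝟙 (𝟙_ D) ▷ X ≫ 𝟙 (𝟙_ D ⊗ X) ≫ (λ_ X).hom
        simp
      right_unitality := fun X => hom_ext fun _ => by
        change (ρ_ X).hom = X ◁ 𝟙 (𝟙_ D) ≫ 𝟙 (X ⊗ 𝟙_ D) ≫ (ρ_ X).hom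
        simp }

instance [SymmetricCategory D] : (single D).Braided where
  braided X Y := hom_ext fun _ => by
    change 𝟙 (X ⊗ Y) ≫ (β_ X Y).hom = (β_ X Y).hom ≫ 𝟙 (Y ⊗ X)
    simp

end Monoidal
end Fam
end FeynmanDec

namespace FeynmanDec

namespace FreeSym

/-! ### Faithfulness of the tensor product of words -/

section TensorFaithful

variable {V : Type u₁} [Category.{v₁} V]

instance (X : Fam (FreeSym V)) : Subsingleton (X ⟶ 𝟙_ (Fam (FreeSym V))) where
  allEq f g := by
    obtain ⟨φ, a⟩ := f
    obtain ⟨ψ, b⟩ := g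
    obtain rfl : φ = ψ := funext fun _ => Subsingleton.elim (α := PUnit) _ _
    exact Fam.hom_ext fun i => Subsingleton.elim (α := X.F i ⟶ 𝟙_ (FreeSym V)) _ _

variable (V) in
/-- A letter `a`, as the family with the two members `a` and the empty word. -/
def optional : V ⥤ Fam (FreeSym V) where
  obj a := ⟨Bool, fun b => cond b (incl.obj a) (𝟙_ _)⟩
  map g := ⟨fun b => b, fun b => match b with
    | true => incl.map g
    | false => 𝟙 _⟩
  map_id a := Fam.hom_ext fun b => match b with
    | true => incl.map_id a
    | false => rfl
  map_comp g h := Fam.hom_ext fun b => match b with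
    | true => incl.map_comp g h
    | false => (Category.id_comp _).symm

variable (V) in
/-- The member `a` of the family `optional a`. -/
def keep : incl ⋙ Fam.single (FreeSym V) ⟶ optional V where
  app a := ⟨fun _ => true, fun _ => 𝟙 (incl.obj a)⟩
  naturality a b g := Fam.hom_ext fun _ => by
    change incl.map g ≫ 𝟙 (incl.obj b) = 𝟙 (incl.obj a) ≫ incl.map g
    simp

variable (V) in
/-- The empty member of the family `optional a`. -/
def omitted : (Functor.const V).obj (𝟙_ (Fam (FreeSym V))) ⟶ optional V where
  app _ := ⟨fun _ => false, fun _ => 𝟙 (𝟙_ (FreeSym V))⟩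
  naturality _ _ _ := Fam.hom_ext fun _ => rfl

/-- On words `τ` acts letter by letter, and inclusions are closed under tensor products. `lift
(optional V)` sends a word to the family of all its subwords; for `keep` and `omitted` the lemma
embeds the whole word and the empty one into this family. -/
lemma isInclusion_liftTrans {G H : V ⥤ Fam (FreeSym V)} (τ : G ⟶ H)
    (h : ∀ a, Fam.IsInclusion (τ.app a)) (x : FreeSym V) :
    Fam.IsInclusion ((liftTrans τ).app x) := by
  induction x using IsCompatible.word_induction with
  | of a => exact h a
  | unit =>
    refine ⟨fun _ _ e => e, fun i => ?_⟩
    change IsIso (𝟙 (𝟙_ (FreeSym V)))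
    infer_instance
  | tensor x y hx hy => exact hx.tensor hy

/-- Both `lift (incl ⋙ single)` and `single` extend the same functor on letters, so they are
isomorphic, and `single` is faithful. -/
lemma lift_single_injective {x y : FreeSym V} {s t : x ⟶ y}
    (h : (lift (incl ⋙ Fam.single (FreeSym V))).map s = (lift (incl ⋙ Fam.single _)).map t) :
    s = t := by
  let e : lift (incl ⋙ Fam.single (FreeSym V)) ≅ Fam.single (FreeSym V) :=
    extIso (NatIso.ofComponents (fun a => Iso.refl _) fun g => by
      exact (Category.comp_id _).trans (Category.id_comp _).symm)
  refine Fam.single_injective ?_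
  rw [← cancel_epi (e.hom.app x), ← e.hom.naturality s, h, e.hom.naturality]

variable {A : Type u₂} [Category.{v₂} A] [MonoidalCategory A] [SymmetricCategory A]

lemma nonempty_lift_const_iso (x : FreeSym V) :
    Nonempty ((lift ((Functor.const V).obj (𝟙_ A))).obj x ≅ 𝟙_ A) := by
  induction x using IsCompatible.word_induction with
  | of a => exact ⟨Iso.refl _⟩
  | unit => exact ⟨Iso.refl _⟩
  | tensor x y hx hy =>
    obtain ⟨i⟩ := hx
    obtain ⟨j⟩ := hy
    exact ⟨(i ⊗ᵢ j) ≪≫ λ_ _⟩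

lemma eq_of_whiskerRight_eq {X Y Z : A} {f g : X ⟶ Y} (i : Z ≅ 𝟙_ A) (h : f ▷ Z = g ▷ Z) :
    f = g := by
  rw [← cancel_epi (ρ_ X).hom, ← rightUnitor_naturality, ← rightUnitor_naturality]
  congr 1
  rw [← cancel_epi (X ◁ i.hom), whisker_exchange, whisker_exchange, h]

/-- To recover `s` from `s ⊗ t`, delete the letters of the second factor. Deleting chosen letters is
not a functor on words, but passing to the family of all subwords is. Inside that family sits the
member keeping all of `x₁` and nothing of `x₂`, on which `s ⊗ t` acts as `s` tensored with a map
between units. -/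
lemma tensorHom_injective_left {x₁ x₂ y₁ y₂ : FreeSym V} {s s' : x₁ ⟶ y₁} {t t' : x₂ ⟶ y₂}
    (h : (s ⊗ₘ t) = (s' ⊗ₘ t')) : s = s' := by
  let J := lift (incl ⋙ Fam.single (FreeSym V))
  let J₀ := lift ((Functor.const V).obj (𝟙_ (Fam (FreeSym V))))
  let θ : J ⟶ lift (optional V) := liftTrans (keep V)
  let θ₀ : J₀ ⟶ lift (optional V) := liftTrans (omitted V)
  have hθ (x) : Fam.IsInclusion (θ.app x) := isInclusion_liftTrans _ (fun a =>
    ⟨fun _ _ _ => rfl, fun _ => by change IsIso (𝟙 (incl.obj a)); infer_instance⟩) x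
  have hθ₀ (x) : Fam.IsInclusion (θ₀.app x) := isInclusion_liftTrans _ (fun a =>
    ⟨fun _ _ _ => rfl, fun _ => by change IsIso (𝟙 (𝟙_ (FreeSym V))); infer_instance⟩) x
  have h' : ((lift (optional V)).map s ⊗ₘ (lift (optional V)).map t) =
      ((lift (optional V)).map s' ⊗ₘ (lift (optional V)).map t') :=
    (lift_map_tensor (optional V) s t).symm.trans
      ((congrArg _ h).trans (lift_map_tensor (optional V) s' t'))
  -- Both sides are the restriction of one morphism of families of subwords, and the inclusion of
  -- the chosen member of the target is a monomorphism.
  have key : (J.map s ⊗ₘ J₀.map t) = (J.map s' ⊗ₘ J₀.map t') := by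
    have := ((hθ y₁).tensor (hθ₀ y₂)).mono
    rw [← cancel_mono (θ.app y₁ ⊗ₘ θ₀.app y₂), tensorHom_comp_tensorHom, tensorHom_comp_tensorHom,
      θ.naturality, θ.naturality, θ₀.naturality, θ₀.naturality, ← tensorHom_comp_tensorHom, h',
      tensorHom_comp_tensorHom]
  obtain ⟨i⟩ := nonempty_lift_const_iso (A := Fam (FreeSym V)) x₂
  obtain ⟨j⟩ := nonempty_lift_const_iso (A := Fam (FreeSym V)) y₂
  -- After deletion the second factor is isomorphic to the unit, so no information on `t` or `t'` is
  -- left there and the factor can be cancelled.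
  have ht (r : J₀.obj x₂ ⟶ J₀.obj y₂) : r = i.hom ≫ j.inv := by
    rw [← cancel_mono j.hom]
    exact Subsingleton.elim _ _
  rw [ht (J₀.map t), ht (J₀.map t'), MonoidalCategory.tensorHom_def,
    MonoidalCategory.tensorHom_def, cancel_mono] at key
  exact lift_single_injective (eq_of_whiskerRight_eq i key)

lemma tensorHom_injective_right {x₁ x₂ y₁ y₂ : FreeSym V} {s s' : x₁ ⟶ y₁} {t t' : x₂ ⟶ y₂}
    (h : (s ⊗ₘ t) = (s' ⊗ₘ t')) : t = t' := by
  refine tensorHom_injective_left (t := s) (t' := s') ?_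
  rw [← cancel_mono (β_ y₂ y₁).hom, BraidedCategory.braiding_naturality,
    BraidedCategory.braiding_naturality, h]

end TensorFaithful

end FreeSym
end FeynmanDec

namespace FeynmanDec

/-! ### Tensor products of separations -/

section Mix

variable {A : Type*} [Category* A] [MonoidalCategory A] [SymmetricCategory A]

/-- Symmetry, not only a braiding, is essential: two successive crossings of `X₁` and `Y₂` have to
cancel. -/
lemma tensorμ_braiding (X₁ X₂ Y₁ Y₂ : A) :
    (β_ (X₁ ⊗ X₂) (Y₁ ⊗ Y₂)).hom ≫ tensorμ Y₁ Y₂ X₁ X₂ =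
      tensorμ X₁ X₂ Y₁ Y₂ ≫ ((β_ X₁ Y₁).hom ⊗ₘ (β_ X₂ Y₂).hom) := by
  have h : Y₁ ◁ (β_ X₁ Y₂).hom ▷ X₂ ≫ Y₁ ◁ (β_ Y₂ X₁).hom ▷ X₂ = 𝟙 _ := by
    rw [← MonoidalCategory.whiskerLeft_comp, ← comp_whiskerRight, SymmetricCategory.symmetry,
      id_whiskerRight, MonoidalCategory.whiskerLeft_id]
  simp [tensorμ, SymmetricCategory.braiding_swap_eq_inv_braiding Y₁ X₂,
    MonoidalCategory.tensorHom_def, reassoc_of% h]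

/-- The product of two separations `X ⟶ L ⊗ R` and `X' ⟶ L' ⊗ R'`. -/
def mix {X L R X' L' R' : A} (k : X ⟶ L ⊗ R) (k' : X' ⟶ L' ⊗ R') :
    X ⊗ X' ⟶ (L ⊗ L') ⊗ (R ⊗ R') :=
  (k ⊗ₘ k') ≫ tensorμ _ _ _ _

variable {X L R X' L' R' X'' L'' R'' Y Y' : A}

lemma mix_natural (k : X ⟶ L ⊗ R) (k' : X' ⟶ L' ⊗ R') {L₁ R₁ L₁' R₁' : A} (f : L ⟶ L₁)
    (g : R ⟶ R₁) (f' : L' ⟶ L₁') (g' : R' ⟶ R₁') :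
    mix (k ≫ (f ⊗ₘ g)) (k' ≫ (f' ⊗ₘ g')) = mix k k' ≫ ((f ⊗ₘ f') ⊗ₘ (g ⊗ₘ g')) := by
  rw [mix, ← tensorHom_comp_tensorHom, Category.assoc, tensorμ_natural, mix, Category.assoc]

lemma tensorHom_comp_mix (s : Y ⟶ X) (s' : Y' ⟶ X') (k : X ⟶ L ⊗ R) (k' : X' ⟶ L' ⊗ R') :
    (s ⊗ₘ s') ≫ mix k k' = mix (s ≫ k) (s' ≫ k') := by
  rw [mix, tensorHom_comp_tensorHom_assoc, mix]

/-- Together with `mix_left`, `mix_right` and `mix_braid` this gives the structural cases of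
`FreeSym.cut_natural`. -/
lemma mix_assoc (k : X ⟶ L ⊗ R) (k' : X' ⟶ L' ⊗ R') (k'' : X'' ⟶ L'' ⊗ R'') :
    (α_ X X' X'').hom ≫ mix k (mix k' k'') =
      mix (mix k k') k'' ≫ ((α_ L L' L'').hom ⊗ₘ (α_ R R' R'').hom) := by
  have h₁ : (k ⊗ₘ mix k' k'') = (k ⊗ₘ (k' ⊗ₘ k'')) ≫ ((L ⊗ R) ◁ tensorμ L' R' L'' R'') := by
    rw [mix, ← id_tensorHom, tensorHom_comp_tensorHom, Category.comp_id]
  have h₂ : (mix k k' ⊗ₘ k'') = ((k ⊗ₘ k') ⊗ₘ k'') ≫ (tensorμ L R L' R' ▷ (L'' ⊗ R'')) := by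
    rw [mix, ← tensorHom_id, tensorHom_comp_tensorHom, Category.comp_id]
  rw [mix, h₁, mix, h₂, Category.assoc, Category.assoc, Category.assoc, tensor_associativity,
    associator_naturality_assoc]

lemma mix_left (k : X ⟶ L ⊗ R) :
    (λ_ X).hom ≫ k = mix (λ_ (𝟙_ A)).inv k ≫ ((λ_ L).hom ⊗ₘ (λ_ R).hom) := by
  rw [mix, MonoidalCategory.tensorHom_def', Category.assoc, Category.assoc,
    ← tensor_left_unitality, leftUnitor_naturality]

lemma mix_right (k : X ⟶ L ⊗ R) :
    (ρ_ X).hom ≫ k = mix k (λ_ (𝟙_ A)).inv ≫ ((ρ_ L).hom ⊗ₘ (ρ_ R).hom) := by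
  rw [mix, MonoidalCategory.tensorHom_def, Category.assoc, Category.assoc,
    ← tensor_right_unitality, rightUnitor_naturality]

lemma mix_braid (k : X ⟶ L ⊗ R) (k' : X' ⟶ L' ⊗ R') :
    (β_ X X').hom ≫ mix k' k = mix k k' ≫ ((β_ L L').hom ⊗ₘ (β_ R R').hom) := by
  rw [mix, ← BraidedCategory.braiding_naturality_assoc, tensorμ_braiding, mix, Category.assoc]

/-- All of `X` goes to the left and all of `Y` to the right. Only two units are interchanged, and
their braiding is the identity. -/
lemma mix_unitors (X Y : A) :
    mix (ρ_ X).inv (λ_ Y).inv = ((ρ_ X).inv ⊗ₘ (λ_ Y).inv) := by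
  have h : (β_ (𝟙_ A) (𝟙_ A)).hom = 𝟙 _ := by
    rw [← cancel_mono (λ_ (𝟙_ A)).hom, braiding_leftUnitor, Category.id_comp, unitors_equal]
  simp only [mix, tensorμ, h]
  monoidal

lemma mix_rightUnitors (X Y : A) :
    mix (ρ_ X).inv (ρ_ Y).inv = (ρ_ (X ⊗ Y)).inv ≫ (𝟙 (X ⊗ Y) ⊗ₘ (λ_ (𝟙_ A)).inv) := by
  rw [mix, ← cancel_mono ((X ⊗ Y) ◁ (λ_ (𝟙_ A)).hom ≫ (ρ_ (X ⊗ Y)).hom), Category.assoc,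
    ← rightUnitor_monoidal]
  simp

lemma mix_leftUnitors (X Y : A) :
    mix (λ_ X).inv (λ_ Y).inv = (λ_ (X ⊗ Y)).inv ≫ ((λ_ (𝟙_ A)).inv ⊗ₘ 𝟙 (X ⊗ Y)) := by
  rw [mix, ← cancel_mono ((λ_ (𝟙_ A)).hom ▷ (X ⊗ Y) ≫ (λ_ (X ⊗ Y)).hom), Category.assoc,
    ← leftUnitor_monoidal]
  simp

end Mix

namespace FreeSym

open Functor.LaxMonoidal Functor.OplaxMonoidal

/-! ### Two-colourings of words and recognition of tensor products -/

section Colouring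

/-- Colourings of the letters of a word by two colours. -/
def Col {V : Type u₁} : FreeSym V → Type
  | .of _ => Bool
  | .unit => PUnit
  | .tensor x y => Col x × Col y

/-- The colouring with a single colour. -/
def Col.const {V : Type u₁} (b : Bool) : ∀ x : FreeSym V, Col x
  | .of _ => b
  | .unit => ⟨⟩
  | .tensor x y => (Col.const b x, Col.const b y)

variable {V : Type u₁} [Category.{v₁} V]

/-- Transport of colourings along formal morphisms. -/
def preColMap : ∀ {x y : FreeSym V}, PreHom V x y → Col x → Col y
  | _, _, .of _ => fun c => c
  | _, _, .id _ => fun c => c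
  | _, _, .comp f g => fun c => preColMap g (preColMap f c)
  | _, _, .tensor f g => fun c => (preColMap f c.1, preColMap g c.2)
  | _, _, .assocHom _ _ _ => fun c => (c.1.1, (c.1.2, c.2))
  | _, _, .assocInv _ _ _ => fun c => ((c.1, c.2.1), c.2.2)
  | _, _, .leftHom _ => fun c => c.2
  | _, _, .leftInv _ => fun c => (⟨⟩, c)
  | _, _, .rightHom _ => fun c => c.1
  | _, _, .rightInv _ => fun c => (c, ⟨⟩)
  | _, _, .braid _ _ => fun c => (c.2, c.1)

lemma preColMap_eqv {x y : FreeSym V} {f g : PreHom V x y} (h : Eqv V f g) :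
    preColMap f = preColMap g := by
  induction h with
  | symm _ ih => exact ih.symm
  | trans _ _ ih ih' => exact ih.trans ih'
  | comp_congr _ _ ih ih' => simp only [preColMap, ih, ih']
  | tensor_congr _ _ ih ih' => simp only [preColMap, ih, ih']; rfl
  | _ => rfl

/-- Transport of colourings along morphisms of words. -/
def colMap {x y : FreeSym V} : (x ⟶ y) → Col x → Col y :=
  Quotient.lift preColMap fun _ _ h => preColMap_eqv h

lemma colMap_comp {x y z : FreeSym V} (s : x ⟶ y) (t : y ⟶ z) (c : Col x) :
    colMap (s ≫ t) c = colMap t (colMap s c) := by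
  obtain ⟨f⟩ := s; obtain ⟨g⟩ := t; rfl

lemma colMap_tensor {x y x' y' : FreeSym V} (s : x ⟶ y) (t : x' ⟶ y') (c : Col x) (d : Col x') :
    colMap (s ⊗ₘ t) ((c, d) : Col x × Col x') = ((colMap s c, colMap t d) : Col y × Col y') := by
  obtain ⟨f⟩ := s; obtain ⟨g⟩ := t; rfl

lemma colMap_const (b : Bool) {x y : FreeSym V} (s : x ⟶ y) :
    colMap s (Col.const b x) = Col.const b y := by
  induction s using hom_induction with
  | comp f g hf hg => rw [colMap_comp, hf, hg]
  | tensor f g hf hg =>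
    exact (colMap_tensor f g _ _).trans (congrArg₂ Prod.mk hf hg)
  | _ => rfl

/-- The identification of the colourings of `p^⊗ x` with those of `x`. -/
def colEquiv {U : Type u₂} [Category.{v₂} U] (p : U ⥤ V) :
    ∀ x : FreeSym U, Col ((mapWord p).obj x) → Col x
  | .of _ => fun c => c
  | .unit => fun c => c
  | .tensor x y => fun c => (colEquiv p x c.1, colEquiv p y c.2)

/-- Transport of colours sees only the permutation underlying `s`, which `p^⊗` does not change. So
the effect of `s` on colours can be read off from `p^⊗ s`. -/
lemma colEquiv_colMap {U : Type u₂} [Category.{v₂} U] (p : U ⥤ V) {x y : FreeSym U} (s : x ⟶ y) :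
    ∀ c, colEquiv p y (colMap ((mapWord p).map s) c) = colMap s (colEquiv p x c) := by
  induction s using hom_induction with
  | id X => intro c; rw [CategoryTheory.Functor.map_id]; rfl
  | comp f g hf hg => intro c; rw [Functor.map_comp, colMap_comp, colMap_comp, hg, hf]
  | tensor f g hf hg =>
    intro c
    rw [lift_map_tensor]
    refine (congrArg (colEquiv p _) (colMap_tensor ((mapWord p).map f) ((mapWord p).map g)
      c.1 c.2)).trans ?_
    exact (congrArg₂ Prod.mk (hf c.1) (hg c.2)).trans (colMap_tensor f g _ _).symm
  | _ => intro c; rfl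

lemma colEquiv_const {U : Type u₂} [Category.{v₂} U] (p : U ⥤ V) (b : Bool) (x : FreeSym U) :
    colEquiv p x (Col.const b _) = Col.const b x := by
  induction x using IsCompatible.word_induction with
  | tensor x y hx hy => exact congrArg₂ Prod.mk hx hy
  | _ => rfl

/-- The letters of colour `b` of a coloured word. -/
def part {V : Type u₁} (b : Bool) : ∀ x : FreeSym V, Col x → FreeSym V
  | .of a, c => match (show Bool from c) == b with
    | true => .of a
    | false => .unit
  | .unit, _ => .unit
  | .tensor x y, c => .tensor (part b x c.1) (part b y c.2)

/-- The separation of the letters of the two colours of a word. -/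
def cut : ∀ (x : FreeSym V) (c : Col x), x ⟶ part true x c ⊗ part false x c
  | .of a, c => match (show Bool from c) with
    | true => (ρ_ (incl.obj a)).inv
    | false => (λ_ (incl.obj a)).inv
  | .unit, _ => (λ_ (𝟙_ (FreeSym V))).inv
  | .tensor x y, c => mix (cut x c.1) (cut y c.2)

/-- A morphism of words matches letters with letters of the same transported colour, so it restricts
to the two monochromatic parts. The proof is an induction on generators. -/
lemma cut_natural {x y : FreeSym V} (s : x ⟶ y) :
    ∀ c : Col x, ∃ (s₁ : part true x c ⟶ part true y (colMap s c))
      (s₂ : part false x c ⟶ part false y (colMap s c)),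
      s ≫ cut y (colMap s c) = cut x c ≫ (s₁ ⊗ₘ s₂) := by
  -- The case of an inverse structural isomorphism follows by inverting the square of the
  -- isomorphism itself.
  have inv {x y : FreeSym V} (i : x ≅ y) (c : Col y)
      (e : colMap i.hom (colMap i.inv c) = c)
      (h : ∃ (s₁ : part true x (colMap i.inv c) ≅ part true y (colMap i.hom (colMap i.inv c)))
        (s₂ : part false x (colMap i.inv c) ≅ part false y (colMap i.hom (colMap i.inv c))),
        i.hom ≫ cut y (colMap i.hom (colMap i.inv c)) = cut x (colMap i.inv c) ≫ (s₁.hom ⊗ₘ s₂.hom)) :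
      ∃ (s₁ : part true y c ⟶ part true x (colMap i.inv c))
      (s₂ : part false y c ⟶ part false x (colMap i.inv c)),
      i.inv ≫ cut x (colMap i.inv c) = cut y c ≫ (s₁ ⊗ₘ s₂) := by
    generalize colMap i.inv c = d at *
    subst e
    obtain ⟨s₁, s₂, h⟩ := h
    refine ⟨s₁.inv, s₂.inv, ?_⟩
    rw [Iso.inv_comp_eq, reassoc_of% h, tensorHom_comp_tensorHom]
    simp
  induction s using hom_induction with
  | of g => exact fun c => match c with
    | true => ⟨incl.map g, 𝟙 _, by
        exact (rightUnitor_inv_naturality _).trans (congrArg _ (tensorHom_id _ _).symm)⟩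
    | false => ⟨𝟙 _, incl.map g, by
        exact (leftUnitor_inv_naturality _).trans (congrArg _ (id_tensorHom _ _).symm)⟩
  | id X => exact fun c => ⟨𝟙 _, 𝟙 _, (Category.id_comp _).trans
      ((Category.comp_id _).symm.trans (congrArg _ (id_tensorHom_id _ _).symm))⟩
  | comp f g hf hg =>
    intro c
    rw [colMap_comp]
    obtain ⟨s₁, s₂, h⟩ := hf c
    obtain ⟨t₁, t₂, h'⟩ := hg (colMap f c)
    exact ⟨s₁ ≫ t₁, s₂ ≫ t₂, by
      rw [Category.assoc, h', reassoc_of% h, tensorHom_comp_tensorHom]⟩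
  | @tensor X Y X' Y' f g hf hg =>
    rintro ⟨c, d⟩
    obtain ⟨s₁, s₂, h⟩ := hf c
    obtain ⟨t₁, t₂, h'⟩ := hg d
    have e := colMap_tensor f g c d
    have key : (f ⊗ₘ g) ≫ mix (cut Y (colMap f c)) (cut Y' (colMap g d)) =
      mix (cut X c) (cut X' d) ≫ ((s₁ ⊗ₘ t₁) ⊗ₘ (s₂ ⊗ₘ t₂)) := by
      rw [tensorHom_comp_mix, h, h', mix_natural]
    -- The type of `cut` depends on the colouring, so the transported colouring is generalised
    -- before it is replaced by the pair of its components.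
    revert e
    generalize colMap (f ⊗ₘ g) ((c, d) : Col X × Col X') = q
    rintro rfl
    exact ⟨s₁ ⊗ₘ t₁, s₂ ⊗ₘ t₂, key⟩
  | assocHom X Y Z => exact fun c => ⟨(α_ _ _ _).hom, (α_ _ _ _).hom, mix_assoc _ _ _⟩
  | assocInv X Y Z =>
    exact fun c => inv (α_ X Y Z) c rfl ⟨α_ _ _ _, α_ _ _ _, mix_assoc _ _ _⟩
  | leftHom X => exact fun c => ⟨(λ_ _).hom, (λ_ _).hom, mix_left _⟩
  | leftInv X => exact fun c => inv (λ_ X) c rfl ⟨λ_ _, λ_ _, mix_left _⟩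
  | rightHom X => exact fun c => ⟨(ρ_ _).hom, (ρ_ _).hom, mix_right _⟩
  | rightInv X => exact fun c => inv (ρ_ X) c rfl ⟨ρ_ _, ρ_ _, mix_right _⟩
  | braid X Y => exact fun c => ⟨(β_ _ _).hom, (β_ _ _).hom, mix_braid _ _⟩

/-- With a single colour the other part consists of units only, so the separation is a unitor up to
isomorphism. -/
lemma cut_true (x : FreeSym V) : ∃ (i : x ≅ part true x (Col.const true x))
    (j : 𝟙_ _ ≅ part false x (Col.const true x)),
    cut x (Col.const true x) = (ρ_ x).inv ≫ (i.hom ⊗ₘ j.hom) := by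
  induction x using IsCompatible.word_induction with
  | of a => exact ⟨Iso.refl _, Iso.refl _,
      (Category.comp_id _).symm.trans (congrArg _ (id_tensorHom_id _ _).symm)⟩
  | unit => exact ⟨Iso.refl _, Iso.refl _, unitors_inv_equal.trans
      ((Category.comp_id _).symm.trans (congrArg _ (id_tensorHom_id _ _).symm))⟩
  | tensor x y hx hy =>
    obtain ⟨i, j, h⟩ := hx
    obtain ⟨i', j', h'⟩ := hy
    refine ⟨i ⊗ᵢ i', (λ_ _).symm ≪≫ (j ⊗ᵢ j'), ?_⟩
    have key : mix (cut x (Col.const true x)) (cut y (Col.const true y)) =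
        (ρ_ (x ⊗ y)).inv ≫ ((i ⊗ᵢ i').hom ⊗ₘ ((λ_ (𝟙_ _)).symm ≪≫ (j ⊗ᵢ j')).hom) := by
      rw [h, h', mix_natural, mix_rightUnitors, Category.assoc, tensorHom_comp_tensorHom,
        Category.id_comp]
      rfl
    exact key

lemma cut_false (x : FreeSym V) : ∃ (i : 𝟙_ _ ≅ part true x (Col.const false x))
    (j : x ≅ part false x (Col.const false x)),
    cut x (Col.const false x) = (λ_ x).inv ≫ (i.hom ⊗ₘ j.hom) := by
  induction x using IsCompatible.word_induction with
  | of a => exact ⟨Iso.refl _, Iso.refl _,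
      (Category.comp_id _).symm.trans (congrArg _ (id_tensorHom_id _ _).symm)⟩
  | unit => exact ⟨Iso.refl _, Iso.refl _,
      (Category.comp_id _).symm.trans (congrArg _ (id_tensorHom_id _ _).symm)⟩
  | tensor x y hx hy =>
    obtain ⟨i, j, h⟩ := hx
    obtain ⟨i', j', h'⟩ := hy
    refine ⟨(λ_ _).symm ≪≫ (i ⊗ᵢ i'), j ⊗ᵢ j', ?_⟩
    have key : mix (cut x (Col.const false x)) (cut y (Col.const false y)) =
        (λ_ (x ⊗ y)).inv ≫ (((λ_ (𝟙_ _)).symm ≪≫ (i ⊗ᵢ i')).hom ⊗ₘ (j ⊗ᵢ j').hom) := by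
      rw [h, h', mix_natural, mix_leftUnitors, Category.assoc, tensorHom_comp_tensorHom,
        Category.id_comp]
      rfl
    exact key

/-- When the colours distinguish the two factors, separating them changes nothing essential. Through
this, naturality of `cut` becomes a tensor decomposition. -/
lemma exists_cut_eq (x y : FreeSym V) :
    ∃ (i : x ≅ part true (x ⊗ y) ((Col.const true x, Col.const false y) : Col x × Col y))
      (j : y ≅ part false (x ⊗ y) ((Col.const true x, Col.const false y) : Col x × Col y)),
      cut (x ⊗ y) ((Col.const true x, Col.const false y) : Col x × Col y) = (i.hom ⊗ₘ j.hom) := by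
  obtain ⟨i, j, h⟩ := cut_true x
  obtain ⟨i', j', h'⟩ := cut_false y
  refine ⟨(ρ_ x).symm ≪≫ (i ⊗ᵢ i'), (λ_ y).symm ≪≫ (j ⊗ᵢ j'), ?_⟩
  have key : mix (cut x (Col.const true x)) (cut y (Col.const false y)) =
      (((ρ_ x).symm ≪≫ (i ⊗ᵢ i')).hom ⊗ₘ ((λ_ y).symm ≪≫ (j ⊗ᵢ j')).hom) := by
    rw [h, h', mix_natural, mix_unitors, tensorHom_comp_tensorHom]
    rfl
  exact key

/-- A morphism of words which is a tensor product after applying `p^⊗` is a tensor product. -/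
lemma exists_eq_tensorHom {U : Type u₂} [Category.{v₂} U] (p : U ⥤ V) {x₁ x₂ y₁ y₂ : FreeSym U}
    (s : x₁ ⊗ x₂ ⟶ y₁ ⊗ y₂) (t₁ : (mapWord p).obj x₁ ⟶ (mapWord p).obj y₁)
    (t₂ : (mapWord p).obj x₂ ⟶ (mapWord p).obj y₂)
    (h : (mapWord p).map s ≫ δ (mapWord p) y₁ y₂ = δ (mapWord p) x₁ x₂ ≫ (t₁ ⊗ₘ t₂)) :
    ∃ (s₁ : x₁ ⟶ y₁) (s₂ : x₂ ⟶ y₂), s = (s₁ ⊗ₘ s₂) ∧ (mapWord p).map s₁ = t₁ ∧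
      (mapWord p).map s₂ = t₂ := by
  let c : Col (x₁ ⊗ x₂) := (Col.const true x₁, Col.const false x₂)
  let d : Col (y₁ ⊗ y₂) := (Col.const true y₁, Col.const false y₂)
  -- It is enough to transport colours along `p^⊗ s`. There the decomposition `t₁ ⊗ t₂` shows that
  -- the two factors keep their colours.
  have hc : colMap s c = d := by
    let c' : Col ((mapWord p).obj (x₁ ⊗ x₂)) := (Col.const true _, Col.const false _)
    let d' : Col ((mapWord p).obj (y₁ ⊗ y₂)) := (Col.const true _, Col.const false _)
    have e₁ : colEquiv p (x₁ ⊗ x₂) c' = c :=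
      congrArg₂ Prod.mk (colEquiv_const p true x₁) (colEquiv_const p false x₂)
    have e₂ : colEquiv p (y₁ ⊗ y₂) d' = d :=
      congrArg₂ Prod.mk (colEquiv_const p true y₁) (colEquiv_const p false y₂)
    have e₃ : colMap ((mapWord p).map s) c' = d' := by
      have e₄ : colMap ((mapWord p).map s) c' = colMap ((mapWord p).map s ≫ δ (mapWord p) y₁ y₂) c' :=
        (colMap_comp ((mapWord p).map s) (δ (mapWord p) y₁ y₂) c').symm
      rw [e₄, h, colMap_comp]
      exact (colMap_tensor t₁ t₂ (Col.const true _) (Col.const false _)).trans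
        (congrArg₂ Prod.mk (colMap_const true t₁) (colMap_const false t₂))
    rw [← e₁, ← colEquiv_colMap, e₃, e₂]
  have hs : ∃ (s₁ : part true (x₁ ⊗ x₂) c ⟶ part true (y₁ ⊗ y₂) d)
      (s₂ : part false (x₁ ⊗ x₂) c ⟶ part false (y₁ ⊗ y₂) d),
      s ≫ cut (y₁ ⊗ y₂) d = cut (x₁ ⊗ x₂) c ≫ (s₁ ⊗ₘ s₂) := hc ▸ cut_natural s c
  obtain ⟨s₁, s₂, e⟩ := hs
  obtain ⟨i, j, hi⟩ := exists_cut_eq x₁ x₂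
  obtain ⟨i', j', hi'⟩ := exists_cut_eq y₁ y₂
  have e' : s ≫ (i'.hom ⊗ₘ j'.hom) = (i.hom ⊗ₘ j.hom) ≫ (s₁ ⊗ₘ s₂) := by
    rw [← hi, ← hi']
    exact e
  have hs : s = ((i.hom ≫ s₁ ≫ i'.inv) ⊗ₘ (j.hom ≫ s₂ ≫ j'.inv)) := by
    rw [← tensorHom_comp_tensorHom, ← tensorHom_comp_tensorHom, ← reassoc_of% e',
      tensorHom_comp_tensorHom, Iso.hom_inv_id, Iso.hom_inv_id, id_tensorHom_id, Category.comp_id]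
  -- The images of the two components have the same tensor product as `t₁` and `t₂`; faithfulness of
  -- the tensor product on words then identifies them.
  have k : ((mapWord p).map (i.hom ≫ s₁ ≫ i'.inv) ⊗ₘ (mapWord p).map (j.hom ≫ s₂ ≫ j'.inv)) =
      (t₁ ⊗ₘ t₂) := by
    rw [← cancel_epi (δ (mapWord p) x₁ x₂), ← h, hs, Functor.OplaxMonoidal.δ_natural]
  exact ⟨_, _, hs, tensorHom_injective_left k, tensorHom_injective_right k⟩

end Colouring
end FreeSym
end FeynmanDec

namespace FeynmanDec

open Functor.LaxMonoidal Functor.OplaxMonoidal FreeSym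

/-! ### Hereditary categories and tensor final functors -/

section Hereditary

variable {V : Type u₁} [Category.{v₁} V] {A : Type u₂} [Category.{v₂} A] [MonoidalCategory A]
  [SymmetricCategory A]

/-- A symmetric monoidal category `A` with a functor from words such that morphisms of `A` to a
tensor product decompose uniquely, after a reordering of the word of the source. -/
structure IsHereditary (K : FreeSym V ⥤ A) [K.Braided] : Prop where
  exists_iso : ∀ X : A, ∃ x : FreeSym V, Nonempty (K.obj x ≅ X)
  exists_split : ∀ {x : FreeSym V} {Y₁ Y₂ : A} (φ : K.obj x ⟶ Y₁ ⊗ Y₂),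
    ∃ (x₁ x₂ : FreeSym V) (s : x ⟶ x₁ ⊗ x₂) (φ₁ : K.obj x₁ ⟶ Y₁) (φ₂ : K.obj x₂ ⟶ Y₂),
      φ = K.map s ≫ δ K x₁ x₂ ≫ (φ₁ ⊗ₘ φ₂)
  split_unique : ∀ {x₁ x₂ y₁ y₂ : FreeSym V} {Y₁ Y₂ : A} (s : x₁ ⊗ x₂ ⟶ y₁ ⊗ y₂)
    (φ₁ : K.obj x₁ ⟶ Y₁) (φ₂ : K.obj x₂ ⟶ Y₂) (ψ₁ : K.obj y₁ ⟶ Y₁) (ψ₂ : K.obj y₂ ⟶ Y₂),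
    K.map s ≫ δ K y₁ y₂ ≫ (ψ₁ ⊗ₘ ψ₂) = δ K x₁ x₂ ≫ (φ₁ ⊗ₘ φ₂) →
      ∃ (s₁ : x₁ ⟶ y₁) (s₂ : x₂ ⟶ y₂), s = (s₁ ⊗ₘ s₂) ∧ K.map s₁ ≫ ψ₁ = φ₁ ∧
        K.map s₂ ≫ ψ₂ = φ₂
  exists_unit : ∀ {x : FreeSym V} (φ : K.obj x ⟶ 𝟙_ A), ∃ s : x ⟶ 𝟙_ _, φ = K.map s ≫ η K

end Hereditary

section TensorFinal

variable {A : Type u₁} [Category.{v₁} A] [MonoidalCategory A] {B : Type u₂} [Category.{v₂} B]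
  [MonoidalCategory B]

/-- A monoidal functor `g` such that tensoring `(g ↓ Y₁) × (g ↓ Y₂) ⥤ (g ↓ Y₁ ⊗ Y₂)` is full and
essentially surjective, and such that the unit is terminal in `(g ↓ 𝟙)`. -/
structure IsTensorFinal (g : A ⥤ B) [g.Monoidal] : Prop where
  exists_split : ∀ {X : A} {Y₁ Y₂ : B} (φ : g.obj X ⟶ Y₁ ⊗ Y₂),
    ∃ (X₁ X₂ : A) (i : X ≅ X₁ ⊗ X₂) (φ₁ : g.obj X₁ ⟶ Y₁) (φ₂ : g.obj X₂ ⟶ Y₂),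
      φ = g.map i.hom ≫ δ g X₁ X₂ ≫ (φ₁ ⊗ₘ φ₂)
  split_map : ∀ {X₁ X₂ Z₁ Z₂ : A} {Y₁ Y₂ : B} (h : X₁ ⊗ X₂ ⟶ Z₁ ⊗ Z₂)
    (φ₁ : g.obj X₁ ⟶ Y₁) (φ₂ : g.obj X₂ ⟶ Y₂) (ψ₁ : g.obj Z₁ ⟶ Y₁) (ψ₂ : g.obj Z₂ ⟶ Y₂),
    g.map h ≫ δ g Z₁ Z₂ ≫ (ψ₁ ⊗ₘ ψ₂) = δ g X₁ X₂ ≫ (φ₁ ⊗ₘ φ₂) →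
      ∃ (h₁ : X₁ ⟶ Z₁) (h₂ : X₂ ⟶ Z₂), h = (h₁ ⊗ₘ h₂) ∧ g.map h₁ ≫ ψ₁ = φ₁ ∧ g.map h₂ ≫ ψ₂ = φ₂
  exists_unit : ∀ {X : A} (φ : g.obj X ⟶ 𝟙_ B), ∃ s : X ⟶ 𝟙_ A, φ = g.map s ≫ η g
  unit_unique : ∀ {X : A} (s t : X ⟶ 𝟙_ A), s = t

end TensorFinal

section

variable {V : Type u₁} [Category.{v₁} V] {A : Type u₂} [Category.{v₂} A] [MonoidalCategory A]
  [SymmetricCategory A] {V' : Type u₃} [Category.{v₃} V'] {B : Type u₄} [Category.{v₄} B]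
  [MonoidalCategory B] [SymmetricCategory B] {K : FreeSym V ⥤ A} [K.Braided]
  {L : FreeSym V' ⥤ B} [L.Braided] {g : A ⥤ B} [g.Braided] {p : V ⥤ V'}

lemma extIso_δ {K L : FreeSym V ⥤ A} [K.Braided] [L.Braided] (e : incl ⋙ K ≅ incl ⋙ L)
    (x y : FreeSym V) :
    δ K x y ≫ ((extIso e).hom.app x ⊗ₘ (extIso e).hom.app y) =
      (extIso e).hom.app (x ⊗ y) ≫ δ L x y := by
  change _ = (extIsoApp e (x ⊗ y)).hom ≫ _
  rw [extIsoApp_tensor, Category.assoc, Category.assoc, Functor.Monoidal.μ_δ, Category.comp_id]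
  rfl

lemma extIso_η {K L : FreeSym V ⥤ A} [K.Braided] [L.Braided] (e : incl ⋙ K ≅ incl ⋙ L) :
    (extIso e).hom.app (𝟙_ _) ≫ η L = η K := by
  change (extIsoApp e (𝟙_ _)).hom ≫ _ = _
  rw [extIsoApp_unit, Category.assoc, Functor.Monoidal.ε_η, Category.comp_id]

/-- Splittings exist in `B` along words of `V'` and are pulled back to words of `V` by `splits`.
Conversely, uniqueness of splittings in `B` makes the `p^⊗`-image of a reordering in `A` a tensor
product, and `exists_eq_tensorHom` brings this back to `A`. Invertibility in `V^⊗` turns the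
reordering of the source into an isomorphism. -/
lemma IsHereditary.isTensorFinal (hK : IsHereditary K) (hL : IsHereditary L)
    (hV : ∀ {x y : FreeSym V} (s : x ⟶ y), IsIso s)
    (e₀ : incl ⋙ mapWord p ⋙ L ≅ incl ⋙ K ⋙ g) : IsTensorFinal g := by
  let e : mapWord p ⋙ L ≅ K ⋙ g := extIso e₀
  have he {x y : FreeSym V} (s : x ⟶ y) : L.map ((mapWord p).map s) ≫ e.hom.app y =
    e.hom.app x ≫ g.map (K.map s) := e.hom.naturality s
  have heδ (x y : FreeSym V) : L.map (δ (mapWord p) x y) ≫ δ L _ _ ≫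
      (e.hom.app x ⊗ₘ e.hom.app y) = e.hom.app (x ⊗ y) ≫ g.map (δ K x y) ≫ δ g _ _ := by
    simpa using extIso_δ e₀ x y
  have heη : e.hom.app (𝟙_ _) ≫ g.map (η K) ≫ η g = L.map (η (mapWord p)) ≫ η L := by
    simpa using extIso_η e₀
  -- Fullness when the source is a tensor product of two words; the general source is reduced to
  -- this below by isomorphisms.
  have aux {x₁ x₂ : FreeSym V} {Z₁ Z₂ : A} {Y₁ Y₂ : B} (h : K.obj x₁ ⊗ K.obj x₂ ⟶ Z₁ ⊗ Z₂)
      (φ₁ : g.obj (K.obj x₁) ⟶ Y₁) (φ₂ : g.obj (K.obj x₂) ⟶ Y₂) (ψ₁ : g.obj Z₁ ⟶ Y₁)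
      (ψ₂ : g.obj Z₂ ⟶ Y₂)
      (H : g.map h ≫ δ g Z₁ Z₂ ≫ (ψ₁ ⊗ₘ ψ₂) = δ g _ _ ≫ (φ₁ ⊗ₘ φ₂)) :
      ∃ (h₁ : K.obj x₁ ⟶ Z₁) (h₂ : K.obj x₂ ⟶ Z₂), h = (h₁ ⊗ₘ h₂) ∧ g.map h₁ ≫ ψ₁ = φ₁ ∧
        g.map h₂ ≫ ψ₂ = φ₂ := by
    obtain ⟨w₁, w₂, s, h₁, h₂, hs⟩ := hK.exists_split (δ K x₁ x₂ ≫ h)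
    -- Both sides of `H` are read as splittings in `B` of one morphism, related by the image of `s`.
    -- Uniqueness forces that image to be a tensor product.
    obtain ⟨s₁', s₂', hs', k₁, k₂⟩ := hL.split_unique
      (μ (mapWord p) x₁ x₂ ≫ (mapWord p).map s ≫ δ (mapWord p) w₁ w₂)
      (e.hom.app x₁ ≫ φ₁) (e.hom.app x₂ ≫ φ₂)
      (e.hom.app w₁ ≫ g.map h₁ ≫ ψ₁) (e.hom.app w₂ ≫ g.map h₂ ≫ ψ₂) (by
        rw [← tensorHom_comp_tensorHom, ← tensorHom_comp_tensorHom, ← tensorHom_comp_tensorHom,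
          Functor.map_comp, Functor.map_comp, Category.assoc, Category.assoc,
          reassoc_of% heδ w₁ w₂, reassoc_of% he s, Functor.OplaxMonoidal.δ_natural_assoc,
          ← g.map_comp_assoc, ← g.map_comp_assoc, Category.assoc, ← hs, Functor.map_comp,
          Category.assoc, H, ← reassoc_of% heδ x₁ x₂]
        rw [← L.map_comp_assoc, Functor.Monoidal.μ_δ, L.map_id, Category.id_comp])
    obtain ⟨s₁, s₂, rfl, rfl, rfl⟩ := exists_eq_tensorHom p s s₁' s₂' (by
      rw [← hs', Functor.Monoidal.δ_μ_assoc])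
    refine ⟨K.map s₁ ≫ h₁, K.map s₂ ≫ h₂, ?_, ?_, ?_⟩
    · rw [← cancel_epi (δ K x₁ x₂), hs, ← tensorHom_comp_tensorHom,
        Functor.OplaxMonoidal.δ_natural_assoc]
    · rw [← cancel_epi (e.hom.app x₁), ← k₁, reassoc_of% he, Functor.map_comp, Category.assoc]
    · rw [← cancel_epi (e.hom.app x₂), ← k₂, reassoc_of% he, Functor.map_comp, Category.assoc]
  refine ⟨?_, ?_, ?_, ?_⟩
  · intro X Y₁ Y₂ φ
    obtain ⟨x, ⟨k⟩⟩ := hK.exists_iso X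
    obtain ⟨y₁, y₂, s, φ₁, φ₂, hs⟩ := hL.exists_split (e.hom.app x ≫ g.map k.hom ≫ φ)
    -- The reordering found in `B` is one of words of `V'`; up to factors acting on the two sides
    -- separately it comes from a reordering `t` of `x`.
    obtain ⟨x₁, x₂, t, s₁, s₂, rfl, -, -⟩ := Splits.tensor_iff.1 (splits p s)
    have := hV t
    refine ⟨_, _, k.symm ≪≫ asIso (K.map t) ≪≫ (Functor.Monoidal.μIso K x₁ x₂).symm,
      e.inv.app x₁ ≫ L.map s₁ ≫ φ₁, e.inv.app x₂ ≫ L.map s₂ ≫ φ₂, ?_⟩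
    rw [← cancel_epi (g.map k.hom), ← cancel_epi (e.hom.app x), hs, ← tensorHom_comp_tensorHom,
      ← tensorHom_comp_tensorHom, Functor.map_comp, Functor.map_comp, Category.assoc,
      Category.assoc, ← Functor.OplaxMonoidal.δ_natural_assoc]
    have h := heδ x₁ x₂
    have h' : (e.hom.app x₁ ⊗ₘ e.hom.app x₂) ≫ (e.inv.app x₁ ⊗ₘ e.inv.app x₂) = 𝟙 _ := by
      simp [tensorHom_comp_tensorHom]
    simp only [Iso.trans_hom, Iso.symm_hom, asIso_hom, Functor.Monoidal.μIso_inv, Functor.map_comp,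
      Category.assoc]
    rw [← g.map_comp_assoc k.hom, Iso.hom_inv_id, g.map_id, Category.id_comp, ← reassoc_of% he t,
      ← reassoc_of% h, reassoc_of% h']
  · intro X₁ X₂ Z₁ Z₂ Y₁ Y₂ h φ₁ φ₂ ψ₁ ψ₂ H
    obtain ⟨x₁, ⟨k₁⟩⟩ := hK.exists_iso X₁
    obtain ⟨x₂, ⟨k₂⟩⟩ := hK.exists_iso X₂
    obtain ⟨h₁, h₂, e₁, e₂, e₃⟩ := aux ((k₁.hom ⊗ₘ k₂.hom) ≫ h) (g.map k₁.hom ≫ φ₁)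
      (g.map k₂.hom ≫ φ₂) ψ₁ ψ₂ (by
        rw [Functor.map_comp, Category.assoc, H, ← Functor.OplaxMonoidal.δ_natural_assoc,
          tensorHom_comp_tensorHom])
    refine ⟨k₁.inv ≫ h₁, k₂.inv ≫ h₂, ?_, ?_, ?_⟩
    · rw [← tensorHom_comp_tensorHom, ← e₁, tensorHom_comp_tensorHom_assoc, Iso.inv_hom_id,
        Iso.inv_hom_id, id_tensorHom_id, Category.id_comp]
    · rw [Functor.map_comp, Category.assoc, e₂, ← g.map_comp_assoc, Iso.inv_hom_id, g.map_id,
        Category.id_comp]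
    · rw [Functor.map_comp, Category.assoc, e₃, ← g.map_comp_assoc, Iso.inv_hom_id, g.map_id,
        Category.id_comp]
  · intro X φ
    obtain ⟨x, ⟨k⟩⟩ := hK.exists_iso X
    obtain ⟨s, hs⟩ := hL.exists_unit (e.hom.app x ≫ g.map k.hom ≫ φ)
    obtain ⟨t, rfl⟩ := Splits.unit_iff.1 (splits p s)
    refine ⟨k.inv ≫ K.map t ≫ η K, ?_⟩
    rw [← cancel_epi (g.map k.hom), ← cancel_epi (e.hom.app x), hs, Functor.map_comp,
      Category.assoc, ← heη, reassoc_of% he t]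
    simp
  · intro X s t
    obtain ⟨x, ⟨k⟩⟩ := hK.exists_iso X
    obtain ⟨s', hs⟩ := hK.exists_unit (k.hom ≫ s)
    obtain ⟨t', ht⟩ := hK.exists_unit (k.hom ≫ t)
    rw [← cancel_epi k.hom, hs, ht, Subsingleton.elim s' t']

end

end FeynmanDec

/-! ### Feynman categories are hereditary -/

namespace FeynmanDec

open Functor.LaxMonoidal Functor.OplaxMonoidal FreeSym

section

variable {V : Type u₁} [Groupoid.{v₁} V] {A : Type u₂} [Category.{v₂} A] [MonoidalCategory A]
  [SymmetricCategory A] {U : Type u₃} [Groupoid.{v₃} U]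

/-- A category of words `K : V^⊗ ⥤ A`, fully faithful on isomorphisms, is hereditary as soon as the
morphisms of `A` are the tensor products of a groupoid `U` of morphisms to letters. -/
lemma IsHereditary.of_arrows {K : FreeSym V ⥤ A} [K.Braided] {S : FreeSym U ⥤ A} [S.Braided]
    (p : U ⥤ V) (θ : S ⟶ mapWord p ⋙ K)
    (hθδ : ∀ x y, θ.app (x ⊗ y) ≫ K.map (δ (mapWord p) x y) ≫ δ K _ _ =
      δ S x y ≫ (θ.app x ⊗ₘ θ.app y))
    (hθη : IsIso (θ.app (𝟙_ _)))
    (hK : ∀ X : A, ∃ x : FreeSym V, Nonempty (K.obj x ≅ X))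
    (hfull : ∀ {x y : FreeSym V} (i : K.obj x ≅ K.obj y), ∃ s : x ⟶ y, K.map s = i.hom)
    (hfaithful : ∀ {x y : FreeSym V} (s t : x ⟶ y), K.map s = K.map t → s = t)
    (harr : ∀ {X Y : A} (φ : X ⟶ Y), ∃ (W : FreeSym U) (a : S.obj W ≅ X)
      (b : K.obj ((mapWord p).obj W) ≅ Y), θ.app W ≫ b.hom = a.hom ≫ φ)
    (hiso : ∀ {W W' : FreeSym U} (a : S.obj W ≅ S.obj W')
      (b : K.obj ((mapWord p).obj W) ≅ K.obj ((mapWord p).obj W')),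
      a.hom ≫ θ.app W' = θ.app W ≫ b.hom →
        ∃ s : W ⟶ W', S.map s = a.hom ∧ K.map ((mapWord p).map s) = b.hom) :
    IsHereditary K := by
  have hnat {W W' : FreeSym U} (s : W ⟶ W') :
    S.map s ≫ θ.app W' = θ.app W ≫ K.map ((mapWord p).map s) := θ.naturality s
  have hK' (X : A) : ∃ x : FreeSym V, Nonempty (X ≅ K.obj x) := by
    obtain ⟨x, ⟨i⟩⟩ := hK X
    exact ⟨x, ⟨i.symm⟩⟩
  refine ⟨hK, ?_, ?_, ?_⟩
  · intro x Y₁ Y₂ φ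
    obtain ⟨y₁, ⟨k₁⟩⟩ := hK Y₁
    obtain ⟨y₂, ⟨k₂⟩⟩ := hK Y₂
    -- With the targets replaced by words, `φ` is isomorphic to an arrow `θ_W`, and the comparison
    -- of targets is a morphism of words to `y₁ ⊗ y₂`. Splitting the latter cuts `W` in two, and
    -- `θ_W` with it.
    obtain ⟨W, a, b, hW⟩ := harr (φ ≫ (k₁.inv ⊗ₘ k₂.inv) ≫ μ K y₁ y₂)
    obtain ⟨t, ht⟩ := hfull b
    obtain ⟨W₁, W₂, r, t₁, t₂, rfl, -, -⟩ := Splits.tensor_iff.1 (splits p t)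
    obtain ⟨x₁, ⟨c₁⟩⟩ := hK' (S.obj W₁)
    obtain ⟨x₂, ⟨c₂⟩⟩ := hK' (S.obj W₂)
    obtain ⟨s, hs⟩ := hfull (a.symm ≪≫ asIso (S.map r) ≪≫ (Functor.Monoidal.μIso S W₁ W₂).symm ≪≫
      (c₁ ⊗ᵢ c₂) ≪≫ Functor.Monoidal.μIso K x₁ x₂)
    refine ⟨x₁, x₂, s, c₁.inv ≫ θ.app W₁ ≫ K.map t₁ ≫ k₁.hom, c₂.inv ≫ θ.app W₂ ≫ K.map t₂ ≫ k₂.hom,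
      ?_⟩
    have e₁ : φ = a.inv ≫ θ.app W ≫ b.hom ≫ δ K y₁ y₂ ≫ (k₁.hom ⊗ₘ k₂.hom) := by
      rw [reassoc_of% hW, Iso.inv_hom_id_assoc, Functor.Monoidal.μ_δ_assoc,
        tensorHom_comp_tensorHom, Iso.inv_hom_id, Iso.inv_hom_id, id_tensorHom_id, Category.comp_id]
    rw [e₁, hs, ← ht, Functor.map_comp, Functor.map_comp, Category.assoc, Category.assoc,
      ← Functor.OplaxMonoidal.δ_natural_assoc, ← reassoc_of% hnat r,
      reassoc_of% hθδ W₁ W₂, tensorHom_comp_tensorHom, tensorHom_comp_tensorHom]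
    simp only [Iso.trans_hom, Iso.symm_hom, asIso_hom, Functor.Monoidal.μIso_inv,
      Functor.Monoidal.μIso_hom, Category.assoc, Functor.Monoidal.μ_δ_assoc, tensorIso_hom,
      tensorHom_comp_tensorHom, Iso.hom_inv_id_assoc]
  · intro x₁ x₂ y₁ y₂ Y₁ Y₂ s φ₁ φ₂ ψ₁ ψ₂ H
    obtain ⟨W₁, a₁, b₁, h₁⟩ := harr φ₁
    obtain ⟨W₂, a₂, b₂, h₂⟩ := harr φ₂
    obtain ⟨Z₁, c₁, d₁, k₁⟩ := harr ψ₁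
    obtain ⟨Z₂, c₂, d₂, k₂⟩ := harr ψ₂
    have : IsIso s := isIso_hom s
    -- By `H` the arrows at `W₁ ⊗ W₂` and `Z₁ ⊗ Z₂` are isomorphic, through `s` on sources and
    -- through a tensor product on targets.
    obtain ⟨σ, hσ, hσ'⟩ := hiso (W := W₁ ⊗ W₂) (W' := Z₁ ⊗ Z₂)
      ((Functor.Monoidal.μIso S W₁ W₂).symm ≪≫ (a₁ ⊗ᵢ a₂) ≪≫ Functor.Monoidal.μIso K x₁ x₂ ≪≫
        asIso (K.map s) ≪≫ (Functor.Monoidal.μIso K y₁ y₂).symm ≪≫ (c₁ ⊗ᵢ c₂).symm ≪≫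
        Functor.Monoidal.μIso S Z₁ Z₂)
      (K.mapIso (Functor.Monoidal.μIso (mapWord p) W₁ W₂).symm ≪≫
        (Functor.Monoidal.μIso K _ _).symm ≪≫ ((b₁ ≪≫ d₁.symm) ⊗ᵢ (b₂ ≪≫ d₂.symm)) ≪≫
        Functor.Monoidal.μIso K _ _ ≪≫ K.mapIso (Functor.Monoidal.μIso (mapWord p) Z₁ Z₂)) (by
      rw [← cancel_mono (K.map (δ (mapWord p) Z₁ Z₂) ≫ δ K _ _)]
      have l₁ : c₁.inv ≫ θ.app Z₁ = ψ₁ ≫ d₁.inv := by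
        rw [Iso.inv_comp_eq, ← reassoc_of% k₁, Iso.hom_inv_id, Category.comp_id]
      have l₂ : c₂.inv ≫ θ.app Z₂ = ψ₂ ≫ d₂.inv := by
        rw [Iso.inv_comp_eq, ← reassoc_of% k₂, Iso.hom_inv_id, Category.comp_id]
      simp only [Iso.trans_hom, Iso.symm_hom, asIso_hom, Functor.Monoidal.μIso_inv,
        Functor.Monoidal.μIso_hom, Category.assoc, tensorIso_hom, tensorIso_inv,
        Functor.mapIso_hom, hθδ, Functor.Monoidal.μ_δ_assoc, tensorHom_comp_tensorHom, l₁, l₂]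
      rw [← tensorHom_comp_tensorHom, reassoc_of% H, Functor.Monoidal.μ_δ_assoc,
        tensorHom_comp_tensorHom, tensorHom_comp_tensorHom, ← reassoc_of% h₁, ← reassoc_of% h₂, ← K.map_comp_assoc,
        Functor.Monoidal.μ_δ, K.map_id, Category.id_comp, Functor.Monoidal.μ_δ, Category.comp_id,
        reassoc_of% hθδ]
      simp only [tensorHom_comp_tensorHom])
    obtain ⟨t₁, ht₁⟩ := hfull (b₁ ≪≫ d₁.symm)
    obtain ⟨t₂, ht₂⟩ := hfull (b₂ ≪≫ d₂.symm)
    -- Being a tensor product on targets, `σ` is a tensor product; reading it on sources then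
    -- decomposes `s`.
    obtain ⟨σ₁, σ₂, rfl, rfl, rfl⟩ := exists_eq_tensorHom p σ t₁ t₂ (hfaithful _ _ (by
      rw [Functor.map_comp, Functor.map_comp, hσ', ← cancel_mono (δ K _ _), Category.assoc,
        Category.assoc, ← Functor.OplaxMonoidal.δ_natural, ht₁, ht₂]
      simp only [Iso.trans_hom, Iso.symm_hom, Functor.Monoidal.μIso_inv,
        Functor.Monoidal.μIso_hom, Category.assoc, tensorIso_hom, Functor.mapIso_hom]
      rw [← K.map_comp_assoc, Functor.Monoidal.μ_δ, K.map_id, Category.id_comp,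
        Functor.Monoidal.μ_δ, Category.comp_id]))
    obtain ⟨s₁, hs₁⟩ := hfull (a₁.symm ≪≫ asIso (S.map σ₁) ≪≫ c₁)
    obtain ⟨s₂, hs₂⟩ := hfull (a₂.symm ≪≫ asIso (S.map σ₂) ≪≫ c₂)
    refine ⟨s₁, s₂, hfaithful _ _ ?_, ?_, ?_⟩
    · rw [← cancel_mono (δ K y₁ y₂), ← Functor.OplaxMonoidal.δ_natural, hs₁, hs₂]
      have q : (S.map σ₁ ⊗ₘ S.map σ₂) = (a₁.hom ⊗ₘ a₂.hom) ≫ μ K x₁ x₂ ≫ K.map s ≫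
          δ K y₁ y₂ ≫ (c₁.inv ⊗ₘ c₂.inv) := by
        rw [← cancel_epi (δ S W₁ W₂), Functor.OplaxMonoidal.δ_natural, hσ]
        simp
      simp only [Iso.trans_hom, Iso.symm_hom, asIso_hom]
      rw [← tensorHom_comp_tensorHom, ← tensorHom_comp_tensorHom, q]
      simp [tensorHom_comp_tensorHom_assoc, tensorHom_comp_tensorHom]
    · rw [hs₁]
      simp only [Iso.trans_hom, Iso.symm_hom, asIso_hom, Category.assoc]
      rw [← k₁, reassoc_of% hnat σ₁, ht₁]
      simp [h₁]
    · rw [hs₂]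
      simp only [Iso.trans_hom, Iso.symm_hom, asIso_hom, Category.assoc]
      rw [← k₂, reassoc_of% hnat σ₂, ht₂]
      simp [h₂]
  · intro x φ
    obtain ⟨W, a, b, hW⟩ := harr (φ ≫ ε K)
    obtain ⟨t, ht⟩ := hfull b
    obtain ⟨r, rfl⟩ := Splits.unit_iff.1 (splits p t)
    have hr := hnat r
    -- `W` is isomorphic to the unit word, where `θ` is invertible. So `φ` is invertible, and
    -- fullness on isomorphisms applies to it.
    have : IsIso (θ.app W) := by
      have e : θ.app W = S.map r ≫ θ.app (𝟙_ _) ≫ inv (K.map ((mapWord p).map r)) := by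
        rw [reassoc_of% hr, IsIso.hom_inv_id, Category.comp_id]
      rw [e]
      infer_instance
    have : IsIso (φ ≫ ε K) := by
      rw [← (Iso.inv_comp_eq a).2 hW]
      infer_instance
    obtain ⟨s, hs⟩ := hfull (x := x) (y := 𝟙_ _) (asIso (φ ≫ ε K))
    exact ⟨s, by rw [hs]; simp⟩

end

end FeynmanDec

namespace FeynmanDec

open Functor.LaxMonoidal Functor.OplaxMonoidal FreeSym

section

variable {V : Type u₁} [Category.{v₁} V] {A : Type u₂} [Category.{v₂} A] [MonoidalCategory A]
  [SymmetricCategory A]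

lemma liftTrans_δ {G H : V ⥤ A} (τ : G ⟶ H) (x y : FreeSym V) :
    (liftTrans τ).app (x ⊗ y) ≫ δ (lift H) x y =
      δ (lift G) x y ≫ ((liftTrans τ).app x ⊗ₘ (liftTrans τ).app y) :=
  (Category.comp_id (liftApp τ x ⊗ₘ liftApp τ y)).trans (Category.id_comp _).symm

end

section

variable {V : Type u₁} [Groupoid.{v₁} V] {A : Type u₂} [Category.{v₂} A] [MonoidalCategory A]
  [SymmetricCategory A]

/-- In `IsHereditary.of_arrows` the groupoid `U` is `Iso(A ↓ V)`, `S` and `p` record sources and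
targets, and `θ` is the tensor product of arrows. The isomorphism condition handles isomorphisms
between words; the hereditary condition provides the arrows (essential surjectivity) and their
isomorphisms (fullness). -/
lemma IsFeynmanCategory.isHereditary {ι : V ⥤ A} (h : IsFeynmanCategory.{w} ι) :
    IsHereditary (lift ι) := by
  have := h.isomorphism_condition
  have := h.hereditary_condition
  let G₀ : IsoOver ι ⥤ A := Core.inclusion _ ⋙ Comma.fst (𝟭 A) ι ⋙ 𝟭 A
  let G₁ : IsoOver ι ⥤ A := Core.inclusion _ ⋙ Comma.snd (𝟭 A) ι ⋙ ι
  let τ : G₀ ⟶ G₁ := Functor.whiskerLeft (Core.inclusion _) (Comma.natTrans (𝟭 A) ι)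
  let p : IsoOver ι ⥤ V := Core.inclusion _ ⋙ Comma.snd (𝟭 A) ι
  let e₀ : incl ⋙ mapWord p ⋙ lift ι ≅ incl ⋙ lift G₁ := Iso.refl G₁
  -- The word of targets can be formed in `V^⊗` and then evaluated, or evaluated directly in `A`.
  -- The results agree on letters, hence are isomorphic.
  let e : mapWord p ⋙ lift ι ≅ lift G₁ := extIso e₀
  refine IsHereditary.of_arrows (S := lift G₀) p (liftTrans τ ≫ e.inv) ?_ ?_ ?_ ?_ ?_ ?_ ?_
  · intro x y
    have h₁ : ((lift ι).map (δ (mapWord p) x y) ≫ δ (lift ι) _ _) ≫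
        (e.hom.app x ⊗ₘ e.hom.app y) = e.hom.app (x ⊗ y) ≫ δ (lift G₁) x y := extIso_δ e₀ x y
    have h₂ : (e.hom.app x ⊗ₘ e.hom.app y) ≫ (e.inv.app x ⊗ₘ e.inv.app y) = 𝟙 _ := by
      simp [tensorHom_comp_tensorHom]
    have h₃ : e.inv.app (x ⊗ y) ≫ (lift ι).map (δ (mapWord p) x y) ≫ δ (lift ι) _ _ =
        δ (lift G₁) x y ≫ (e.inv.app x ⊗ₘ e.inv.app y) := by
      rw [← cancel_epi (e.hom.app (x ⊗ y)), ← reassoc_of% h₁, h₂, Iso.hom_inv_id_app_assoc]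
      exact congrArg (_ ≫ ·) (Category.comp_id _).symm
    rw [NatTrans.comp_app, NatTrans.comp_app, NatTrans.comp_app, ← tensorHom_comp_tensorHom,
      ← reassoc_of% liftTrans_δ, Category.assoc, h₃]
  · have : IsIso ((liftTrans τ).app (𝟙_ _)) := inferInstanceAs (IsIso (𝟙 (𝟙_ A)))
    rw [NatTrans.comp_app]
    infer_instance
  · intro X
    exact ⟨_, ⟨(Core.inclusion A).mapIso ((Core.functorToCore (lift ι)).objObjPreimageIso ⟨X⟩)⟩⟩
  · intro x y i
    obtain ⟨s, hs⟩ := (Core.functorToCore (lift ι)).map_surjective (X := x) (Y := y) ⟨i⟩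
    exact ⟨s, congrArg (fun j => j.iso.hom) hs⟩
  · intro x y s t hst
    exact (Core.functorToCore (lift ι)).map_injective (Core.hom_ext hst)
  · intro X Y φ
    let W := (Core.functorToCore (tensorArrows ι)).objPreimage ⟨Arrow.mk φ⟩
    let j : (tensorArrows ι).obj W ≅ Arrow.mk φ :=
      (Core.inclusion _).mapIso ((Core.functorToCore (tensorArrows ι)).objObjPreimageIso ⟨Arrow.mk φ⟩)
    refine ⟨W, Arrow.leftFunc.mapIso j, e.app W ≪≫ Arrow.rightFunc.mapIso j, ?_⟩
    have hj : (liftTrans τ).app W ≫ j.hom.right = j.hom.left ≫ φ := (Arrow.w j.hom).symm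
    change ((liftTrans τ).app W ≫ e.inv.app W) ≫ e.hom.app W ≫ j.hom.right = j.hom.left ≫ φ
    let r : (lift G₁).obj W ⟶ Y := j.hom.right
    exact (Category.assoc _ _ _).trans ((congrArg ((liftTrans τ).app W ≫ ·)
      (Iso.inv_hom_id_app_assoc e W r)).trans hj)
  · intro W W' a b hab
    have hab' : a.hom ≫ (liftTrans τ).app W' =
        (liftTrans τ).app W ≫ e.inv.app W ≫ b.hom ≫ e.hom.app W' := by
      have := hab =≫ e.hom.app W'
      simpa using this
    let j : (tensorArrows ι).obj W ≅ (tensorArrows ι).obj W' :=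
      Arrow.isoMk a ((e.app W).symm ≪≫ b ≪≫ e.app W') hab'
    obtain ⟨s, hs⟩ := (Core.functorToCore (tensorArrows ι)).map_surjective (X := W) (Y := W') ⟨j⟩
    have hs' : (tensorArrows ι).map s = j.hom := congrArg (fun k => k.iso.hom) hs
    refine ⟨s, congrArg (fun k => k.left) hs', ?_⟩
    have h₁ : (lift G₁).map s = e.inv.app W ≫ b.hom ≫ e.hom.app W' :=
      congrArg (fun k => k.right) hs'
    have h₂ : (lift ι).map ((mapWord p).map s) ≫ e.hom.app W' = e.hom.app W ≫ (lift G₁).map s :=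
      e.hom.naturality s
    rw [h₁] at h₂
    rw [← cancel_mono (e.hom.app W')]
    simpa using h₂

end

end FeynmanDec

namespace FeynmanDec

open Functor.LaxMonoidal Functor.OplaxMonoidal

/-! ### Pointwise Kan extensions and tensor products of colimits -/

section Kan

variable {A : Type u₁} [Category.{v₁} A] {B : Type u₂} [Category.{v₂} B]
  {C : Type u₃} [Category.{v₃} C] {g : A ⥤ B} {F : A ⥤ C} {L : B ⥤ C}

/-- The structure map `F X ⟶ L Y` of a left extension at `φ : g X ⟶ Y`. -/
def inj (u : F ⟶ g ⋙ L) {X : A} {Y : B} (φ : g.obj X ⟶ Y) : F.obj X ⟶ L.obj Y :=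
  u.app X ≫ L.map φ

variable (u : F ⟶ g ⋙ L)

lemma map_inj {X X' : A} {Y : B} (h : X ⟶ X') (φ : g.obj X' ⟶ Y) :
    F.map h ≫ inj u φ = inj u (g.map h ≫ φ) := by
  simp [inj]

lemma inj_map {X : A} {Y Y' : B} (φ : g.obj X ⟶ Y) (ψ : Y ⟶ Y') :
    inj u φ ≫ L.map ψ = inj u (φ ≫ ψ) := by
  simp [inj]

variable {u} (hu : (Functor.LeftExtension.mk L u).IsPointwiseLeftKanExtension)

include hu in
-- The functor `T` carries further tensor factors along, since `T (L Y)` is again a colimit; `T = 𝟭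
-- C` gives joint epimorphy for `L Y` itself.
lemma inj_ext (T : C ⥤ C) (Y : B) [PreservesColimitsOfShape (CostructuredArrow g Y) T]
    {Z : C} {a b : T.obj (L.obj Y) ⟶ Z}
    (h : ∀ (X : A) (φ : g.obj X ⟶ Y), T.map (inj u φ) ≫ a = T.map (inj u φ) ≫ b) : a = b :=
  (isColimitOfPreserves T (hu Y)).hom_ext fun j => h j.left j.hom

include hu in
lemma exists_desc (T : C ⥤ C) (Y : B) [PreservesColimitsOfShape (CostructuredArrow g Y) T]
    {Z : C} (s : ∀ {X : A} (_ : g.obj X ⟶ Y), T.obj (F.obj X) ⟶ Z)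
    (hs : ∀ {X X' : A} (h : X ⟶ X') (φ : g.obj X' ⟶ Y),
      T.map (F.map h) ≫ s φ = s (g.map h ≫ φ)) :
    ∃ d : T.obj (L.obj Y) ⟶ Z, ∀ {X : A} (φ : g.obj X ⟶ Y), T.map (inj u φ) ≫ d = s φ := by
  let c : Cocone ((CostructuredArrow.proj g Y ⋙ F) ⋙ T) :=
    { pt := Z
      ι := { app := fun j => s j.hom
             naturality := fun j k m => by
              have := hs m.left k.hom
              rw [CostructuredArrow.w m] at this
              exact this.trans (Category.comp_id _).symm } }
  exact ⟨(isColimitOfPreserves T (hu Y)).desc c, fun φ =>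
    (isColimitOfPreserves T (hu Y)).fac c (CostructuredArrow.mk φ)⟩

end Kan

section MonoidalKan

variable {A : Type u₁} [Category.{v₁} A] [MonoidalCategory A] {B : Type u₂} [Category.{v₂} B]
  [MonoidalCategory B] {C : Type u₃} [Category.{v₃} C] [MonoidalCategory C]
  {g : A ⥤ B} {F : A ⥤ C} {L : B ⥤ C}
  {u : F ⟶ g ⋙ L} (hu : (Functor.LeftExtension.mk L u).IsPointwiseLeftKanExtension)
  [∀ (Y : B) (X : C), PreservesColimitsOfShape (CostructuredArrow g Y) (tensorLeft X)]
  [∀ (Y : B) (X : C), PreservesColimitsOfShape (CostructuredArrow g Y) (tensorRight X)]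

include hu in
lemma tensor_inj_ext {Y₁ Y₂ : B} {Z : C} {a b : L.obj Y₁ ⊗ L.obj Y₂ ⟶ Z}
    (h : ∀ (X₁ X₂ : A) (φ₁ : g.obj X₁ ⟶ Y₁) (φ₂ : g.obj X₂ ⟶ Y₂),
      (inj u φ₁ ⊗ₘ inj u φ₂) ≫ a = (inj u φ₁ ⊗ₘ inj u φ₂) ≫ b) : a = b := by
  refine inj_ext hu (tensorLeft (L.obj Y₁)) Y₂ fun X₂ φ₂ => ?_
  refine inj_ext hu (tensorRight (F.obj X₂)) Y₁ fun X₁ φ₁ => ?_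
  simpa [MonoidalCategory.tensorHom_def] using h X₁ X₂ φ₁ φ₂

include hu in
lemma tensor_tensor_inj_ext {Y₁ Y₂ Y₃ : B} {Z : C}
    {a b : (L.obj Y₁ ⊗ L.obj Y₂) ⊗ L.obj Y₃ ⟶ Z}
    (h : ∀ (X₁ X₂ X₃ : A) (φ₁ : g.obj X₁ ⟶ Y₁) (φ₂ : g.obj X₂ ⟶ Y₂) (φ₃ : g.obj X₃ ⟶ Y₃),
      ((inj u φ₁ ⊗ₘ inj u φ₂) ⊗ₘ inj u φ₃) ≫ a = ((inj u φ₁ ⊗ₘ inj u φ₂) ⊗ₘ inj u φ₃) ≫ b) :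
    a = b := by
  refine inj_ext hu (tensorLeft (L.obj Y₁ ⊗ L.obj Y₂)) Y₃ fun X₃ φ₃ => ?_
  refine inj_ext hu (tensorLeft (L.obj Y₁) ⋙ tensorRight (F.obj X₃)) Y₂ fun X₂ φ₂ => ?_
  refine inj_ext hu (tensorRight (F.obj X₂) ⋙ tensorRight (F.obj X₃)) Y₁ fun X₁ φ₁ => ?_
  simpa [MonoidalCategory.tensorHom_def] using h X₁ X₂ X₃ φ₁ φ₂ φ₃

include hu in
-- The universal property of a colimit in two variables, obtained one variable at a time: for fixed
-- `φ₁` the maps glue to `F X₁ ⊗ L Y₂ ⟶ Z`, and these then glue over `φ₁`.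
lemma exists_tensor_desc (Y₁ Y₂ : B) {Z : C}
    (s : ∀ {X₁ X₂ : A} (_ : g.obj X₁ ⟶ Y₁) (_ : g.obj X₂ ⟶ Y₂), F.obj X₁ ⊗ F.obj X₂ ⟶ Z)
    (hs : ∀ {X₁ X₂ X₁' X₂' : A} (h₁ : X₁ ⟶ X₁') (h₂ : X₂ ⟶ X₂') (φ₁ : g.obj X₁' ⟶ Y₁)
      (φ₂ : g.obj X₂' ⟶ Y₂),
      (F.map h₁ ⊗ₘ F.map h₂) ≫ s φ₁ φ₂ = s (g.map h₁ ≫ φ₁) (g.map h₂ ≫ φ₂)) :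
    ∃ d : L.obj Y₁ ⊗ L.obj Y₂ ⟶ Z, ∀ {X₁ X₂ : A} (φ₁ : g.obj X₁ ⟶ Y₁) (φ₂ : g.obj X₂ ⟶ Y₂),
      (inj u φ₁ ⊗ₘ inj u φ₂) ≫ d = s φ₁ φ₂ := by
  have h₁ {X₁ : A} (φ₁ : g.obj X₁ ⟶ Y₁) :=
    exists_desc hu (tensorLeft (F.obj X₁)) Y₂ (fun φ₂ => s φ₁ φ₂) fun h φ₂ => by
      simpa using hs (𝟙 _) h φ₁ φ₂
  choose t ht using @h₁
  obtain ⟨d, hd⟩ := exists_desc hu (tensorRight (L.obj Y₂)) Y₁ t fun {X X'} h φ₁ => by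
    refine inj_ext hu (tensorLeft (F.obj X)) Y₂ fun X₂ φ₂ => ?_
    have e := hs h (𝟙 X₂) φ₁ φ₂
    simp only [CategoryTheory.Functor.map_id, tensorHom_id, Category.id_comp] at e
    have k : F.obj X' ◁ inj u φ₂ ≫ t φ₁ = s φ₁ φ₂ := ht φ₁ φ₂
    refine Eq.trans ?_ (e.trans (ht _ φ₂).symm)
    change F.obj X ◁ inj u φ₂ ≫ F.map h ▷ L.obj Y₂ ≫ t φ₁ = _
    rw [whisker_exchange_assoc, k]
  refine ⟨d, fun {X₁ X₂} φ₁ φ₂ => ?_⟩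
  rw [MonoidalCategory.tensorHom_def', Category.assoc]
  have k : inj u φ₁ ▷ L.obj Y₂ ≫ d = t φ₁ := hd φ₁
  rw [k]
  exact ht φ₁ φ₂

end MonoidalKan

section TensorFinalKan

variable {A : Type u₁} [Category.{v₁} A] [MonoidalCategory A] {B : Type u₂} [Category.{v₂} B]
  [MonoidalCategory B] {C : Type u₃} [Category.{v₃} C] [MonoidalCategory C]
  {g : A ⥤ B} [g.Monoidal] {F : A ⥤ C} [F.Monoidal] {L : B ⥤ C} {u : F ⟶ g ⋙ L}
  (hg : IsTensorFinal g)

include hg in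
-- Fullness makes `h` a tensor product of morphisms over `Y₁` and `Y₂`. This is why a map to `L Y₁ ⊗
-- L Y₂` defined through a chosen splitting does not depend on the choice.
lemma IsTensorFinal.map_δ_inj {X₁ X₂ Z₁ Z₂ : A} {Y₁ Y₂ : B} (h : X₁ ⊗ X₂ ⟶ Z₁ ⊗ Z₂)
    (φ₁ : g.obj X₁ ⟶ Y₁) (φ₂ : g.obj X₂ ⟶ Y₂) (ψ₁ : g.obj Z₁ ⟶ Y₁) (ψ₂ : g.obj Z₂ ⟶ Y₂)
    (e : g.map h ≫ δ g Z₁ Z₂ ≫ (ψ₁ ⊗ₘ ψ₂) = δ g X₁ X₂ ≫ (φ₁ ⊗ₘ φ₂)) :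
    F.map h ≫ δ F Z₁ Z₂ ≫ (inj u ψ₁ ⊗ₘ inj u ψ₂) = δ F X₁ X₂ ≫ (inj u φ₁ ⊗ₘ inj u φ₂) := by
  obtain ⟨h₁, h₂, rfl, rfl, rfl⟩ := hg.split_map h φ₁ φ₂ ψ₁ ψ₂ e
  rw [← Functor.OplaxMonoidal.δ_natural_assoc, tensorHom_comp_tensorHom, map_inj, map_inj]

variable (hu : (Functor.LeftExtension.mk L u).IsPointwiseLeftKanExtension)

include hg hu in
-- The unit with `η g` is terminal in `(g ↓ 𝟙)`, so the colimit is the value of `F` there, which is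
-- the unit of `C`.
lemma IsTensorFinal.exists_unitIso :
    ∃ i : 𝟙_ C ≅ L.obj (𝟙_ B), i.hom = ε F ≫ inj u (η g) := by
  choose s hs using @hg.exists_unit
  obtain ⟨d, hd⟩ := exists_desc hu (𝟭 C) (𝟙_ B) (fun φ => F.map (s φ) ≫ η F) fun h φ => by
    rw [Functor.id_map, ← F.map_comp_assoc, hg.unit_unique (h ≫ s φ)]
  refine ⟨⟨ε F ≫ inj u (η g), d, ?_, ?_⟩, rfl⟩
  · have := hd (η g)
    rw [Functor.id_map] at this
    rw [Category.assoc, this, hg.unit_unique (s (η g)) (𝟙 _)]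
    simp
  · refine inj_ext hu (𝟭 C) (𝟙_ B) fun X φ => ?_
    rw [← Category.assoc, hd]
    simp only [Category.assoc, Functor.Monoidal.η_ε_assoc, map_inj, Functor.id_map]
    rw [← hs]
    exact (Category.comp_id _).symm

variable [∀ (Y : B) (X : C), PreservesColimitsOfShape (CostructuredArrow g Y) (tensorLeft X)]
  [∀ (Y : B) (X : C), PreservesColimitsOfShape (CostructuredArrow g Y) (tensorRight X)]

include hg hu in
-- One direction tensors structure maps; the other sends the structure map at `φ` to those of a
-- chosen splitting of `φ`.
lemma IsTensorFinal.exists_tensorIso (Y₁ Y₂ : B) :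
    ∃ i : L.obj Y₁ ⊗ L.obj Y₂ ≅ L.obj (Y₁ ⊗ Y₂),
      ∀ {X₁ X₂ : A} (φ₁ : g.obj X₁ ⟶ Y₁) (φ₂ : g.obj X₂ ⟶ Y₂),
        (inj u φ₁ ⊗ₘ inj u φ₂) ≫ i.hom = μ F X₁ X₂ ≫ inj u (δ g X₁ X₂ ≫ (φ₁ ⊗ₘ φ₂)) := by
  obtain ⟨m, hm⟩ := exists_tensor_desc hu Y₁ Y₂
    (fun {X₁ X₂} φ₁ φ₂ => μ F X₁ X₂ ≫ inj u (δ g X₁ X₂ ≫ (φ₁ ⊗ₘ φ₂))) fun h₁ h₂ φ₁ φ₂ => by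
      rw [μ_natural_assoc, map_inj, ← Functor.OplaxMonoidal.δ_natural_assoc,
        tensorHom_comp_tensorHom]
  have h {X : A} (φ : g.obj X ⟶ Y₁ ⊗ Y₂) := hg.exists_split φ
  choose X₁ X₂ i φ₁ φ₂ hφ using @h
  obtain ⟨n, hn⟩ := exists_desc hu (𝟭 C) (Y₁ ⊗ Y₂)
    (fun φ => F.map (i φ).hom ≫ δ F _ _ ≫ (inj u (φ₁ φ) ⊗ₘ inj u (φ₂ φ))) fun h φ => by
      rw [← cancel_epi (F.map (i (g.map h ≫ φ)).inv)]
      -- The splittings chosen for `g h ≫ φ` and for `φ` are compared through `h`, conjugated by the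
      -- chosen isomorphisms.
      have := hg.map_δ_inj (F := F) (u := u) ((i (g.map h ≫ φ)).inv ≫ h ≫ (i φ).hom) _ _ _ _ (by
        rw [Functor.map_comp, Category.assoc, Functor.map_comp, Category.assoc, ← hφ φ]
        exact (Iso.inv_comp_eq (g.mapIso (i (g.map h ≫ φ)))).2 (hφ (g.map h ≫ φ)))
      simpa using this
  refine ⟨⟨m, n, ?_, ?_⟩, hm⟩
  · refine tensor_inj_ext hu fun Z₁ Z₂ ψ₁ ψ₂ => ?_
    have := hn (δ g Z₁ Z₂ ≫ (ψ₁ ⊗ₘ ψ₂))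
    rw [Functor.id_map] at this
    rw [reassoc_of% hm, this, hg.map_δ_inj _ _ _ _ _ (hφ _).symm]
    simp
  · refine inj_ext hu (𝟭 C) (Y₁ ⊗ Y₂) fun X φ => ?_
    have := hn φ
    rw [← Category.assoc, this, Category.assoc, Category.assoc, hm, Functor.Monoidal.δ_μ_assoc,
      map_inj, ← hφ]
    exact (Category.comp_id _).symm

end TensorFinalKan

end FeynmanDec

namespace FeynmanDec

open Functor.LaxMonoidal Functor.OplaxMonoidal

/-! ### The symmetric monoidal structure on the Kan extension and the pushforward -/

section KanStructure

variable {A : Type u₁} [Category.{v₁} A] [MonoidalCategory A] {B : Type u₂} [Category.{v₂} B]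
  [MonoidalCategory B] {C : Type u₃} [Category.{v₃} C] [MonoidalCategory C]
  {g : A ⥤ B} [g.Monoidal] {F : A ⥤ C} [F.Monoidal] {L : B ⥤ C} {u : F ⟶ g ⋙ L}
  (hg : IsTensorFinal g) (hu : (Functor.LeftExtension.mk L u).IsPointwiseLeftKanExtension)
  [∀ (Y : B) (X : C), PreservesColimitsOfShape (CostructuredArrow g Y) (tensorLeft X)]
  [∀ (Y : B) (X : C), PreservesColimitsOfShape (CostructuredArrow g Y) (tensorRight X)]

/-- The isomorphism `L Y₁ ⊗ L Y₂ ≅ L (Y₁ ⊗ Y₂)` for a pointwise left Kan extension `L` of a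
monoidal functor along a tensor final one. -/
noncomputable def kanTensorIso (Y₁ Y₂ : B) : L.obj Y₁ ⊗ L.obj Y₂ ≅ L.obj (Y₁ ⊗ Y₂) :=
  (hg.exists_tensorIso (F := F) hu Y₁ Y₂).choose

lemma inj_kanTensorIso {Y₁ Y₂ : B} {X₁ X₂ : A} (φ₁ : g.obj X₁ ⟶ Y₁) (φ₂ : g.obj X₂ ⟶ Y₂) :
    (inj u φ₁ ⊗ₘ inj u φ₂) ≫ (kanTensorIso hg hu Y₁ Y₂).hom =
      μ F X₁ X₂ ≫ inj u (δ g X₁ X₂ ≫ (φ₁ ⊗ₘ φ₂)) :=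
  (hg.exists_tensorIso (F := F) hu Y₁ Y₂).choose_spec φ₁ φ₂

/-- A pointwise left Kan extension of a monoidal functor along a tensor final one is monoidal. -/
noncomputable abbrev kanMonoidal : L.Monoidal :=
  Functor.CoreMonoidal.toMonoidal
    { εIso := (hg.exists_unitIso (F := F) hu).choose
      μIso := kanTensorIso hg hu
      μIso_hom_natural_left := fun {Y Y'} f Z => by
        refine tensor_inj_ext hu fun X₁ X₂ φ₁ φ₂ => ?_
        rw [← tensorHom_id, tensorHom_comp_tensorHom_assoc, inj_map, Category.comp_id,
          inj_kanTensorIso, reassoc_of% inj_kanTensorIso hg hu, inj_map, Category.assoc,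
          ← tensorHom_id, tensorHom_comp_tensorHom, Category.comp_id]
      μIso_hom_natural_right := fun {Y Y'} Z f => by
        refine tensor_inj_ext hu fun X₁ X₂ φ₁ φ₂ => ?_
        rw [← id_tensorHom, tensorHom_comp_tensorHom_assoc, inj_map, Category.comp_id,
          inj_kanTensorIso, reassoc_of% inj_kanTensorIso hg hu, inj_map, Category.assoc,
          ← id_tensorHom, tensorHom_comp_tensorHom, Category.comp_id]
      associativity := fun Y₁ Y₂ Y₃ => by
        refine tensor_tensor_inj_ext hu fun X₁ X₂ X₃ φ₁ φ₂ φ₃ => ?_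
        rw [associator_naturality_assoc, ← tensorHom_id, ← id_tensorHom,
          tensorHom_comp_tensorHom_assoc, tensorHom_comp_tensorHom_assoc, inj_kanTensorIso,
          inj_kanTensorIso, Category.comp_id, Category.comp_id]
        have h₁ : (μ F X₁ X₂ ≫ inj u (δ g X₁ X₂ ≫ (φ₁ ⊗ₘ φ₂)) ⊗ₘ inj u φ₃) =
            (μ F X₁ X₂ ▷ F.obj X₃) ≫ (inj u (δ g X₁ X₂ ≫ (φ₁ ⊗ₘ φ₂)) ⊗ₘ inj u φ₃) := by
          rw [← tensorHom_id, tensorHom_comp_tensorHom, Category.id_comp]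
        have h₂ : (inj u φ₁ ⊗ₘ μ F X₂ X₃ ≫ inj u (δ g X₂ X₃ ≫ (φ₂ ⊗ₘ φ₃))) =
            (F.obj X₁ ◁ μ F X₂ X₃) ≫ (inj u φ₁ ⊗ₘ inj u (δ g X₂ X₃ ≫ (φ₂ ⊗ₘ φ₃))) := by
          rw [← id_tensorHom, tensorHom_comp_tensorHom, Category.id_comp]
        rw [h₁, h₂, Category.assoc, Category.assoc, inj_kanTensorIso,
          reassoc_of% inj_kanTensorIso hg hu, inj_map,
          ← Functor.LaxMonoidal.associativity_assoc, map_inj, FreeSym.arr_assoc]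
      left_unitality := fun Y => by
        rw [(hg.exists_unitIso (F := F) hu).choose_spec]
        refine inj_ext hu (tensorLeft (𝟙_ C)) Y fun X φ => ?_
        change 𝟙_ C ◁ inj u φ ≫ _ = 𝟙_ C ◁ inj u φ ≫ _
        rw [← tensorHom_id, ← id_tensorHom, tensorHom_comp_tensorHom_assoc, Category.comp_id,
          Category.id_comp]
        have h₁ : (ε F ≫ inj u (η g) ⊗ₘ inj u φ) =
            (ε F ▷ F.obj X) ≫ (inj u (η g) ⊗ₘ inj u φ) := by
          rw [← tensorHom_id, tensorHom_comp_tensorHom, Category.id_comp]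
        rw [h₁, Category.assoc, reassoc_of% inj_kanTensorIso hg hu, inj_map, FreeSym.arr_left,
          ← map_inj, ← Functor.LaxMonoidal.left_unitality_assoc, id_tensorHom,
          leftUnitor_naturality]
      right_unitality := fun Y => by
        rw [(hg.exists_unitIso (F := F) hu).choose_spec]
        refine inj_ext hu (tensorRight (𝟙_ C)) Y fun X φ => ?_
        change inj u φ ▷ 𝟙_ C ≫ _ = inj u φ ▷ 𝟙_ C ≫ _
        rw [← tensorHom_id, ← id_tensorHom, tensorHom_comp_tensorHom_assoc, Category.comp_id,
          Category.id_comp]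
        have h₁ : (inj u φ ⊗ₘ ε F ≫ inj u (η g)) =
            (F.obj X ◁ ε F) ≫ (inj u φ ⊗ₘ inj u (η g)) := by
          rw [← id_tensorHom, tensorHom_comp_tensorHom, Category.id_comp]
        rw [h₁, Category.assoc, reassoc_of% inj_kanTensorIso hg hu, inj_map, FreeSym.arr_right,
          ← map_inj, ← Functor.LaxMonoidal.right_unitality_assoc, tensorHom_id,
          rightUnitor_naturality] }

include hg hu in
-- Keeps only the two formulas that characterise the structure on structure maps; nothing else about
-- the construction is used later.
lemma exists_kanMonoidal : ∃ _ : L.Monoidal, ε L = ε F ≫ inj u (η g) ∧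
    ∀ {X₁ X₂ : A} {Y₁ Y₂ : B} (φ₁ : g.obj X₁ ⟶ Y₁) (φ₂ : g.obj X₂ ⟶ Y₂),
      (inj u φ₁ ⊗ₘ inj u φ₂) ≫ μ L Y₁ Y₂ = μ F X₁ X₂ ≫ inj u (δ g X₁ X₂ ≫ (φ₁ ⊗ₘ φ₂)) :=
  ⟨kanMonoidal hg hu, (hg.exists_unitIso (F := F) hu).choose_spec, inj_kanTensorIso hg hu⟩

end KanStructure

section KanBraided

variable {A : Type u₁} [Category.{v₁} A] [MonoidalCategory A] [SymmetricCategory A]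
  {B : Type u₂} [Category.{v₂} B] [MonoidalCategory B] [SymmetricCategory B]
  {C : Type u₃} [Category.{v₃} C] [MonoidalCategory C] [SymmetricCategory C]
  {g : A ⥤ B} [g.Braided]
  [∀ (Y : B) (X : C), PreservesColimitsOfShape (CostructuredArrow g Y) (tensorLeft X)]

instance (Y : B) (X : C) : PreservesColimitsOfShape (CostructuredArrow g Y) (tensorRight X) :=
  preservesColimitsOfShape_of_natIso (BraidedCategory.tensorLeftIsoTensorRight X)

/-- Pointwise left Kan extensions of symmetric monoidal functors along a tensor final functor are
symmetric monoidal, and universal among symmetric monoidal functors. -/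
lemma IsTensorFinal.exists_op (hg : IsTensorFinal g) (O : Op A C) {L : B ⥤ C}
    {u : O.functor ⟶ g ⋙ L} (hu : (Functor.LeftExtension.mk L u).IsPointwiseLeftKanExtension) :
    ∃ (_ : L.Braided) (κ : O ⟶ (pullback C g).obj ⟨L⟩), κ.trans = u ∧
      ∀ (P : Op B C) (τ : O ⟶ (pullback C g).obj P),
        ∃! σ : (⟨L⟩ : Op B C) ⟶ P, κ ≫ (pullback C g).map σ = τ := by
  obtain ⟨hL, hε, hμ⟩ := exists_kanMonoidal hg hu
  -- The braided structure has exactly `hL` as its monoidal part, so that `hε` and `hμ` remain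
  -- usable.
  obtain ⟨hB, rfl⟩ : ∃ hB : L.Braided, hB.toMonoidal = hL := ⟨
    { hL with
      braided := fun Y₁ Y₂ => by
        refine tensor_inj_ext hu fun X₁ X₂ φ₁ φ₂ => ?_
        rw [reassoc_of% hμ, inj_map, BraidedCategory.braiding_naturality_assoc, hμ,
          Category.assoc, BraidedCategory.braiding_naturality,
          ← Functor.LaxBraided.braided_assoc, map_inj, Functor.map_braiding]
        simp }, rfl⟩
  have hM : NatTrans.IsMonoidal u :=
    { unit := by
        change ε O.functor ≫ u.app _ = ε L ≫ L.map (ε g)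
        rw [hε, Category.assoc, inj_map, Functor.Monoidal.η_ε]
        simp [inj]
      tensor := fun X Y => by
        change μ O.functor X Y ≫ u.app _ = (u.app X ⊗ₘ u.app Y) ≫ μ L _ _ ≫ L.map (μ g X Y)
        have h := hμ (𝟙 (g.obj X)) (𝟙 (g.obj Y))
        simp only [inj, L.map_id, Category.comp_id, id_tensorHom_id] at h
        erw [Category.comp_id, Category.comp_id] at h
        rw [reassoc_of% h, ← L.map_comp, Functor.Monoidal.δ_μ, L.map_id, Category.comp_id] }
  refine ⟨hB, .mk u (isMonoidal := hM), rfl, fun P τ => ?_⟩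
  have : L.IsLeftKanExtension u := hu.isLeftKanExtension
  -- The Kan property gives a unique natural `d`; that `d` is monoidal is checked on structure maps,
  -- where `τ` determines it.
  let d : L ⟶ P.functor := L.descOfIsLeftKanExtension u P.functor τ.trans
  have hd {X : A} {Y : B} (φ : g.obj X ⟶ Y) :
      inj u φ ≫ d.app Y = transApp τ X ≫ P.functor.map φ := by
    rw [inj, Category.assoc, d.naturality, ← Category.assoc]
    exact congrArg (· ≫ _) (L.descOfIsLeftKanExtension_fac_app u P.functor τ.trans X)
  have : NatTrans.IsMonoidal d :=
    { unit := by
        rw [hε, Category.assoc, hd, reassoc_of% transApp_unit, ← Functor.map_comp,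
          Functor.Monoidal.ε_η, P.functor.map_id, Category.comp_id]
      tensor := fun Y₁ Y₂ => by
        refine tensor_inj_ext hu fun X₁ X₂ φ₁ φ₂ => ?_
        rw [reassoc_of% hμ, hd, tensorHom_comp_tensorHom_assoc, hd, hd,
          reassoc_of% transApp_tensor, ← Functor.map_comp, Functor.Monoidal.μ_δ_assoc,
          ← tensorHom_comp_tensorHom, Category.assoc, μ_natural] }
  refine ⟨⟨d⟩, OpHom.ext (L.descOfIsLeftKanExtension_fac u P.functor τ.trans),
    fun σ hσ => OpHom.ext ?_⟩
  exact L.hom_ext_of_isLeftKanExtension u _ _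
    ((congrArg OpHom.trans hσ).trans (L.descOfIsLeftKanExtension_fac u P.functor τ.trans).symm)

/-- Pushforwards along tensor final functors exist. -/
lemma IsTensorFinal.nonempty_pushforward (hg : IsTensorFinal g)
    [∀ Y : B, HasColimitsOfShape (CostructuredArrow g Y) C] : Nonempty (Pushforward C g) := by
  have h (O : Op A C) := hg.exists_op O
    (g.pointwiseLeftKanExtensionIsPointwiseLeftKanExtension O.functor)
  choose hB u hu σ hσ hσ' using h
  let e (O : Op A C) (P : Op B C) :
      ((⟨g.pointwiseLeftKanExtension O.functor⟩ : Op B C) ⟶ P) ≃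
        (O ⟶ (pullback C g).obj P) :=
    { toFun := fun τ => u O ≫ (pullback C g).map τ
      invFun := fun τ => σ O P τ
      left_inv := fun τ => (hσ' O P _ τ rfl).symm
      right_inv := fun τ => hσ O P τ }
  have he (O : Op A C) (P P' : Op B C) (k : P ⟶ P') (τ) :
      e O P' (τ ≫ k) = e O P τ ≫ (pullback C g).map k := by
    simp [e]
  refine ⟨⟨_, Adjunction.adjunctionOfEquivLeft e he, fun O => ?_⟩⟩
  -- The unit of the adjunction is the transformation of the Kan extension, so the pointwise formula
  -- holds with the required structure maps.
  have k : (Adjunction.adjunctionOfEquivLeft e he).unit.app O = u O := by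
    simp [e]
  rw [k]
  change Nonempty (Functor.LeftExtension.mk _ (u O).trans).IsPointwiseLeftKanExtension
  rw [hu]
  exact ⟨g.pointwiseLeftKanExtensionIsPointwiseLeftKanExtension O.functor⟩

end KanBraided

end FeynmanDec

namespace FeynmanDec

open Functor.LaxMonoidal Functor.OplaxMonoidal FreeSym

/-! ### Heredity of decorated categories -/

section Comap

variable {U : Type u₁} [Category.{v₁} U] {V : Type u₂} [Category.{v₂} V] {A : Type u₃}
  [Category.{v₃} A] [MonoidalCategory A] [SymmetricCategory A] {p : U ⥤ V}
  {L : FreeSym V ⥤ A} [L.Braided] {K : FreeSym U ⥤ A} [K.Braided]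

namespace IsHereditary

variable (hL : IsHereditary L) (e₀ : incl ⋙ mapWord p ⋙ L ≅ incl ⋙ K)

include hL e₀ in
-- Up to isomorphism `K` is `L` after `p^⊗`, so splittings along words of `V` pull back by `splits`.
-- Apart from essential surjectivity, all of heredity passes to `K` in this way.
lemma comap_split {x : FreeSym U} {Y₁ Y₂ : A} (φ : K.obj x ⟶ Y₁ ⊗ Y₂) :
    ∃ (x₁ x₂ : FreeSym U) (s : x ⟶ x₁ ⊗ x₂) (φ₁ : K.obj x₁ ⟶ Y₁) (φ₂ : K.obj x₂ ⟶ Y₂),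
      φ = K.map s ≫ δ K x₁ x₂ ≫ (φ₁ ⊗ₘ φ₂) := by
  let e : mapWord p ⋙ L ≅ K := extIso e₀
  obtain ⟨y₁, y₂, s, φ₁, φ₂, hs⟩ := hL.exists_split (e.hom.app x ≫ φ)
  obtain ⟨x₁, x₂, t, s₁, s₂, rfl, -, -⟩ := Splits.tensor_iff.1 (splits p s)
  refine ⟨x₁, x₂, t, e.inv.app x₁ ≫ L.map s₁ ≫ φ₁, e.inv.app x₂ ≫ L.map s₂ ≫ φ₂, ?_⟩
  have h₁ : (L.map (δ (mapWord p) x₁ x₂) ≫ δ L _ _) ≫ (e.hom.app x₁ ⊗ₘ e.hom.app x₂) =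
      e.hom.app (x₁ ⊗ x₂) ≫ δ K x₁ x₂ := extIso_δ e₀ x₁ x₂
  have h₂ : (e.hom.app x₁ ⊗ₘ e.hom.app x₂) ≫ (e.inv.app x₁ ⊗ₘ e.inv.app x₂) = 𝟙 _ := by
    simp [tensorHom_comp_tensorHom]
  have h₃ : L.map ((mapWord p).map t) ≫ e.hom.app _ = e.hom.app x ≫ K.map t := e.hom.naturality t
  rw [← cancel_epi (e.hom.app x), hs, ← tensorHom_comp_tensorHom, ← tensorHom_comp_tensorHom,
    ← reassoc_of% h₃, ← reassoc_of% h₁, reassoc_of% h₂, Functor.OplaxMonoidal.δ_natural_assoc,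
    ← L.map_comp_assoc, ← L.map_comp_assoc]
  simp only [Category.assoc]

include hL e₀ in
lemma comap_split_unique {x₁ x₂ y₁ y₂ : FreeSym U} {Y₁ Y₂ : A} (s : x₁ ⊗ x₂ ⟶ y₁ ⊗ y₂)
    (φ₁ : K.obj x₁ ⟶ Y₁) (φ₂ : K.obj x₂ ⟶ Y₂) (ψ₁ : K.obj y₁ ⟶ Y₁) (ψ₂ : K.obj y₂ ⟶ Y₂)
    (H : K.map s ≫ δ K y₁ y₂ ≫ (ψ₁ ⊗ₘ ψ₂) = δ K x₁ x₂ ≫ (φ₁ ⊗ₘ φ₂)) :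
    ∃ (s₁ : x₁ ⟶ y₁) (s₂ : x₂ ⟶ y₂), s = (s₁ ⊗ₘ s₂) ∧ K.map s₁ ≫ ψ₁ = φ₁ ∧
      K.map s₂ ≫ ψ₂ = φ₂ := by
  let e : mapWord p ⋙ L ≅ K := extIso e₀
  have h₁ (x₁ x₂ : FreeSym U) : L.map (δ (mapWord p) x₁ x₂) ≫ δ L _ _ ≫
      (e.hom.app x₁ ⊗ₘ e.hom.app x₂) = e.hom.app (x₁ ⊗ x₂) ≫ δ K x₁ x₂ :=
    (Category.assoc _ _ _).symm.trans (extIso_δ e₀ x₁ x₂)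
  have h₃ {x y : FreeSym U} (t : x ⟶ y) : L.map ((mapWord p).map t) ≫ e.hom.app y =
    e.hom.app x ≫ K.map t := e.hom.naturality t
  obtain ⟨t₁, t₂, ht, k₁, k₂⟩ := hL.split_unique
    (μ (mapWord p) x₁ x₂ ≫ (mapWord p).map s ≫ δ (mapWord p) y₁ y₂)
    (e.hom.app x₁ ≫ φ₁) (e.hom.app x₂ ≫ φ₂) (e.hom.app y₁ ≫ ψ₁) (e.hom.app y₂ ≫ ψ₂) (by
      rw [← tensorHom_comp_tensorHom, ← tensorHom_comp_tensorHom, Functor.map_comp,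
        Functor.map_comp, Category.assoc, Category.assoc, reassoc_of% h₁, reassoc_of% h₃, H,
        ← reassoc_of% h₁, ← L.map_comp_assoc, Functor.Monoidal.μ_δ, L.map_id, Category.id_comp])
  obtain ⟨s₁, s₂, rfl, rfl, rfl⟩ := exists_eq_tensorHom p s t₁ t₂ (by
    rw [← ht, Functor.Monoidal.δ_μ_assoc])
  refine ⟨s₁, s₂, rfl, ?_, ?_⟩
  · rw [← cancel_epi (e.hom.app x₁), ← k₁, reassoc_of% h₃]
  · rw [← cancel_epi (e.hom.app x₂), ← k₂, reassoc_of% h₃]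

include hL e₀ in
lemma comap_unit {x : FreeSym U} (φ : K.obj x ⟶ 𝟙_ A) :
    ∃ s : x ⟶ 𝟙_ _, φ = K.map s ≫ η K := by
  let e : mapWord p ⋙ L ≅ K := extIso e₀
  obtain ⟨s, hs⟩ := hL.exists_unit (e.hom.app x ≫ φ)
  obtain ⟨t, rfl⟩ := Splits.unit_iff.1 (splits p s)
  have h₁ : e.hom.app (𝟙_ _) ≫ η K = L.map (η (mapWord p)) ≫ η L := extIso_η e₀
  have h₃ : L.map ((mapWord p).map t) ≫ e.hom.app _ = e.hom.app x ≫ K.map t := e.hom.naturality t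
  refine ⟨t, ?_⟩
  rw [← cancel_epi (e.hom.app x), hs, ← reassoc_of% h₃, h₁, Functor.map_comp, Category.assoc]

end IsHereditary

end Comap

section DecoratedLift

variable {W : Type u₁} [Category.{v₁} W] [MonoidalCategory W] [SymmetricCategory W]
  {A : Type u₂} [Category.{v₂} A] [MonoidalCategory A] [SymmetricCategory A]

/-- A compatible choice of decorations of the values of a strong symmetric monoidal functor. -/
structure DecoratedLift (K : W ⥤ A) [K.Braided] (D : Decoration.{t} A) where
  dec : ∀ x : W, D.Fib (K.obj x)
  rel_map : ∀ {x y : W} (s : x ⟶ y), D.Rel (dec x) (dec y) (K.map s)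
  rel_ε : D.Rel D.unit (dec (𝟙_ W)) (ε K)
  rel_η : D.Rel (dec (𝟙_ W)) D.unit (η K)
  rel_μ : ∀ x y : W, D.Rel (D.tensor (dec x) (dec y)) (dec (x ⊗ y)) (μ K x y)
  rel_δ : ∀ x y : W, D.Rel (dec (x ⊗ y)) (D.tensor (dec x) (dec y)) (δ K x y)

namespace DecoratedLift

variable {K : W ⥤ A} [K.Braided] {D : Decoration.{t} A} (S : DecoratedLift K D)

/-- The lift of `K` to the decorated category. -/
def functor : W ⥤ Decorated D where
  obj x := ⟨K.obj x, S.dec x⟩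
  map s := ⟨K.map s, S.rel_map s⟩

instance functorMonoidal : S.functor.Monoidal :=
  Functor.CoreMonoidal.toMonoidal
    { εIso := Decorated.isoMk (Functor.Monoidal.εIso K) S.rel_ε S.rel_η
      μIso := fun x y =>
        Decorated.isoMk (Functor.Monoidal.μIso K x y) (S.rel_μ _ _) (S.rel_δ _ _)
      μIso_hom_natural_left := fun φ z => Decorated.hom_ext (μ_natural_left K φ z)
      μIso_hom_natural_right := fun z φ => Decorated.hom_ext (μ_natural_right K z φ)
      associativity := fun x y z => Decorated.hom_ext (associativity K x y z)
      left_unitality := fun x => Decorated.hom_ext (left_unitality K x)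
      right_unitality := fun x => Decorated.hom_ext (right_unitality K x) }

instance : S.functor.Braided where
  braided x y := Decorated.hom_ext (Functor.LaxBraided.braided (F := K) x y)

end DecoratedLift

end DecoratedLift

section

variable {V : Type u₁} [Category.{v₁} V] {A : Type u₂} [Category.{v₂} A] [MonoidalCategory A]
  [SymmetricCategory A] {C : Type u₃} [Category.{v₃} C] [MonoidalCategory C] [SymmetricCategory C]
  (ι : V ⥤ A) (O : Op A C)

/-- Words of decorated vertices as objects with a decomposed decoration. -/
def decomposedLift : DecoratedLift (wordObj ι O) (decomposed ι O) where
  dec x := ⟨x, Iso.refl _⟩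
  rel_map s := IsCompatible.of_map s (by simp)
  rel_ε := IsCompatible.of_map (𝟙 _) (by simp [decomposed])
  rel_η := IsCompatible.of_map (𝟙 _) (by simp [decomposed])
  rel_μ x y := IsCompatible.of_map (𝟙 _) (by simp [decomposed])
  rel_δ x y := IsCompatible.of_map (𝟙 _) (by simp [decomposed])

/-- Words of decorated vertices as objects decorated by the product of the elements. -/
def elementsLift : DecoratedLift (wordObj ι O) (elements O) where
  dec x := wordElt ι O x
  rel_map s := wordElt_map s
  rel_ε := wordElt_unit.symm
  rel_η := elt_inv O.functor (Functor.Monoidal.εIso (wordObj ι O)) wordElt_unit.symm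
  rel_μ x y := (wordElt_tensor x y).symm
  rel_δ x y := elt_inv O.functor (Functor.Monoidal.μIso (wordObj ι O) x y) (wordElt_tensor x y).symm

variable {ι O}

/-- Forgetting decorations is faithful, so uniqueness of splittings and the unit condition are
inherited from `A`. What depends on the decoration is that every object comes from a word and that
the pieces of a decorated morphism can be chosen decorated. -/
lemma IsHereditary.decorated (h : IsHereditary (lift ι)) {D : Decoration.{t} A}
    (S : DecoratedLift (wordObj ι O) D)
    (hiso : ∀ X : Decorated D, ∃ x, Nonempty (S.functor.obj x ≅ X))
    (hsplit : ∀ {x : FreeSym (DecVertex ι O)} {Y₁ Y₂ : A} {a₁ : D.Fib Y₁} {a₂ : D.Fib Y₂}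
      {φ : (wordObj ι O).obj x ⟶ Y₁ ⊗ Y₂}, D.Rel (S.dec x) (D.tensor a₁ a₂) φ →
      ∃ (x₁ x₂ : FreeSym (DecVertex ι O)) (s : x ⟶ x₁ ⊗ x₂) (φ₁ : (wordObj ι O).obj x₁ ⟶ Y₁)
        (φ₂ : (wordObj ι O).obj x₂ ⟶ Y₂), D.Rel (S.dec x₁) a₁ φ₁ ∧ D.Rel (S.dec x₂) a₂ φ₂ ∧
          φ = (wordObj ι O).map s ≫ δ (wordObj ι O) x₁ x₂ ≫ (φ₁ ⊗ₘ φ₂)) :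
    IsHereditary S.functor := by
  have e₀ : incl ⋙ mapWord (DecVertex.forget ι O) ⋙ lift ι ≅ incl ⋙ wordObj ι O :=
    Iso.refl (DecVertex.forget ι O ⋙ ι)
  refine ⟨hiso, ?_, ?_, ?_⟩
  · intro x Y₁ Y₂ φ
    obtain ⟨x₁, x₂, s, φ₁, φ₂, h₁, h₂, e⟩ := hsplit φ.rel
    exact ⟨x₁, x₂, s, ⟨φ₁, h₁⟩, ⟨φ₂, h₂⟩, Decorated.hom_ext e⟩
  · intro x₁ x₂ y₁ y₂ Y₁ Y₂ s φ₁ φ₂ ψ₁ ψ₂ H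
    obtain ⟨s₁, s₂, e, h₁, h₂⟩ := h.comap_split_unique e₀ s φ₁.hom φ₂.hom ψ₁.hom ψ₂.hom
      (congrArg Decorated.Hom.hom H)
    exact ⟨s₁, s₂, e, Decorated.hom_ext h₁, Decorated.hom_ext h₂⟩
  · intro x φ
    obtain ⟨s, e⟩ := h.comap_unit e₀ φ.hom
    exact ⟨s, Decorated.hom_ext e⟩

/-- Both conditions are built into the definition: an object is isomorphic to its word along its own
decomposition, and the tensor clause of `IsCompatible` is a decorated splitting. -/
lemma IsHereditary.decomposed (h : IsHereditary (lift ι)) :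
    IsHereditary (decomposedLift ι O).functor := by
  refine h.decorated _ ?_ ?_
  · rintro ⟨X, w, i⟩
    have h₁ : IsCompatible ι O w w (𝟙 _ ≫ i.hom ≫ i.inv) := by simpa using IsCompatible.id w
    have h₂ : IsCompatible ι O w w (i.hom ≫ i.inv ≫ 𝟙 _) := by simpa using IsCompatible.id w
    exact ⟨w, ⟨Decorated.isoMk i h₁ h₂⟩⟩
  · intro x Y₁ Y₂ a₁ a₂ φ hφ
    obtain ⟨x₁, x₂, s, φ₁, φ₂, e, h₁, h₂⟩ := IsCompatible.tensor_iff.1 hφ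
    refine ⟨x₁, x₂, s, φ₁ ≫ a₁.iso.hom, φ₂ ≫ a₂.iso.hom, ?_, ?_, ?_⟩
    · change IsCompatible _ _ _ _ _
      simpa [decomposedLift] using h₁
    · change IsCompatible _ _ _ _ _
      simpa [decomposedLift] using h₂
    · have e' := e =≫ (δ (wordObj ι O) _ _ ≫ (a₁.iso.hom ⊗ₘ a₂.iso.hom))
      simpa [decomposedLift, FeynmanDec.decomposed, tensorHom_comp_tensorHom] using e'

end

end FeynmanDec

namespace FeynmanDec

open Functor.LaxMonoidal Functor.OplaxMonoidal FreeSym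

/-! ### Elements in the Cartesian case -/

section Cartesian

variable {A : Type u₁} [Category.{v₁} A] [MonoidalCategory A] [SymmetricCategory A]
  {C : Type u₂} [Category.{v₂} C] [MonoidalCategory C] [SymmetricCategory C]

namespace IsCartesian

variable (hC : IsCartesian C) (O : A ⥤ C) [O.Braided]

include hC in
lemma elt_unit_ext (a b : 𝟙_ C ⟶ O.obj (𝟙_ A)) : a = b := by
  obtain ⟨t, -⟩ := hC
  exact (cancel_mono (η O)).1 (t.hom_ext _ _)

lemma mulElt_fst (t : IsTerminal (𝟙_ C)) {X Y : A} (a : 𝟙_ C ⟶ O.obj X) (b : 𝟙_ C ⟶ O.obj Y) :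
    mulElt O a b ≫ δ O X Y ≫ O.obj X ◁ t.from (O.obj Y) ≫ (ρ_ _).hom = a := by
  have h : b ≫ t.from (O.obj Y) = 𝟙 _ := t.hom_ext _ _
  rw [mulElt, Category.assoc, Category.assoc, Functor.Monoidal.μ_δ_assoc, ← id_tensorHom,
    tensorHom_comp_tensorHom_assoc, h, Category.comp_id, tensorHom_id, rightUnitor_naturality,
    unitors_inv_equal, Iso.inv_hom_id_assoc]

lemma mulElt_snd (t : IsTerminal (𝟙_ C)) {X Y : A} (a : 𝟙_ C ⟶ O.obj X) (b : 𝟙_ C ⟶ O.obj Y) :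
    mulElt O a b ≫ δ O X Y ≫ t.from (O.obj X) ▷ O.obj Y ≫ (λ_ _).hom = b := by
  have h : a ≫ t.from (O.obj X) = 𝟙 _ := t.hom_ext _ _
  rw [mulElt, Category.assoc, Category.assoc, Functor.Monoidal.μ_δ_assoc, ← tensorHom_id,
    tensorHom_comp_tensorHom_assoc, h, Category.comp_id, id_tensorHom, leftUnitor_naturality,
    Iso.inv_hom_id_assoc]

include hC in
-- Terminality of the unit suffices: discarding one factor of a product element returns the other.
lemma mulElt_injective {X Y : A} {a a' : 𝟙_ C ⟶ O.obj X} {b b' : 𝟙_ C ⟶ O.obj Y}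
    (h : mulElt O a b = mulElt O a' b') : a = a' ∧ b = b' := by
  obtain ⟨t, -⟩ := hC
  exact ⟨by rw [← mulElt_fst O t a b, h, mulElt_fst], by rw [← mulElt_snd O t a b, h, mulElt_snd]⟩

include hC in
-- Through `δ`, `O (X ⊗ Y)` is the product of `O X` and `O Y`, so `c` is recovered from its two
-- projections.
lemma exists_mulElt {X Y : A} (c : 𝟙_ C ⟶ O.obj (X ⊗ Y)) :
    ∃ (a : 𝟙_ C ⟶ O.obj X) (b : 𝟙_ C ⟶ O.obj Y), mulElt O a b = c := by
  obtain ⟨t, h⟩ := hC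
  obtain ⟨l⟩ := h (O.obj X) (O.obj Y)
  refine ⟨c ≫ δ O X Y ≫ O.obj X ◁ t.from (O.obj Y) ≫ (ρ_ _).hom,
    c ≫ δ O X Y ≫ t.from (O.obj X) ▷ O.obj Y ≫ (λ_ _).hom, ?_⟩
  rw [← cancel_mono (δ O X Y)]
  refine BinaryFan.IsLimit.hom_ext l ?_ ?_
  · exact (Category.assoc _ _ _).trans ((mulElt_fst O t _ _).trans (Category.assoc _ _ _).symm)
  · exact (Category.assoc _ _ _).trans ((mulElt_snd O t _ _).trans (Category.assoc _ _ _).symm)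

end IsCartesian

variable {V : Type u₃} [Category.{v₃} V] {ι : V ⥤ A} {O : Op A C}

/-- An element over a tensor word factors letter by letter, and a letter with an element is a
decorated vertex. -/
lemma exists_wordElt (hC : IsCartesian C) (x : FreeSym V) :
    ∀ a : 𝟙_ C ⟶ O.functor.obj ((lift ι).obj x), ∃ (w : FreeSym (DecVertex ι O))
      (i : (wordObj ι O).obj w ≅ (lift ι).obj x), wordElt ι O w ≫ O.functor.map i.hom = a := by
  induction x using IsCompatible.word_induction with
  | of v =>
    intro a
    exact ⟨incl.obj ⟨v, a⟩, Iso.refl _, (congrArg (a ≫ ·) (O.functor.map_id _)).trans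
      (Category.comp_id a)⟩
  | unit =>
    intro a
    exact ⟨𝟙_ _, Iso.refl _, hC.elt_unit_ext O.functor _ _⟩
  | tensor x y hx hy =>
    intro a
    obtain ⟨b, c, h⟩ := hC.exists_mulElt O.functor (a ≫ O.functor.map (δ (lift ι) x y))
    obtain ⟨w, i, rfl⟩ := hx b
    obtain ⟨z, j, rfl⟩ := hy c
    refine ⟨w ⊗ z, (Functor.Monoidal.μIso (wordObj ι O) w z).symm ≪≫ (i ⊗ᵢ j) ≪≫
      Functor.Monoidal.μIso (lift ι) x y, ?_⟩
    rw [← mulElt_map] at h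
    rw [wordElt_tensor, Category.assoc, ← Functor.map_comp]
    simp only [Iso.trans_hom, Iso.symm_hom, Functor.Monoidal.μIso_inv, Functor.Monoidal.μIso_hom,
      tensorIso_hom, Functor.Monoidal.μ_δ_assoc]
    rw [Functor.map_comp, reassoc_of% h, ← Functor.map_comp, Functor.Monoidal.δ_μ,
      O.functor.map_id]
    exact Category.comp_id _

/-- Elements factor over the letters, so every object comes from a word. An undecorated splitting is
automatically decorated, because a product element determines its factors. -/
lemma IsHereditary.elements (h : IsHereditary (lift ι)) (hC : IsCartesian C) :
    IsHereditary (elementsLift ι O).functor := by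
  refine h.decorated _ ?_ ?_
  · rintro ⟨X, a⟩
    change 𝟙_ C ⟶ O.functor.obj X at a
    obtain ⟨x, ⟨k⟩⟩ := h.exists_iso X
    obtain ⟨w, i, hw⟩ := exists_wordElt hC x (a ≫ O.functor.map k.inv)
    have e : wordElt ι O w ≫ O.functor.map (i ≪≫ k).hom = a := by
      rw [Iso.trans_hom, Functor.map_comp, reassoc_of% hw, ← Functor.map_comp, k.inv_hom_id,
        O.functor.map_id]
      exact Category.comp_id _
    exact ⟨w, ⟨Decorated.isoMk (i ≪≫ k) e (elt_inv O.functor (i ≪≫ k) e)⟩⟩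
  · intro x Y₁ Y₂ a₁ a₂ φ hφ
    obtain ⟨x₁, x₂, s, φ₁, φ₂, rfl⟩ := h.comap_split (K := wordObj ι O)
      (Iso.refl (DecVertex.forget ι O ⋙ ι)) φ
    change wordElt ι O x ≫ O.functor.map _ = mulElt O.functor a₁ a₂ at hφ
    rw [Functor.map_comp, Functor.map_comp, ← Category.assoc, wordElt_map, wordElt_tensor,
      Category.assoc, ← Functor.map_comp_assoc, Functor.Monoidal.μ_δ, O.functor.map_id,
      Category.id_comp, mulElt_map] at hφ
    obtain ⟨h₁, h₂⟩ := hC.mulElt_injective O.functor hφ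
    exact ⟨x₁, x₂, s, φ₁, φ₂, h₁, h₂, rfl⟩

end Cartesian

/-! ### Tensor finality of the functors in the square -/

section TensorFinal

variable {V : Type u₁} [Groupoid.{v₁} V] {A : Type u₂} [Category.{v₂} A] [MonoidalCategory A]
  [SymmetricCategory A] {V' : Type u₃} [Category.{v₃} V'] {B : Type u₄} [Category.{v₄} B]
  [MonoidalCategory B] [SymmetricCategory B]
  {C : Type u₅} [Category.{v₅} C] [MonoidalCategory C] [SymmetricCategory C]
  {ι : V ⥤ A} {ι' : V' ⥤ B} {v : V ⥤ V'} {f : A ⥤ B} [f.Braided]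

lemma isTensorFinal_of_square (h : IsHereditary (lift ι)) (h' : IsHereditary (lift ι'))
    (e : ι ⋙ f ≅ v ⋙ ι') : IsTensorFinal f :=
  h.isTensorFinal (p := v) h' (fun s => isIso_hom s) (show v ⋙ ι' ≅ ι ⋙ f from e.symm)

variable (O : Op A C)

/-- Needed so that morphisms of words of decorated vertices are invertible, as
`IsHereditary.isTensorFinal` requires. -/
noncomputable instance : Groupoid (DecVertex ι O) :=
  Groupoid.ofIsIso fun {p q} g =>
    ⟨⟨inv g.hom, by
      rw [← g.rel, Category.assoc, ← Functor.map_comp, ← Functor.map_comp, IsIso.hom_inv_id]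
      simp⟩, DecVertex.Hom.ext (IsIso.hom_inv_id g.hom), DecVertex.Hom.ext (IsIso.inv_hom_id g.hom)⟩

variable {O}

lemma isTensorFinal_forget (h : IsHereditary (lift ι)) {D : Decoration.{t} A}
    {S : DecoratedLift (wordObj ι O) D} (hS : IsHereditary S.functor) :
    IsTensorFinal (Decorated.forget D) :=
  hS.isTensorFinal (p := DecVertex.forget ι O) h (fun s => isIso_hom s)
    (Iso.refl (DecVertex.forget ι O ⋙ ι))

variable {P : Op B C} (σ : O ⟶ (pullback C f).obj P)

/-- On letters the functor is `vertexMap e σ`, so it remains to see that the components of `e`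
respect the elements; they do because `vertexMap` is defined by transport along `e`. -/
lemma isTensorFinal_elementsMap (e : ι ⋙ f ≅ v ⋙ ι') (h : IsHereditary (lift ι)) (h' : IsHereditary (lift ι'))
    (hC : IsCartesian C) : IsTensorFinal (elementsMap σ).functor := by
  have k (p : DecVertex ι O) : (elements P).Rel
      (wordElt ι' P (incl.obj ((vertexMap e σ).obj p))) (p.elt ≫ transApp σ _) (e.inv.app p.vertex) :=
    elt_inv P.functor (e.app p.vertex) rfl
  let e₀ : incl ⋙ mapWord (vertexMap e σ) ⋙ (elementsLift ι' P).functor ≅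
      incl ⋙ (elementsLift ι O).functor ⋙ (elementsMap σ).functor :=
    NatIso.ofComponents (fun p => Decorated.isoMk (e.symm.app p.vertex) (k p) rfl)
      fun g => Decorated.hom_ext (e.inv.naturality g.hom)
  exact (h.elements hC).isTensorFinal (h'.elements hC) (fun s => isIso_hom s) e₀

lemma isTensorFinal_decomposedMap (e : ι ⋙ f ≅ v ⋙ ι') (h : IsHereditary (lift ι)) (h' : IsHereditary (lift ι')) :
    IsTensorFinal (decomposedMap e σ).functor := by
  -- On a letter the induced decomposition of `f (ι w)` is the inverse of `e`, so in both directions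
  -- the comparison is compatible through the identity of the word.
  have k (p : DecVertex ι O) : e.inv.app p.vertex =
      (wordIsoApp e σ (incl.obj p) ≪≫ f.mapIso (Iso.refl _)).hom :=
    ((congrArg (e.inv.app p.vertex ≫ ·) (f.map_id _)).trans (Category.comp_id _)).symm
  have k₁ (p : DecVertex ι O) := IsCompatible.of_map (ι := ι') (O := P)
    (x := incl.obj ((vertexMap e σ).obj p)) (φ := e.inv.app p.vertex) (k := Iso.refl _) (l := wordIsoApp e σ (incl.obj p) ≪≫ f.mapIso (Iso.refl _)) (𝟙 _)
    ((Category.id_comp _).trans ((k p).trans (Category.id_comp _).symm))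
  have k₂ (p : DecVertex ι O) := IsCompatible.of_map (ι := ι') (O := P)
    (y := incl.obj ((vertexMap e σ).obj p)) (φ := e.hom.app p.vertex)
    (k := wordIsoApp e σ (incl.obj p) ≪≫ f.mapIso (Iso.refl _)) (l := Iso.refl _) (𝟙 _)
    (by
      rw [← k]
      exact (e.inv_hom_id_app p.vertex).trans (Category.id_comp _).symm)
  let e₀ : incl ⋙ mapWord (vertexMap e σ) ⋙ (decomposedLift ι' P).functor ≅
      incl ⋙ (decomposedLift ι O).functor ⋙ (decomposedMap e σ).functor :=
    NatIso.ofComponents (fun p => Decorated.isoMk (e.symm.app p.vertex) (k₁ p) (k₂ p))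
      fun g => Decorated.hom_ext (e.inv.naturality g.hom)
  exact h.decomposed.isTensorFinal h'.decomposed (fun s => isIso_hom s) e₀

end TensorFinal

end FeynmanDec

namespace FeynmanDec

open Functor.LaxMonoidal Functor.OplaxMonoidal FreeSym

/-! ### Essential smallness of slices -/

section Smallness

variable {J : Type u₁} [Category.{v₁} J] {J' : Type u₂} [Category.{v₂} J']

lemma essentiallySmall_of_family {S : Type w} (d : S → J) (hd : ∀ j, ∃ s, Nonempty (j ≅ d s))
    (hs : ∀ s s', Small.{w} (d s ⟶ d s')) : EssentiallySmall.{w} J := by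
  refine (essentiallySmall_iff J).2 ⟨?_, ⟨fun j j' => ?_⟩⟩
  · refine small_of_surjective (f := fun s : S => toSkeleton (d s)) fun j => ?_
    obtain ⟨s, ⟨i⟩⟩ := hd (fromSkeleton J |>.obj j)
    refine ⟨s, ?_⟩
    have := (toSkeleton_eq_iff).2 ⟨i.symm⟩
    exact this
  · obtain ⟨s, ⟨i⟩⟩ := hd j
    obtain ⟨s', ⟨i'⟩⟩ := hd j'
    have := hs s s'
    exact small_map (Iso.homCongr i i')

lemma exists_family [EssentiallySmall.{w} J] :
    ∃ (S : Type w) (d : S → J), ∀ j, ∃ s, Nonempty (j ≅ d s) :=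
  ⟨SmallModel.{w} J, (equivSmallModel J).inverse.obj, fun j =>
    ⟨(equivSmallModel J).functor.obj j, ⟨(equivSmallModel J).unitIso.app j⟩⟩⟩

/-- Faithfulness bounds the morphisms. The isomorphism classes are covered by a small union, over
representatives of `J'`, of the small families lying above them. -/
lemma essentiallySmall_of_faithful (G : J ⥤ J') [G.Faithful] [EssentiallySmall.{w} J']
    (h : ∀ k : J', ∃ (S : Type w) (d : S → J), ∀ j, Nonempty (G.obj j ≅ k) →
      ∃ s, Nonempty (j ≅ d s)) : EssentiallySmall.{w} J := by
  obtain ⟨T, k, hk⟩ := exists_family.{w} (J := J')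
  choose S d hd using h
  have := locallySmall_of_faithful.{w} G
  refine essentiallySmall_of_family (S := Σ t : T, S (k t)) (fun x => d _ x.2) (fun j => ?_)
    fun _ _ => inferInstance
  obtain ⟨t, ht⟩ := hk (G.obj j)
  obtain ⟨s, hs⟩ := hd _ j ht
  exact ⟨⟨t, s⟩, hs⟩

end Smallness

section Over

variable {A : Type u₁} [Category.{v₁} A] [MonoidalCategory A]

lemma essentiallySmall_over_of_iso {X Y : A} (i : X ≅ Y) (h : EssentiallySmall.{w} (Over X)) :
    EssentiallySmall.{w} (Over Y) :=
  (essentiallySmall_congr (Over.mapIso i)).1 h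

/-- Tensor finality of the identity says that tensoring the slices over `Y₁` and `Y₂` reaches all
objects and morphisms over `Y₁ ⊗ Y₂`. -/
lemma IsTensorFinal.essentiallySmall_over_tensor (hA : IsTensorFinal (𝟭 A)) {Y₁ Y₂ : A}
    (h₁ : EssentiallySmall.{w} (Over Y₁)) (h₂ : EssentiallySmall.{w} (Over Y₂)) :
    EssentiallySmall.{w} (Over (Y₁ ⊗ Y₂)) := by
  obtain ⟨S₁, d₁, hd₁⟩ := exists_family.{w} (J := Over Y₁)
  obtain ⟨S₂, d₂, hd₂⟩ := exists_family.{w} (J := Over Y₂)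
  refine essentiallySmall_of_family (S := S₁ × S₂)
    (fun s => Over.mk ((d₁ s.1).hom ⊗ₘ (d₂ s.2).hom)) (fun j => ?_) fun s s' => ?_
  · obtain ⟨X₁, X₂, i, φ₁, φ₂, h⟩ := hA.exists_split j.hom
    obtain ⟨s₁, ⟨i₁⟩⟩ := hd₁ (Over.mk φ₁)
    obtain ⟨s₂, ⟨i₂⟩⟩ := hd₂ (Over.mk φ₂)
    refine ⟨⟨s₁, s₂⟩, ⟨Over.isoMk (i ≪≫ ((Over.forget _).mapIso i₁ ⊗ᵢ
      (Over.forget _).mapIso i₂)) ?_⟩⟩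
    have k₁ : i₁.hom.left ≫ (d₁ s₁).hom = φ₁ := Over.w i₁.hom
    have k₂ : i₂.hom.left ≫ (d₂ s₂).hom = φ₂ := Over.w i₂.hom
    have h' : j.hom = i.hom ≫ (φ₁ ⊗ₘ φ₂) := h.trans (congrArg (i.hom ≫ ·) (Category.id_comp _))
    change (i.hom ≫ (i₁.hom.left ⊗ₘ i₂.hom.left)) ≫ ((d₁ s₁).hom ⊗ₘ (d₂ s₂).hom) = j.hom
    rw [Category.assoc, tensorHom_comp_tensorHom, k₁, k₂]
    exact h'.symm
  · refine small_of_surjective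
      (f := fun m : (d₁ s.1 ⟶ d₁ s'.1) × (d₂ s.2 ⟶ d₂ s'.2) =>
        (Over.homMk (m.1.left ⊗ₘ m.2.left) (by
          change (m.1.left ⊗ₘ m.2.left) ≫ ((d₁ s'.1).hom ⊗ₘ (d₂ s'.2).hom) = (_ ⊗ₘ _)
          rw [tensorHom_comp_tensorHom, Over.w, Over.w]) :
            Over.mk ((d₁ s.1).hom ⊗ₘ (d₂ s.2).hom) ⟶
              Over.mk ((d₁ s'.1).hom ⊗ₘ (d₂ s'.2).hom))) fun m => ?_
    obtain ⟨m₁, m₂, e, e₁, e₂⟩ := hA.split_map (X₁ := (d₁ s.1).left) (X₂ := (d₂ s.2).left)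
      (Z₁ := (d₁ s'.1).left) (Z₂ := (d₂ s'.2).left) m.left (d₁ s.1).hom (d₂ s.2).hom
      (d₁ s'.1).hom (d₂ s'.2).hom (by
        refine (congrArg (m.left ≫ ·) (Category.id_comp _)).trans ?_
        exact (Over.w m).trans (Category.id_comp _).symm)
    exact ⟨⟨Over.homMk m₁ e₁, Over.homMk m₂ e₂⟩, Over.OverMorphism.ext e.symm⟩

lemma IsTensorFinal.essentiallySmall_over_unit (hA : IsTensorFinal (𝟭 A))
    (h : ∀ {X : A} (φ : X ⟶ 𝟙_ A), IsIso φ) : EssentiallySmall.{w} (Over (𝟙_ A)) := by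
  refine essentiallySmall_of_family (S := PUnit) (fun _ => Over.mk (𝟙 _))
    (fun j => ⟨⟨⟩, ?_⟩) fun _ _ => ?_
  · have := h j.hom
    exact ⟨Over.isoMk (asIso j.hom)⟩
  · have : Subsingleton ((Over.mk (𝟙 (𝟙_ A))) ⟶ Over.mk (𝟙 (𝟙_ A))) :=
      ⟨fun a b => Over.OverMorphism.ext (hA.unit_unique _ _)⟩
    infer_instance

variable [SymmetricCategory A] {V : Type u₂} [Groupoid.{v₂} V] {ι : V ⥤ A}

/-- Every object is a tensor word of letters. The size condition treats letters, and heredity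
propagates smallness to words. -/
lemma IsFeynmanCategory.essentiallySmall_over (h : IsFeynmanCategory.{w} ι) (X : A) :
    EssentiallySmall.{w} (Over X) := by
  have hA : IsTensorFinal (𝟭 A) :=
    isTensorFinal_of_square (v := 𝟭 V) h.isHereditary h.isHereditary (Iso.refl ι)
  obtain ⟨x, ⟨i⟩⟩ := h.isHereditary.exists_iso X
  refine essentiallySmall_over_of_iso i ?_
  clear i
  induction x using IsCompatible.word_induction with
  | of v => exact h.size_condition v
  | unit =>
    -- A morphism to the unit comes from a morphism of words, and these are invertible.
    refine hA.essentiallySmall_over_unit fun {X} φ => ?_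
    obtain ⟨x, ⟨i⟩⟩ := h.isHereditary.exists_iso X
    obtain ⟨s, hs⟩ := h.isHereditary.exists_unit (i.hom ≫ φ)
    have := isIso_hom s
    rw [← Iso.eq_inv_comp] at hs
    rw [hs]
    infer_instance
  | tensor x y hx hy => exact hA.essentiallySmall_over_tensor hx hy

lemma IsFeynmanCategory.exists_map_eq (h : IsFeynmanCategory.{w} ι) {x y : FreeSym V}
    (i : (lift ι).obj x ≅ (lift ι).obj y) : ∃ s : x ⟶ y, (lift ι).map s = i.hom := by
  have := h.isomorphism_condition
  obtain ⟨s, hs⟩ := (Core.functorToCore (lift ι)).map_surjective (X := x) (Y := y) ⟨i⟩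
  exact ⟨s, congrArg (fun j => j.iso.hom) hs⟩

end Over

/-! ### Smallness of decorations and of decorated comma categories -/

section Fibres

variable {A : Type u₁} [Category.{v₁} A] [MonoidalCategory A] [SymmetricCategory A]

/-- A decoration with, up to isomorphism, a small set of decorations of every object. -/
def HasSmallFibres (D : Decoration.{t} A) : Prop :=
  ∀ X : A, ∃ (S : Type w) (d : S → D.Fib X), ∀ (a : Decorated D) (k : a.obj ≅ X),
    ∃ s, D.Rel a.dec (d s) k.hom ∧ D.Rel (d s) a.dec k.inv

variable {C : Type u₂} [Category.{w} C] [MonoidalCategory C] [SymmetricCategory C]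

/-- The morphisms of `C` live in the universe `w`, so all elements of `O X` may be taken. -/
lemma hasSmallFibres_elements (O : Op A C) : HasSmallFibres.{w} (elements O) := fun X =>
  ⟨𝟙_ C ⟶ O.functor.obj X, fun a => a, fun a k =>
    ⟨(show 𝟙_ C ⟶ O.functor.obj a.obj from a.dec) ≫ O.functor.map k.hom, rfl,
      elt_inv O.functor k rfl⟩⟩

variable {V : Type u₃}

/-- A decorated word lying over `x` amounts to a choice of one element for each letter of `x`, and
the elements over a letter form a `w`-small set. -/
lemma exists_small_words [Category.{v₃} V] {ι : V ⥤ A} (O : Op A C) (x : FreeSym V) :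
    ∃ (S : Type w) (d : S → FreeSym (DecVertex ι O))
      (j : ∀ s, (mapWord (DecVertex.forget ι O)).obj (d s) ⟶ x),
      ∀ (y : FreeSym (DecVertex ι O)) (k : (mapWord (DecVertex.forget ι O)).obj y ⟶ x),
        ∃ (s : S) (r : y ⟶ d s), k = (mapWord (DecVertex.forget ι O)).map r ≫ j s := by
  induction x using IsCompatible.word_induction with
  | of v =>
    refine ⟨𝟙_ C ⟶ O.functor.obj (ι.obj v), fun a => incl.obj ⟨v, a⟩, fun a => 𝟙 _,
      fun y k => ?_⟩
    obtain ⟨q, r, g, rfl⟩ := Splits.of_iff.1 (splits _ k)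
    change q.vertex ⟶ v at g
    -- The element of `q` is pushed forward along `g`, so that the decorated vertex sits over `v`
    -- itself.
    let m : q ⟶ (⟨v, q.elt ≫ O.functor.map (ι.map g)⟩ : DecVertex ι O) := ⟨g, rfl⟩
    exact ⟨q.elt ≫ O.functor.map (ι.map g), r ≫ incl.map m,
      ((Category.comp_id _).trans ((mapWord (DecVertex.forget ι O)).map_comp r (incl.map m))).symm⟩
  | unit =>
    refine ⟨PUnit, fun _ => 𝟙_ _, fun _ => η _, fun y k => ?_⟩
    obtain ⟨r, rfl⟩ := Splits.unit_iff.1 (splits _ k)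
    exact ⟨⟨⟩, r, rfl⟩
  | tensor x₁ x₂ h₁ h₂ =>
    obtain ⟨S₁, d₁, j₁, H₁⟩ := h₁
    obtain ⟨S₂, d₂, j₂, H₂⟩ := h₂
    refine ⟨S₁ × S₂, fun s => d₁ s.1 ⊗ d₂ s.2, fun s => δ (mapWord _) _ _ ≫ (j₁ s.1 ⊗ₘ j₂ s.2),
      fun y k => ?_⟩
    obtain ⟨y₁, y₂, r, k₁, k₂, rfl, -, -⟩ := Splits.tensor_iff.1 (splits _ k)
    obtain ⟨s₁, r₁, rfl⟩ := H₁ y₁ k₁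
    obtain ⟨s₂, r₂, rfl⟩ := H₂ y₂ k₂
    refine ⟨⟨s₁, s₂⟩, r ≫ (r₁ ⊗ₘ r₂), ?_⟩
    rw [Functor.map_comp, Category.assoc, ← tensorHom_comp_tensorHom,
      Functor.OplaxMonoidal.δ_natural_assoc]

lemma IsFeynmanCategory.hasSmallFibres_decomposed [Groupoid.{v₃} V] {ι : V ⥤ A}
    (h : IsFeynmanCategory.{w} ι) (O : Op A C) : HasSmallFibres.{w} (decomposed ι O) := by
  intro X
  obtain ⟨x, ⟨i⟩⟩ := h.isHereditary.exists_iso X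
  obtain ⟨S, d, j, H⟩ := exists_small_words (ι := ι) O x
  let e : mapWord (DecVertex.forget ι O) ⋙ lift ι ≅ wordObj ι O :=
    extIso (Iso.refl (DecVertex.forget ι O ⋙ ι))
  have := fun s => isIso_hom (j s)
  refine ⟨S, fun s => ⟨d s, e.symm.app _ ≪≫ (lift ι).mapIso (asIso (j s)) ≪≫ i⟩, ?_⟩
  rintro ⟨X', y, l⟩ k
  -- The given decomposition and the fixed one of `X` differ by an isomorphism between words, which
  -- by the isomorphism condition is a morphism of `V^⊗` and so is covered by `H`.
  obtain ⟨m, hm⟩ := h.exists_map_eq (x := (mapWord (DecVertex.forget ι O)).obj y) (y := x)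
    (e.app y ≪≫ l ≪≫ k ≪≫ i.symm)
  obtain ⟨s, r, rfl⟩ := H y m
  have hr : (lift ι).map ((mapWord (DecVertex.forget ι O)).map r) ≫ e.hom.app (d s) =
    e.hom.app y ≫ (wordObj ι O).map r := e.hom.naturality r
  have key : l.hom ≫ k.hom = (wordObj ι O).map r ≫
      (e.symm.app _ ≪≫ (lift ι).mapIso (asIso (j s)) ≪≫ i).hom := by
    rw [← cancel_epi (e.hom.app y), ← reassoc_of% hr, ← cancel_mono i.inv]
    simpa using hm.symm
  have := isIso_hom r
  exact ⟨s, IsCompatible.of_map r key,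
    IsCompatible.of_map (inv r) (arr_inv (asIso r) k key)⟩

end Fibres

section DecoratedSmall

variable {A : Type u₁} [Category.{v₁} A] [MonoidalCategory A] [SymmetricCategory A]
  {B : Type u₂} [Category.{v₂} B] {B' : Type u₃} [Category.{v₃} B']

/-- Forgetting decorations gives a faithful functor from `(H ↓ Y)` to `(f ↓ r Y)`. Above a fixed
object `k` lie the decorations of its source for which the structure map of `k` lifts along `r`, and
only a small set of these is needed. -/
lemma HasSmallFibres.essentiallySmall {D : Decoration.{t} A} (hD : HasSmallFibres.{w} D)
    (H : Decorated D ⥤ B') (f : A ⥤ B) (r : B' ⥤ B) [r.Faithful]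
    (c : ∀ x : Decorated D, f.obj x.obj ≅ r.obj (H.obj x))
    (hc : ∀ {x y : Decorated D} (m : x ⟶ y), f.map m.hom ≫ (c y).hom = (c x).hom ≫ r.map (H.map m))
    (Y : B') [EssentiallySmall.{w} (CostructuredArrow f (r.obj Y))] :
    EssentiallySmall.{w} (CostructuredArrow H Y) := by
  let G : CostructuredArrow H Y ⥤ CostructuredArrow f (r.obj Y) :=
    { obj := fun j => CostructuredArrow.mk ((c j.left).hom ≫ r.map j.hom)
      map := fun {j j'} m => CostructuredArrow.homMk m.left.hom (by
        change f.map m.left.hom ≫ (c j'.left).hom ≫ r.map j'.hom = (c j.left).hom ≫ r.map j.hom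
        rw [reassoc_of% hc, ← r.map_comp, CostructuredArrow.w]) }
  have : G.Faithful := ⟨fun {j j'} m m' h => CostructuredArrow.hom_ext _ _
    (Decorated.hom_ext (congrArg (fun z => z.left) h))⟩
  refine essentiallySmall_of_faithful G fun k => ?_
  obtain ⟨S, d, hd⟩ := hD k.left
  -- The lift `ψ` need not be part of the index: it is unique because `r` is faithful, so any choice
  -- will do.
  let T := {s : S // ∃ ψ : H.obj ⟨k.left, d s⟩ ⟶ Y, (c ⟨k.left, d s⟩).hom ≫ r.map ψ = k.hom}
  refine ⟨T, fun s => CostructuredArrow.mk s.2.choose, fun j => ?_⟩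
  rintro ⟨i⟩
  obtain ⟨s, h₁, h₂⟩ := hd j.left ((CostructuredArrow.proj _ _).mapIso i)
  let I : j.left ≅ ⟨k.left, d s⟩ := Decorated.isoMk ((CostructuredArrow.proj _ _).mapIso i) h₁ h₂
  have hI : (c ⟨k.left, d s⟩).hom ≫ r.map (H.map I.inv ≫ j.hom) = k.hom := by
    rw [r.map_comp, ← reassoc_of% hc]
    exact CostructuredArrow.w i.inv
  let s' : T := ⟨s, _, hI⟩
  refine ⟨s', ⟨CostructuredArrow.isoMk I ?_⟩⟩
  change H.map I.hom ≫ s'.2.choose = j.hom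
  have : s'.2.choose = H.map I.inv ≫ j.hom := r.map_injective (by
    rw [← cancel_epi (c ⟨k.left, d s⟩).hom, hI]
    exact s'.2.choose_spec)
  rw [this, ← H.map_comp_assoc]
  simp

end DecoratedSmall

end FeynmanDec

/-! ### The square of adjunctions -/

namespace FeynmanDec

open FreeSym

section

variable {A : Type u₁} [Category.{v₁} A] [MonoidalCategory A] [SymmetricCategory A]
  {B : Type u₂} [Category.{v₂} B] [MonoidalCategory B] [SymmetricCategory B]
  {C : Type u₃} [Category.{w} C] [MonoidalCategory C] [SymmetricCategory C]
  [HasColimitsOfSize.{w, w} C] [∀ X : C, PreservesColimitsOfSize.{w, w} (tensorLeft X)]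

instance (D : Decoration.{t} A) : (Decorated.forget D).Faithful :=
  ⟨fun h => Decorated.hom_ext h⟩

lemma IsTensorFinal.nonempty_pushforward_of_essentiallySmall {g : A ⥤ B} [g.Braided]
    (hg : IsTensorFinal g) (h : ∀ Y : B, EssentiallySmall.{w} (CostructuredArrow g Y)) :
    Nonempty (Pushforward C g) := by
  have (Y : B) : HasColimitsOfShape (CostructuredArrow g Y) C :=
    hasColimitsOfShape_of_essentiallySmall.{w, w} _ C
  have (Y : B) (X : C) : PreservesColimitsOfShape (CostructuredArrow g Y) (tensorLeft X) :=
    preservesColimitsOfShape_of_equiv (equivSmallModel.{w} (CostructuredArrow g Y)).symm _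
  exact hg.nonempty_pushforward

variable (C) in
-- Smallness is the case of the comparison in which both undecorated functors are identities, so
-- that the undecorated comma category is the slice over `Y`.
lemma nonempty_pushforward_forget {D : Decoration.{t} A}
    (hD : HasSmallFibres.{w} D) (hA : ∀ X : A, EssentiallySmall.{w} (Over X))
    (h : IsTensorFinal (Decorated.forget D)) : Nonempty (Pushforward C (Decorated.forget D)) :=
  h.nonempty_pushforward_of_essentiallySmall fun Y =>
    have : EssentiallySmall.{w} (CostructuredArrow (𝟭 A) ((𝟭 A).obj Y)) := hA Y
    hD.essentiallySmall (Decorated.forget D) (𝟭 A) (𝟭 A) (fun _ => Iso.refl _)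
      (fun m => (Category.comp_id m.hom).trans (Category.id_comp m.hom).symm) Y

/-- The square of a map of decorations is a square of adjunctions as soon as its functors are tensor
final and the decorations have small fibres. -/
lemma adjointSquare {f : A ⥤ B} [f.Braided] (hA : ∀ X : A, EssentiallySmall.{w} (Over X))
    (hB : ∀ Y : B, EssentiallySmall.{w} (Over Y))
    (hf : ∀ Y : B, EssentiallySmall.{w} (CostructuredArrow f Y)) (p : Pushforward C f)
    {D : Decoration.{t} A} {E : Decoration.{t'} B} (m : DecorationMap f D E)
    (hD : HasSmallFibres.{w} D) (hE : HasSmallFibres.{w} E)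
    (hDf : IsTensorFinal (Decorated.forget D)) (hEf : IsTensorFinal (Decorated.forget E))
    (hm : IsTensorFinal m.functor) : AdjointSquare C p m := by
  refine ⟨hm.nonempty_pushforward_of_essentiallySmall fun Y => ?_,
    nonempty_pushforward_forget C hD hA hDf, nonempty_pushforward_forget C hE hB hEf,
    -- The conjugate of an isomorphism of right adjoints is an isomorphism, whatever the chosen
    -- pushforwards.
    fun q l r => inferInstance⟩
  have := hf ((Decorated.forget E).obj Y)
  exact hD.essentiallySmall m.functor f (Decorated.forget E) (fun _ => Iso.refl _)
    (fun φ => (Category.comp_id (f.map φ.hom)).trans (Category.id_comp (f.map φ.hom)).symm) Y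

end

end FeynmanDec

theorem mainTheorem4
    {V : Type u₁} [Groupoid.{v₁} V]
    {F : Type u₂} [Category.{v₂} F] [MonoidalCategory F] [SymmetricCategory F]
    {V' : Type u₃} [Groupoid.{v₃} V']
    {F' : Type u₄} [Category.{v₄} F'] [MonoidalCategory F'] [SymmetricCategory F']
    {C : Type u₅} [Category.{w} C] [MonoidalCategory C] [SymmetricCategory C]
    [HasColimitsOfSize.{w, w} C] [∀ X : C, PreservesColimitsOfSize.{w, w} (tensorLeft X)]
    {ι : V ⥤ F} (hι : IsFeynmanCategory.{w} ι) {ι' : V' ⥤ F'} (hι' : IsFeynmanCategory.{w} ι')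
    (v : V ⥤ V') (f : F ⥤ F') [f.Braided] (e : ι ⋙ f ≅ v ⋙ ι')
    (hf : ∀ X' : F', EssentiallySmall.{w} (CostructuredArrow f X')) :
    Nonempty (Pushforward C f) ∧ ∀ (p : Pushforward C f) (O : Op F C),
      (IsCartesian C → AdjointSquare C p (elementsMap (p.adj.unit.app O))) ∧
        AdjointSquare C p (decomposedMap e (p.adj.unit.app O)) := by
  have h := hι.isHereditary
  have h' := hι'.isHereditary
  refine ⟨(isTensorFinal_of_square h h' e).nonempty_pushforward_of_essentiallySmall hf,
    fun p O => ⟨fun hC => ?_, ?_⟩⟩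
  · exact adjointSquare hι.essentiallySmall_over hι'.essentiallySmall_over hf p _
      (hasSmallFibres_elements O) (hasSmallFibres_elements _)
      (isTensorFinal_forget h (h.elements hC)) (isTensorFinal_forget h' (h'.elements hC))
      (isTensorFinal_elementsMap _ e h h' hC)
  · exact adjointSquare hι.essentiallySmall_over hι'.essentiallySmall_over hf p _
      (hι.hasSmallFibres_decomposed O) (hι'.hasSmallFibres_decomposed _)
      (isTensorFinal_forget h h.decomposed) (isTensorFinal_forget h' h'.decomposed)
      (isTensorFinal_decomposedMap _ e h h')
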